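/- Let $S=\mathbb N\times\mathbb N\times\mathbb N^*$ (with $0\in\mathbb N$), write $p=(a,b,m)\in S$, and for $c,f:S\to\mathbb R$ let $\langle c,f\rangle=\langle f,c\rangle=\sum_{p\in S}c(p)f(p)$, where $a$, $b$, $m$ also denote the coordinate functions on $S$. For $p=(a,b,m)$ and $p'=(a',b',m')$ put $p.p'=a'b+ab'$; write $p'\preceq p$ if $a'\le a+1$, $b'\le b+1$, $m'\le m-1$, and then $p\backslash p'=(a+1-a',b+1-b',m-m')$. For $0<T\le\infty$, a solution on $[0,T)$ of the sexed Smoluchowski system with initial condition $c_0:S\to\mathbb R$ is a family $(c_t(p))_{p\in S,\,t\in[0,T)}$ of real numbers, equal to $c_0$ at $t=0$, such that every $t\mapsto c_t(p)$ is differentiable and satisfies $$\frac{d}{dt}c_t(p)=\frac12\sum_{p'\preceq p}p'.(p\backslash p')\,c_t(p')\,c_t(p\backslash p')-c_t(p)\sum_{p'\in S}p.p'\,c_t(p')\qquad(0\le t<T),$$ such that $\langle a+b,|c_t|\rangle<\infty$ for all $t\in[0,T)$, the functions $t\mapsto\langle a,c_t\rangle$ and $t\mapsto\langle b,c_t\rangle$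 are locally integrable on $[0,T)$, and $\langle a^2+b^2,|c_t|\rangle<\infty$ for $t$ in a neighbourhood of $0$. Let $c_0:S\to[0,\infty)$ satisfy $\langle 1,c_0\rangle<\infty$, $\langle a,c_0\rangle=\langle b,c_0\rangle=1$ and $\langle a^2+b^2,c_0\rangle<\infty$. Let $$M=\langle ab,c_0\rangle+\sqrt{\langle a^2-a,c_0\rangle\,\langle b^2-b,c_0\rangle},\qquad T_c=\begin{cases}+\infty&\text{if }M\le1,\\ 1/(M-1)&\text{if }M>1,\end{cases}$$ and $g_0(x,y,z)=\sum_{(a,b,m)\in S}c_0(a,b,m)x^ay^bz^m$ on $[0,1]^3$. Then the following hold. (i) The sexed Smoluchowski system with initial condition $c_0$ has a unique solution $(c_t)$ on $[0,T_c)$. (ii) For every $t\in[0,T_c)$, $\langle a^2+b^2,c_t\rangle<\infty$; and if $T_c<\infty$, then $\langle a^2+b^2,c_t\rangle\to+\infty$ as $t\uparrow T_c$. (iii) For $t\in[0,T_c)$ and $z\in[0,1]$ the map $$\phi_t(x,y,z)=\Big((1+t)x-t\,\frac{\partial g_0}{\partial y}(x,y,z),\ (1+t)y-t\,\frac{\partial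 g_0}{\partial x}(x,y,z)\Big),\qquad(x,y)\in[0,1]^2,$$ has a unique right inverse $h_t(\cdot,\cdot,z)=(h_t^{(1)},h_t^{(2)}):[0,1]^2\to[0,1]^2$, i.e. $\phi_t(h_t(x,y,z),z)=(x,y)$ for all $(x,y)\in[0,1]^2$; it is continuous on $[0,1]^2$ and real analytic on $(0,1)^2$. For $t\in(0,T_c)$ and $(x,y,z)\in[0,1]^3$ the generating function $g_t(x,y,z)=\sum_{(a,b,m)\in S}c_t(a,b,m)x^ay^bz^m$ converges absolutely and is given by $$g_t(x,y,z)=\frac1{1+t}\Big(\tilde H_t^{(2)}(x,y,z)+\tilde H_t^{(1)}(0,y,z)\Big)+G_t(z),$$ where $\tilde h_t^{(1)}=\frac{1+t}{t}h_t^{(1)}(x,y,z)-\frac xt$ and $\tilde h_t^{(2)}=\frac{1+t}{t}h_t^{(2)}(x,y,z)-\frac yt$; $\tilde H_t^{(1)}$ is the antiderivative of $\tilde h_t^{(1)}$ with respect to $y$ vanishing at $y=0$; $\tilde H_t^{(2)}$ is the antiderivative of $\tilde h_t^{(2)}$ with respect to $x$ vanishing at $x=0$; and $$G_t(z)=\int_0^z\frac{\partial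 g_0}{\partial z}\big(h_t^{(1)}(0,0,s),h_t^{(2)}(0,0,s),s\big)\,ds,$$ the integrand being integrable on $(0,1)$. (iv) The total mass $\langle m,c_t\rangle$ is constant on $[0,T_c)$ (in particular it is finite at every time if it is finite at time $0$, and infinite at every time otherwise). -/

import Mathlib

open Set Filter Topology MeasureTheory

noncomputable section

namespace SexedSmoluchowski

/-- Particle types `p = (a, b, m)`: `a` male arms, `b` female arms, mass `m ≥ 1`. -/
abbrev S : Type := ℕ × ℕ × ℕ+

/-- Number of male arms, as a real function on the types. -/
def male (p : S) : ℝ := (p.1 : ℝ)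

/-- Number of female arms, as a real function on the types. -/
def female (p : S) : ℝ := (p.2.1 : ℝ)

/-- Mass, as a real function on the types. -/
def mass (p : S) : ℝ := ((p.2.2 : ℕ) : ℝ)

/-- The rate of coagulation `p.p' = a' b + a b'`. -/
def rate (p p' : S) : ℝ := male p' * female p + male p * female p'

/-- The finite set of all `p' ⪯ p`, i.e. `a' ≤ a + 1`, `b' ≤ b + 1`, `m' ≤ m - 1`. -/
def below (p : S) : Finset S :=
  Finset.range (p.1 + 2) ×ˢ Finset.range (p.2.1 + 2) ×ˢ Finset.Ico 1 p.2.2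

/-- The type `p \ p' = (a + 1 - a', b + 1 - b', m - m')`, used only for `p' ⪯ p`
(where the subtractions are not truncated). -/
def rest (p p' : S) : S := (p.1 + 1 - p'.1, p.2.1 + 1 - p'.2.1, p.2.2 - p'.2.2)

/-- `⟨c, f⟩ = ∑_p c(p) f(p)`. -/
def bracket (c f : S → ℝ) : ℝ := ∑' p, c p * f p

/-- The right-hand side of the sexed Smoluchowski system. -/
def coagulation (c : S → ℝ) (p : S) : ℝ :=
  (1 / 2) * ∑ p' ∈ below p, rate p' (rest p p') * c p' * c (rest p p')
    - c p * ∑' p', rate p p' * c p'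

/-- The time interval `[0, T)`, with `T = ∞` allowed. -/
def timeInterval (T : EReal) : Set ℝ := {t : ℝ | 0 ≤ t ∧ (t : EReal) < T}

/-- `c` (with `c t p` the concentration of `p`-particles at time `t`) is a solution on `[0, T)` of
the sexed Smoluchowski system with initial condition `c₀`. Only the values `c t p` with
`t ∈ [0, T)` matter. No sign is imposed on `c`. -/
structure IsSolution (c₀ : S → ℝ) (T : EReal) (c : ℝ → S → ℝ) : Prop where
  initial : c 0 = c₀
  /-- `⟨a + b, |c_t|⟩ < ∞` at all times -/
  arms : ∀ t ∈ timeInterval T, Summable fun p => |c t p| * (male p + female p)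
  /-- the total rates `⟨a, c_t⟩` and `⟨b, c_t⟩` in the loss term are locally integrable in time -/
  male_integrable : ∀ t ∈ timeInterval T,
    IntervalIntegrable (fun s => bracket (c s) male) volume 0 t
  female_integrable : ∀ t ∈ timeInterval T,
    IntervalIntegrable (fun s => bracket (c s) female) volume 0 t
  /-- `⟨a² + b², |c_t|⟩ < ∞` for `t` in a neighbourhood of `0` -/
  second_moment : ∃ ε : ℝ, 0 < ε ∧ ∀ t ∈ timeInterval T, t < ε →
    Summable fun p => |c t p| * (male p ^ 2 + female p ^ 2)
  /-- every `t ↦ c_t(p)` is differentiable on `[0, T)` and the system holds there -/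
  system : ∀ t ∈ timeInterval T, ∀ p,
    HasDerivWithinAt (fun s => c s p) (coagulation (c t) p) (timeInterval T) t

/-- `M = ⟨ab, c₀⟩ + √(⟨a² - a, c₀⟩ ⟨b² - b, c₀⟩)`. -/
def bigM (c₀ : S → ℝ) : ℝ :=
  bracket c₀ (fun p => male p * female p) +
    √(bracket c₀ (fun p => male p ^ 2 - male p) * bracket c₀ (fun p => female p ^ 2 - female p))

open Classical in
/-- The critical time: `∞` if `M ≤ 1` and `1 / (M - 1)` if `M > 1`. -/
def critTime (c₀ : S → ℝ) : EReal :=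
  if bigM c₀ ≤ 1 then ⊤ else ((1 / (bigM c₀ - 1) : ℝ) : EReal)

/-- The monomial `x^a y^b z^m`. -/
def monomial (x y z : ℝ) (p : S) : ℝ := x ^ p.1 * y ^ p.2.1 * z ^ (p.2.2 : ℕ)

/-- The generating function `g(x, y, z) = ∑ c(a, b, m) x^a y^b z^m`, used on `[0, 1]³`. -/
def genFun (c : S → ℝ) (x y z : ℝ) : ℝ := bracket c (monomial x y z)

/-- `∂g/∂x` on the cube `[0, 1]³` (one-sided on its faces). -/
def genFunDx (c : S → ℝ) (x y z : ℝ) : ℝ := derivWithin (fun s => genFun c s y z) (Icc 0 1) x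

/-- `∂g/∂y` on the cube `[0, 1]³` (one-sided on its faces). -/
def genFunDy (c : S → ℝ) (x y z : ℝ) : ℝ := derivWithin (fun s => genFun c x s z) (Icc 0 1) y

/-- `∂g/∂z` on the cube `[0, 1]³` (one-sided on its faces). -/
def genFunDz (c : S → ℝ) (x y z : ℝ) : ℝ := derivWithin (fun s => genFun c x y s) (Icc 0 1) z

/-- The map `φ_t(·, ·, z)`. -/
def phi (c₀ : S → ℝ) (t z : ℝ) (q : ℝ × ℝ) : ℝ × ℝ :=
  ((1 + t) * q.1 - t * genFunDy c₀ q.1 q.2 z, (1 + t) * q.2 - t * genFunDx c₀ q.1 q.2 z)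

/-- The closed unit square, on which `φ_t(·, ·, z)` is defined. -/
def square : Set (ℝ × ℝ) := Icc 0 1 ×ˢ Icc 0 1

/-- `h : [0, 1]² → [0, 1]²` is a right inverse of `φ_t(·, ·, z) : [0, 1]² → ℝ²` over `[0, 1]²`. -/
def IsRightInverse (c₀ : S → ℝ) (t z : ℝ) (h : ℝ × ℝ → ℝ × ℝ) : Prop :=
  MapsTo h square square ∧ ∀ q ∈ square, phi c₀ t z (h q) = q

/-- `h̃⁽¹⁾(x, y) = ((1 + t) / t) h⁽¹⁾(x, y) - x / t`, for `t > 0`. -/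
def tilde1 (t : ℝ) (h : ℝ × ℝ → ℝ × ℝ) (x y : ℝ) : ℝ := (1 + t) / t * (h (x, y)).1 - x / t

/-- `h̃⁽²⁾(x, y) = ((1 + t) / t) h⁽²⁾(x, y) - y / t`, for `t > 0`. -/
def tilde2 (t : ℝ) (h : ℝ × ℝ → ℝ × ℝ) (x y : ℝ) : ℝ := (1 + t) / t * (h (x, y)).2 - y / t

/-- `H̃⁽¹⁾`: the antiderivative of `h̃⁽¹⁾` in `y` that vanishes at `y = 0`. -/
def bigTilde1 (t : ℝ) (h : ℝ × ℝ → ℝ × ℝ) (x y : ℝ) : ℝ := ∫ s in (0 : ℝ)..y, tilde1 t h x s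

/-- `H̃⁽²⁾`: the antiderivative of `h̃⁽²⁾` in `x` that vanishes at `x = 0`. -/
def bigTilde2 (t : ℝ) (h : ℝ × ℝ → ℝ × ℝ) (x y : ℝ) : ℝ := ∫ s in (0 : ℝ)..x, tilde2 t h s y

/-- The function `z ↦ ∂g₀/∂z (h⁽¹⁾(0, 0, z), h⁽²⁾(0, 0, z), z)`, where `h z` is `h(·, ·, z)`. -/
def massIntegrand (c₀ : S → ℝ) (h : ℝ → ℝ × ℝ → ℝ × ℝ) (z : ℝ) : ℝ :=
  genFunDz c₀ (h z (0, 0)).1 (h z (0, 0)).2 z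

/-- `G(z)`: the antiderivative of `massIntegrand` that vanishes at `z = 0`. -/
def bigG (c₀ : S → ℝ) (h : ℝ → ℝ × ℝ → ℝ × ℝ) (z : ℝ) : ℝ :=
  ∫ s in (0 : ℝ)..z, massIntegrand c₀ h s

end SexedSmoluchowski

end

open SexedSmoluchowski

/-! Put `τ = t / (1 + t)` and `c_t(a, b, m) = (1 - τ)^(a + b) U_τ(a, b, m)`. If `⟨a, c_t⟩ = ⟨b, c_t⟩
= 1 - τ`, the loss term is exactly the derivative of the power, and what remains is the system
without loss, `dU/dτ = gain U`. Since reagents are lighter than their product, this system is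
triangular in the mass and its solution `flow` exists without any convergence question.

Its generating function `g` solves `∂g/∂τ = (∂g/∂x)(∂g/∂y)`, of Hamilton–Jacobi type. Along the
characteristics, which are straight lines, the whole gradient of `g` is constant. Comparison on
finite truncations shows that the gradient stays at most `1` on the shrinking square `[0, 1 - τ]²`,
so a characteristic traced back from that square ends in `[0, 1]²` (`characteristics`,
`flowDx_eq_and_flowDy_eq`). Rescaled, the end of this backward line (`foot`) is the right inverse of
`φ_t`, and the formula for `g_t` comes from integrating the gradient along edges.

The critical time enters through the equation `(x, y) = (ξ, η) + τ (∂g₀/∂y, ∂g₀/∂x)(x, y, z)`. The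
derivative of the gradient map at `(1, 1, 1)` has spectral radius `M` and bounds its Lipschitz
constants on the cube. Hence solutions are unique and stable as long as `τ M < 1`, that is `t < T_c`
(`fixed_point_lipschitz`). At the corner `(1 - τ, 1 - τ, 1)` the solution must be `(1, 1)`, so no
arm is lost (`flowD_corner`): this yields `⟨a, c_t⟩ = ⟨b, c_t⟩ = 1 / (1 + t)` and closes the
construction. Differentiating the same equation at the corner gives a linear system for the second
moments, whose determinant vanishes at `T_c`; mass conservation is the constancy of `∂g/∂z` in the
limit at the corner.

For uniqueness, any solution has the form `U_σ(p) X^a Y^b`, with `X`, `Y` its own integrating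
factors and `σ` its own clock (`eq_flow_clock`). Comparison gives `⟨a, c⟩ ≤ X`, `⟨b, c⟩ ≤ Y` and `X,
Y ≥ 1 - σ`. While `σ` is subcritical, conservation of arms at the corner turns all of these into
equalities, so `σ' = (1 - σ)²` and `σ = τ`. -/

noncomputable section

/-! ### Pairs of particles, the gain term and weights with a product rule -/

namespace SexedSmoluchowski

/-- The type produced when `p` and `q` coagulate. -/
def join (p q : S) : S := (p.1 + q.1 - 1, p.2.1 + q.2.1 - 1, p.2.2 + q.2.2)

/-- The gain term of the sexed Smoluchowski system. -/
def gain (U : S → ℝ) (p : S) : ℝ :=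
  (1 / 2) * ∑ p' ∈ below p, rate p' (rest p p') * U p' * U (rest p p')

lemma male_nonneg (p : S) : 0 ≤ male p := Nat.cast_nonneg _

lemma female_nonneg (p : S) : 0 ≤ female p := Nat.cast_nonneg _

lemma mass_nonneg (p : S) : 0 ≤ mass p := Nat.cast_nonneg _

lemma rate_nonneg (p q : S) : 0 ≤ rate p q :=
  add_nonneg (mul_nonneg (male_nonneg _) (female_nonneg _))
    (mul_nonneg (male_nonneg _) (female_nonneg _))

lemma join_comm (p q : S) : join p q = join q p := by
  simp only [join, add_comm]

lemma mem_below {p p' : S} :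
    p' ∈ below p ↔ p'.1 < p.1 + 2 ∧ p'.2.1 < p.2.1 + 2 ∧ p'.2.2 < p.2.2 := by
  simp [below]

lemma join_rest {p p' : S} (h : p' ∈ below p) : join p' (rest p p') = p := by
  obtain ⟨h1, h2, h3⟩ := mem_below.1 h
  refine Prod.ext ?_ (Prod.ext ?_ ?_)
  · simp only [join, rest]; omega
  · simp only [join, rest]; omega
  · simp only [join, rest]; exact PNat.add_sub_of_lt h3

/-- The positivity conditions keep the subtraction of `1` in `join` from truncating. They hold as
soon as `rate p q ≠ 0`. -/
lemma rest_join {p q : S} (h1 : 0 < p.1 + q.1) (h2 : 0 < p.2.1 + q.2.1) :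
    p ∈ below (join p q) ∧ rest (join p q) p = q := by
  refine ⟨mem_below.2 ⟨?_, ?_, ?_⟩, Prod.ext ?_ (Prod.ext ?_ ?_)⟩
  · simp only [join]; omega
  · simp only [join]; omega
  · simp only [join]; exact PNat.lt_add_right _ _
  · simp only [join, rest]; omega
  · simp only [join, rest]; omega
  · simp only [join, rest, add_comm p.2.2, PNat.add_sub]

/-- The gain term, integrated against a weight, is a sum over pairs of particles. -/
lemma hasSum_gain {U w : S → ℝ} {s : ℝ}
    (h : HasSum (fun q : S × S => male q.1 * female q.2 * U q.1 * U q.2 * w (join q.1 q.2)) s) :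
    HasSum (fun p => w p * gain U p) s := by
  -- The rate has two terms that are exchanged by swapping the reagents. Both give the sum `s`, and
  -- the factor `1 / 2` of the gain term averages them.
  have h' : HasSum (fun q : S × S =>
      male q.2 * female q.1 * U q.1 * U q.2 * w (join q.1 q.2)) s := by
    refine ((Equiv.prodComm S S).hasSum_iff.2 h).congr_fun ?_ |> id
    intro q
    simp only [Function.comp, Equiv.prodComm_apply, Prod.fst_swap, Prod.snd_swap,
      join_comm q.2 q.1]
    ring
  have hF : HasSum (fun q : S × S =>
      (1 / 2) * (rate q.1 q.2 * U q.1 * U q.2) * w (join q.1 q.2)) s := by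
    have := (h.add h').mul_left (1 / 2 : ℝ)
    rw [show (1 / 2 : ℝ) * (s + s) = s by ring] at this
    refine this.congr_fun fun q => ?_
    simp only [rate]; ring
  -- The pairs `(p, p')` with `p' ⪯ p` embed into `S × S`. A pair outside the image has no male arm
  -- at all or no female arm at all, hence rate zero.
  let j : (Σ p : S, {x // x ∈ below p}) → S × S := fun x => (x.2.1, rest x.1 x.2.1)
  have hj : Function.Injective j := by
    rintro ⟨p, x, hx⟩ ⟨p', x', hx'⟩ hxx
    simp only [j, Prod.mk.injEq] at hxx
    obtain ⟨rfl, h2⟩ := hxx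
    have : p = p' := by rw [← join_rest hx, ← join_rest hx', h2]
    subst this
    rfl
  have hj0 : ∀ q ∉ Set.range j,
      (1 / 2) * (rate q.1 q.2 * U q.1 * U q.2) * w (join q.1 q.2) = 0 := by
    intro q hq
    have : rate q.1 q.2 = 0 := by
      by_contra hr
      apply hq
      have h12 : 0 < q.1.1 + q.2.1 ∧ 0 < q.1.2.1 + q.2.2.1 := by
        by_contra hc
        apply hr
        simp only [rate, male, female, ← Nat.cast_mul, ← Nat.cast_add]
        norm_cast
        rw [not_and_or] at hc
        rcases hc with hc | hc
        · have h1 : q.1.1 = 0 := by omega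
          have h2 : q.2.1 = 0 := by omega
          simp [h1, h2]
        · have h1 : q.1.2.1 = 0 := by omega
          have h2 : q.2.2.1 = 0 := by omega
          simp [h1, h2]
      obtain ⟨ha, hb⟩ := rest_join h12.1 h12.2
      exact ⟨⟨join q.1 q.2, q.1, ha⟩, Prod.ext rfl hb⟩
    simp [this]
  have hs := (hj.hasSum_iff hj0).2 hF
  refine hs.sigma (fun p => ?_)
  have : w p * gain U p = ∑ x : {x // x ∈ below p},
      (1 / 2) * (rate x.1 (rest p x.1) * U x.1 * U (rest p x.1)) * w p := by
    rw [Finset.sum_coe_sort (below p)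
      (fun x => (1 / 2) * (rate x (rest p x) * U x * U (rest p x)) * w p),
      ← Finset.sum_mul, ← Finset.mul_sum, gain]
    ring
  rw [this]
  refine (hasSum_fintype _).congr_fun fun x => ?_
  simp only [Function.comp, j, join_rest x.2]

lemma hasSum_mul_pair {ι κ : Type*} {f : ι → ℝ} {g : κ → ℝ} (hf : Summable f) (hg : Summable g) :
    HasSum (fun q : ι × κ => f q.1 * g q.2) ((∑' i, f i) * ∑' j, g j) :=
  hf.hasSum.mul hg.hasSum (summable_mul_of_summable_norm hf.norm hg.norm)

/-- A weight `w` that satisfies a Leibniz rule with respect to `join`. -/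
structure Leibniz (w wx wy X Y : S → ℝ) : Prop where
  rule : ∀ p q, male p * female q * w (join p q) = wx p * Y q + X p * wy q

/-- Coefficient form of the equation obtained by applying a derivation `D` to `∂g/∂τ = g_x g_y`,
namely `∂(Dg)/∂τ = (D g_x) g_y + g_x (D g_y)`. Absolute convergence of the four series allows the
products to be summed over pairs. -/
lemma Leibniz.hasSum_gain {U w wx wy X Y : S → ℝ} (h : Leibniz w wx wy X Y)
    (hwx : Summable fun p => U p * wx p) (hwy : Summable fun p => U p * wy p)
    (hX : Summable fun p => U p * X p) (hY : Summable fun p => U p * Y p) :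
    HasSum (fun p => w p * gain U p)
      ((∑' p, U p * wx p) * (∑' p, U p * Y p) + (∑' p, U p * X p) * ∑' p, U p * wy p) := by
  have h1 : HasSum (fun q : S × S => U q.1 * wx q.1 * (U q.2 * Y q.2)) _ :=
    hasSum_mul_pair hwx hY
  have h2 : HasSum (fun q : S × S => U q.1 * X q.1 * (U q.2 * wy q.2)) _ :=
    hasSum_mul_pair hX hwy
  have h3 := h1.add h2
  refine SexedSmoluchowski.hasSum_gain ?_
  convert h3 using 1
  funext q
  have := h.rule q.1 q.2
  calc _ = (male q.1 * female q.2 * w (join q.1 q.2)) * (U q.1 * U q.2) := by ring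
    _ = _ := by rw [this]; ring

/-- A finite set of types is hereditary if it contains the reagents of its elements. -/
def Hereditary (A : Finset S) : Prop :=
  ∀ p q, join p q ∈ A → 0 < p.1 → 0 < q.2.1 → p ∈ A ∧ q ∈ A

lemma gain_nonneg {U : S → ℝ} (hU : ∀ p, 0 ≤ U p) (p : S) : 0 ≤ gain U p :=
  mul_nonneg (by norm_num) (Finset.sum_nonneg fun _ _ =>
    mul_nonneg (mul_nonneg (rate_nonneg _ _) (hU _)) (hU _))

/-- On a hereditary set the system without loss is closed: every term of the gain that involves a
type outside the set has rate zero. -/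
lemma gain_congr_of_mem {A : Finset S} (hA : Hereditary A) {U U' : S → ℝ}
    (hUU : ∀ p ∈ A, U p = U' p) {p : S} (hp : p ∈ A) : gain U p = gain U' p := by
  unfold gain
  congr 1
  refine Finset.sum_congr rfl fun x hx => ?_
  have hj := join_rest hx
  by_cases hr : rate x (rest p x) = 0
  · simp [hr]
  have : x ∈ A ∧ rest p x ∈ A := by
    -- A nonzero rate means that one of the two products of arms is nonzero. Which one it is decides
    -- the order in which the reagents are fed to `hA`.
    rcases Nat.eq_zero_or_pos (x.1 * (rest p x).2.1) with h0 | h0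
    · have h1 : 0 < (rest p x).1 * x.2.1 := by
        rw [Nat.pos_iff_ne_zero]
        intro h1
        apply hr
        simp only [rate, male, female]
        norm_cast
        rw [h0, h1]
      have := hA (rest p x) x (by rwa [join_comm, hj]) (Nat.pos_of_mul_pos_right h1)
        (Nat.pos_of_mul_pos_left h1)
      exact this.symm
    · exact hA x (rest p x) (by rwa [hj]) (Nat.pos_of_mul_pos_right h0)
        (Nat.pos_of_mul_pos_left h0)
  rw [hUU _ this.1, hUU _ this.2]

/-- Setting `U` to zero outside `A` does not change the gain on `A`, and makes the identity over all
pairs a finite one. Only nonnegative contributions, from products outside `A`, are then dropped, so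
the identity becomes an inequality. -/
lemma sum_gain_le {A : Finset S} (hA : Hereditary A) {U w : S → ℝ} (hU : ∀ p, 0 ≤ U p)
    (hw : ∀ p, 0 ≤ w p) :
    ∑ p ∈ A, w p * gain U p ≤
      ∑ q ∈ A ×ˢ A, male q.1 * female q.2 * U q.1 * U q.2 * w (join q.1 q.2) := by
  classical
  set U' : S → ℝ := fun p => if p ∈ A then U p else 0 with hU'
  have hU'0 : ∀ p, 0 ≤ U' p := fun p => by
    simp only [hU']; split_ifs
    · exact hU p
    · exact le_rfl
  have h1 : HasSum (fun q : S × S => male q.1 * female q.2 * U' q.1 * U' q.2 * w (join q.1 q.2))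
      (∑ q ∈ A ×ˢ A, male q.1 * female q.2 * U' q.1 * U' q.2 * w (join q.1 q.2)) := by
    apply hasSum_sum_of_ne_finset_zero
    intro q hq
    rw [Finset.mem_product, not_and_or] at hq
    rcases hq with hq | hq <;> simp [hU', hq]
  have h2 := sum_le_hasSum A (fun p _ => mul_nonneg (hw p) (gain_nonneg hU'0 p)) (hasSum_gain h1)
  calc _ = ∑ p ∈ A, w p * gain U' p := Finset.sum_congr rfl fun p hp => by
        rw [gain_congr_of_mem hA (U := U) (U' := U') (fun p hp => by simp [hU', hp]) hp]
    _ ≤ _ := h2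
    _ = _ := Finset.sum_congr rfl fun q hq => by
        rw [Finset.mem_product] at hq
        simp [hU', hq.1, hq.2]

lemma Leibniz.sum_gain_le {A : Finset S} (hA : Hereditary A) {U w wx wy X Y : S → ℝ}
    (h : Leibniz w wx wy X Y) (hU : ∀ p, 0 ≤ U p) (hw : ∀ p, 0 ≤ w p) :
    ∑ p ∈ A, w p * gain U p ≤
      (∑ p ∈ A, U p * wx p) * (∑ p ∈ A, U p * Y p)
        + (∑ p ∈ A, U p * X p) * ∑ p ∈ A, U p * wy p := by
  refine (SexedSmoluchowski.sum_gain_le hA hU hw).trans_eq ?_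
  rw [Finset.sum_mul_sum, Finset.sum_mul_sum, ← Finset.sum_product', ← Finset.sum_product',
    ← Finset.sum_add_distrib]
  refine Finset.sum_congr rfl fun q _ => ?_
  have := h.rule q.1 q.2
  calc _ = (male q.1 * female q.2 * w (join q.1 q.2)) * (U q.1 * U q.2) := by ring
    _ = _ := by rw [this]; ring

/-- The number of arms plus the mass. -/
def size (p : S) : ℕ := p.1 + p.2.1 + p.2.2

/-- The types with size at most `N`. -/
def trunc (N : ℕ) : Finset S :=
  (Finset.range (N + 1) ×ˢ Finset.range (N + 1) ×ˢ Finset.Icc 1 N.succPNat).filter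
    fun p => size p ≤ N

lemma mem_trunc {N : ℕ} {p : S} : p ∈ trunc N ↔ size p ≤ N := by
  simp only [trunc, Finset.mem_filter, Finset.mem_product, Finset.mem_range, Finset.mem_Icc,
    one_le, true_and, and_iff_right_iff_imp]
  intro h
  unfold size at h
  refine ⟨by omega, by omega, ?_⟩
  rw [← PNat.coe_le_coe, Nat.succPNat_coe]
  omega

/-- A coagulation costs two arms, so the size of the product is the sum of the sizes minus `2`; each
reagent, having an arm and a positive mass, has size at least `2`. -/
lemma hereditary_trunc (N : ℕ) : Hereditary (trunc N) := by
  intro p q h hp hq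
  rw [mem_trunc] at h ⊢
  rw [mem_trunc]
  have h1 := p.2.2.pos
  have h2 := q.2.2.pos
  simp only [size, join, PNat.add_coe] at *
  omega

lemma exists_subset_trunc (F : Finset S) : ∃ N, F ⊆ trunc N :=
  ⟨F.sup size, fun _ hp => mem_trunc.2 (Finset.le_sup hp)⟩

/-! Derivatives of the monomials. -/

/-- `∂/∂x` of the monomial. -/
def dX (x y z : ℝ) (p : S) : ℝ := male p * x ^ (p.1 - 1) * y ^ p.2.1 * z ^ (p.2.2 : ℕ)

/-- `∂/∂y` of the monomial. -/
def dY (x y z : ℝ) (p : S) : ℝ := female p * x ^ p.1 * y ^ (p.2.1 - 1) * z ^ (p.2.2 : ℕ)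

/-- `∂/∂z` of the monomial. -/
def dZ (x y z : ℝ) (p : S) : ℝ := mass p * x ^ p.1 * y ^ p.2.1 * z ^ ((p.2.2 : ℕ) - 1)

/-- `∂²/∂x²` of the monomial. -/
def dXX (x y z : ℝ) (p : S) : ℝ :=
  male p * (male p - 1) * x ^ (p.1 - 2) * y ^ p.2.1 * z ^ (p.2.2 : ℕ)

/-- `∂²/∂x∂y` of the monomial. -/
def dXY (x y z : ℝ) (p : S) : ℝ :=
  male p * female p * x ^ (p.1 - 1) * y ^ (p.2.1 - 1) * z ^ (p.2.2 : ℕ)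

/-- `∂²/∂y²` of the monomial. -/
def dYY (x y z : ℝ) (p : S) : ℝ :=
  female p * (female p - 1) * x ^ p.1 * y ^ (p.2.1 - 2) * z ^ (p.2.2 : ℕ)

/-- `∂²/∂x∂z` of the monomial. -/
def dXZ (x y z : ℝ) (p : S) : ℝ :=
  male p * mass p * x ^ (p.1 - 1) * y ^ p.2.1 * z ^ ((p.2.2 : ℕ) - 1)

/-- `∂²/∂y∂z` of the monomial. -/
def dYZ (x y z : ℝ) (p : S) : ℝ :=
  female p * mass p * x ^ p.1 * y ^ (p.2.1 - 1) * z ^ ((p.2.2 : ℕ) - 1)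

/-- The three rules `leibniz_dX`, `leibniz_dY`, `leibniz_dZ` are the derivatives in `x`, `y`, `z` of
the identity `monomial_join`. The case distinctions treat the exponents at which the natural
subtraction truncates; the numerical prefactors vanish there. -/
lemma leibniz_dX (x y z : ℝ) :
    Leibniz (dX x y z) (dXX x y z) (dXY x y z) (dX x y z) (dY x y z) := by
  refine ⟨?_⟩
  rintro ⟨a, b, m⟩ ⟨a', b', m'⟩
  simp only [dX, dY, dXX, dXY, male, female, join, PNat.add_coe]
  rcases a with _ | a
  · simp
  rcases b' with _ | b'
  · simp
  rcases a with _ | a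
  · rcases a' with _ | a'
    · simp
    · simp only [zero_add, Nat.add_sub_cancel, show 1 + (a' + 1) - 1 = a' + 1 by omega,
        show b + (b' + 1) - 1 = b + b' by omega]
      push_cast
      ring
  · simp only [show a + 1 + 1 + a' - 1 = a + a' + 1 by omega,
      show b + (b' + 1) - 1 = b + b' by omega, Nat.add_sub_cancel,
      show a + 1 + 1 - 2 = a by omega]
    rcases a' with _ | a'
    · push_cast; simp; ring
    · simp only [Nat.add_sub_cancel]
      push_cast
      ring

lemma leibniz_dY (x y z : ℝ) :
    Leibniz (dY x y z) (dXY x y z) (dYY x y z) (dX x y z) (dY x y z) := by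
  refine ⟨?_⟩
  rintro ⟨a, b, m⟩ ⟨a', b', m'⟩
  simp only [dX, dY, dYY, dXY, male, female, join, PNat.add_coe]
  rcases a with _ | a
  · simp
  rcases b' with _ | b'
  · simp
  rcases b' with _ | b'
  · rcases b with _ | b
    · simp
    · simp only [zero_add, Nat.add_sub_cancel, show a + 1 + a' - 1 = a + a' by omega]
      push_cast
      ring
  · simp only [show a + 1 + a' - 1 = a + a' by omega,
      show b + (b' + 1 + 1) - 1 = b + b' + 1 by omega, Nat.add_sub_cancel,
      show b' + 1 + 1 - 2 = b' by omega]
    rcases b with _ | b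
    · push_cast; simp; ring
    · simp only [Nat.add_sub_cancel]
      push_cast
      ring

lemma leibniz_dZ (x y z : ℝ) :
    Leibniz (dZ x y z) (dXZ x y z) (dYZ x y z) (dX x y z) (dY x y z) := by
  refine ⟨?_⟩
  rintro ⟨a, b, m⟩ ⟨a', b', m'⟩
  simp only [dX, dY, dZ, dYZ, dXZ, male, female, mass, join, PNat.add_coe]
  rcases a with _ | a
  · simp
  rcases b' with _ | b'
  · simp
  obtain ⟨m, rfl⟩ : ∃ k : ℕ, m = k.succPNat := ⟨m.natPred, by simp⟩
  obtain ⟨m', rfl⟩ : ∃ k : ℕ, m' = k.succPNat := ⟨m'.natPred, by simp⟩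
  simp only [show a + 1 + a' - 1 = a + a' by omega, Nat.succPNat_coe, Nat.succ_eq_add_one,
    show b + (b' + 1) - 1 = b + b' by omega, Nat.add_sub_cancel,
    show m + 1 + (m' + 1) - 1 = m + m' + 1 by omega]
  push_cast
  ring

/-- Coagulation consumes one male arm of one reagent and one female arm of the other. This is what
turns the system without loss into `∂g/∂τ = g_x g_y`. -/
lemma monomial_join (x y z : ℝ) (p q : S) :
    male p * female q * monomial x y z (join p q) = dX x y z p * dY x y z q := by
  obtain ⟨a, b, m⟩ := p
  obtain ⟨a', b', m'⟩ := q
  simp only [dX, dY, monomial, male, female, join, PNat.add_coe]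
  rcases a with _ | a
  · simp
  rcases b' with _ | b'
  · simp
  simp only [show a + 1 + a' - 1 = a + a' by omega,
    show b + (b' + 1) - 1 = b + b' by omega, Nat.add_sub_cancel]
  ring

lemma sum_gain_monomial_le {A : Finset S} (hA : Hereditary A) {U : S → ℝ} (hU : ∀ p, 0 ≤ U p)
    {x y z : ℝ} (hx : 0 ≤ x) (hy : 0 ≤ y) (hz : 0 ≤ z) :
    ∑ p ∈ A, monomial x y z p * gain U p ≤
      (∑ p ∈ A, U p * dX x y z p) * (∑ p ∈ A, U p * dY x y z p) := by
  refine (sum_gain_le hA hU fun p => by unfold monomial; positivity).trans_eq ?_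
  rw [Finset.sum_mul_sum, ← Finset.sum_product']
  refine Finset.sum_congr rfl fun q _ => ?_
  have := monomial_join x y z q.1 q.2
  calc _ = (male q.1 * female q.2 * monomial x y z (join q.1 q.2)) * (U q.1 * U q.2) := by ring
    _ = _ := by rw [this]; ring

end SexedSmoluchowski

namespace SexedSmoluchowski

/-! ### Series of functions -/

/-- On a convex set the mean value inequality bounds the difference quotients of each term by `u i`,
so dominated convergence applies to them. The derivatives are taken within `s`, which permits end
points of intervals. -/
lemma hasDerivWithinAt_tsum {ι : Type*} {f f' : ι → ℝ → ℝ} {s : Set ℝ} (hs : Convex ℝ s)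
    {u : ι → ℝ} (hu : Summable u) (hf : ∀ i, ∀ x ∈ s, HasDerivWithinAt (f i) (f' i x) s x)
    (hb : ∀ i, ∀ x ∈ s, |f' i x| ≤ u i) {x₀ : ℝ} (hx₀ : x₀ ∈ s)
    (h₀ : Summable fun i => f i x₀) {x : ℝ} (hx : x ∈ s) :
    HasDerivWithinAt (fun y => ∑' i, f i y) (∑' i, f' i x) s x := by
  have hlip : ∀ i, ∀ y ∈ s, ∀ y' ∈ s, |f i y - f i y'| ≤ u i * |y - y'| := by
    intro i y hy y' hy'
    simpa [Real.norm_eq_abs] using hs.norm_image_sub_le_of_norm_hasDerivWithin_le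
      (f := f i) (f' := f' i) (hf i) (hb i) hy' hy
  have hsum : ∀ y ∈ s, Summable fun i => f i y := by
    intro y hy
    have : Summable fun i => f i y - f i x₀ :=
      Summable.of_norm_bounded (hu.mul_right |y - x₀|) fun i => hlip i y hy x₀ hx₀
    simpa using this.add h₀
  rw [hasDerivWithinAt_iff_tendsto_slope]
  have key : Tendsto (fun y => ∑' i, slope (f i) x y) (𝓝[s \ {x}] x) (𝓝 (∑' i, f' i x)) := by
    refine tendsto_tsum_of_dominated_convergence hu
      (fun i => hasDerivWithinAt_iff_tendsto_slope.1 (hf i x hx)) ?_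
    filter_upwards [self_mem_nhdsWithin] with y hy i
    have hne : 0 < |y - x| := abs_pos.2 (sub_ne_zero.2 hy.2)
    rw [slope_def_field, Real.norm_eq_abs, abs_div, div_le_iff₀ hne]
    exact hlip i y hy.1 x hx
  refine key.congr' ?_
  filter_upwards [self_mem_nhdsWithin] with y hy
  simp only [slope_def_field]
  rw [tsum_div_const, (hsum y hy.1).tsum_sub (hsum x hx)]

/-- Fatou's lemma for series. -/
lemma summable_and_tsum_le_of_tendsto {ι κ : Type*} {l : Filter κ} [l.NeBot] {f : κ → ι → ℝ}
    {g : ι → ℝ} {C : ℝ} (hg : ∀ i, 0 ≤ g i) (hlim : ∀ i, Tendsto (fun k => f k i) l (𝓝 (g i)))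
    (hC : ∀ F : Finset ι, ∀ᶠ k in l, ∑ i ∈ F, f k i ≤ C) :
    Summable g ∧ ∑' i, g i ≤ C := by
  have h : ∀ F : Finset ι, ∑ i ∈ F, g i ≤ C := fun F =>
    le_of_tendsto (tendsto_finsetSum F fun i _ => hlim i) (hC F)
  exact ⟨summable_of_sum_le hg h, Real.tsum_le_of_sum_le hg h⟩

/-! ### Double power series -/

/-- The `n`-linear form `v ↦ ∏_{k < i} (v k).1 * ∏_{k ≥ i} (v k).2`. -/
def bidegreeForm (n i : ℕ) : ContinuousMultilinearMap ℝ (fun _ : Fin n => ℝ × ℝ) ℝ :=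
  (ContinuousMultilinearMap.mkPiAlgebra ℝ (Fin n) ℝ).compContinuousLinearMap
    fun k => if (k : ℕ) < i then ContinuousLinearMap.fst ℝ ℝ ℝ else ContinuousLinearMap.snd ℝ ℝ ℝ

lemma norm_bidegreeForm_le (n i : ℕ) : ‖bidegreeForm n i‖ ≤ 1 := by
  refine (ContinuousMultilinearMap.norm_compContinuousLinearMap_le _ _).trans ?_
  have h1 : ‖ContinuousMultilinearMap.mkPiAlgebra ℝ (Fin n) ℝ‖ ≤ 1 := by simp
  refine mul_le_one₀ h1 (Finset.prod_nonneg fun _ _ => norm_nonneg _) ?_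
  refine Finset.prod_le_one (fun _ _ => norm_nonneg _) fun k _ => ?_
  split_ifs
  · exact ContinuousLinearMap.norm_fst_le ..
  · exact ContinuousLinearMap.norm_snd_le ..

lemma bidegreeForm_apply (i j : ℕ) (v : ℝ × ℝ) :
    bidegreeForm (i + j) i (fun _ => v) = v.1 ^ i * v.2 ^ j := by
  simp only [bidegreeForm, ContinuousMultilinearMap.compContinuousLinearMap_apply,
    ContinuousMultilinearMap.mkPiAlgebra_apply]
  rw [Fin.prod_univ_add]
  simp

/-- The formal multilinear series of the double power series with coefficients `w`. -/
def doubleSeries (w : ℕ × ℕ → ℝ) : FormalMultilinearSeries ℝ (ℝ × ℝ) ℝ := fun n =>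
  ∑ q ∈ Finset.HasAntidiagonal.antidiagonal n, w q • bidegreeForm n q.1

lemma doubleSeries_apply (w : ℕ × ℕ → ℝ) (n : ℕ) (v : ℝ × ℝ) :
    doubleSeries w n (fun _ => v) =
      ∑ q ∈ Finset.HasAntidiagonal.antidiagonal n, w q * (v.1 ^ q.1 * v.2 ^ q.2) := by
  simp only [doubleSeries, sum_apply, smul_apply,
    smul_eq_mul]
  refine Finset.sum_congr rfl fun q hq => ?_
  obtain rfl := Finset.HasAntidiagonal.mem_antidiagonal.1 hq
  rw [bidegreeForm_apply]

lemma hasSum_antidiagonal {f : ℕ × ℕ → ℝ} {s : ℝ} (h : HasSum f s) :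
    HasSum (fun n => ∑ q ∈ Finset.HasAntidiagonal.antidiagonal n, f q) s := by
  have h1 := (Finset.HasAntidiagonal.sigmaAntidiagonalEquivProd (A := ℕ)).hasSum_iff.2 h
  refine h1.sigma fun n => ?_
  rw [← Finset.sum_coe_sort]
  exact hasSum_fintype _

lemma hasFPowerSeriesOnBall_doubleSeries {w : ℕ × ℕ → ℝ} (hw : Summable w) :
    HasFPowerSeriesOnBall (fun v : ℝ × ℝ => ∑' q, w q * (v.1 ^ q.1 * v.2 ^ q.2))
      (doubleSeries w) 0 1 := by
  have hn : Summable fun n => ‖doubleSeries w n‖ := by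
    refine Summable.of_nonneg_of_le (fun _ => norm_nonneg _) (fun n => ?_)
      (hasSum_antidiagonal hw.norm.hasSum).summable
    refine (norm_sum_le _ _).trans (Finset.sum_le_sum fun q _ => ?_)
    rw [norm_smul]
    exact mul_le_of_le_one_right (norm_nonneg _) (norm_bidegreeForm_le _ _)
  refine ⟨?_, one_pos, ?_⟩
  · have := FormalMultilinearSeries.le_radius_of_summable_norm (doubleSeries w) (r := 1)
      (by simpa using hn)
    simpa using this
  · intro v hv
    rw [zero_add]
    simp_rw [doubleSeries_apply]
    apply hasSum_antidiagonal
    refine Summable.hasSum ?_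
    have hv1 : ‖v‖ < 1 := by
      rwa [Metric.mem_eball, edist_zero_right, ← ofReal_norm, ENNReal.ofReal_lt_one] at hv
    refine Summable.of_norm_bounded hw.norm fun q => ?_
    rw [norm_mul, norm_mul, norm_pow, norm_pow]
    refine mul_le_of_le_one_right (norm_nonneg _) (mul_le_one₀ ?_ (by positivity) ?_)
    · exact pow_le_one₀ (norm_nonneg _) ((norm_fst_le v).trans hv1.le)
    · exact pow_le_one₀ (norm_nonneg _) ((norm_snd_le v).trans hv1.le)

/-- Summation over the mass first leaves a double power series with summable coefficients. Its
radius of convergence about `0`, for the sup norm on `ℝ × ℝ`, is at least `1`. -/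
lemma analyticOnNhd_tsum {w : S → ℝ} (hw : Summable w) :
    AnalyticOnNhd ℝ (fun v : ℝ × ℝ => ∑' p, w p * (v.1 ^ p.1 * v.2 ^ p.2.1))
      (Ioo 0 1 ×ˢ Ioo 0 1) := by
  set e : S ≃ (ℕ × ℕ) × ℕ+ := (Equiv.prodAssoc ℕ ℕ ℕ+).symm with he
  have hw' : Summable fun q : (ℕ × ℕ) × ℕ+ => w (e.symm q) := e.symm.summable_iff.2 hw
  have hs : Summable fun q : ℕ × ℕ => ∑' m, w (e.symm (q, m)) := hw'.prod
  have hsub : (Ioo 0 1 ×ˢ Ioo 0 1 : Set (ℝ × ℝ)) ⊆ Metric.eball 0 1 := by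
    rintro v ⟨h1, h2⟩
    have : ‖v‖ < 1 := by
      rw [Prod.norm_def, max_lt_iff, Real.norm_eq_abs, Real.norm_eq_abs, abs_of_pos h1.1,
        abs_of_pos h2.1]
      exact ⟨h1.2, h2.2⟩
    rwa [Metric.mem_eball, edist_zero_right, ← ofReal_norm, ENNReal.ofReal_lt_one]
  have ha := (hasFPowerSeriesOnBall_doubleSeries hs).analyticOnNhd.mono hsub
  refine ha.congr (isOpen_Ioo.prod isOpen_Ioo) fun v hv => ?_
  have hv' : Summable fun q : (ℕ × ℕ) × ℕ+ =>
      w (e.symm q) * (v.1 ^ q.1.1 * v.2 ^ q.1.2) := by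
    refine Summable.of_norm_bounded hw'.norm fun q => ?_
    rw [norm_mul, norm_mul, norm_pow, norm_pow, Real.norm_eq_abs v.1, Real.norm_eq_abs v.2,
      abs_of_pos hv.1.1, abs_of_pos hv.2.1]
    exact mul_le_of_le_one_right (norm_nonneg _) (mul_le_one₀
      (pow_le_one₀ hv.1.1.le hv.1.2.le) (pow_nonneg hv.2.1.le _)
      (pow_le_one₀ hv.2.1.le hv.2.2.le))
  calc _ = ∑' q : ℕ × ℕ, ∑' m, w (e.symm (q, m)) * (v.1 ^ q.1 * v.2 ^ q.2) :=
        tsum_congr fun q => tsum_mul_right.symm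
    _ = ∑' q : (ℕ × ℕ) × ℕ+, w (e.symm q) * (v.1 ^ q.1.1 * v.2 ^ q.1.2) := hv'.tsum_prod.symm
    _ = _ := e.symm.tsum_eq fun p => w p * (v.1 ^ p.1 * v.2 ^ p.2.1)

end SexedSmoluchowski

namespace SexedSmoluchowski

/-! ### The system without loss term -/

lemma mass_lt_of_mem_below {p p' : S} (h : p' ∈ below p) :
    (p'.2.2 : ℕ) < p.2.2 ∧ ((rest p p').2.2 : ℕ) < p.2.2 := by
  obtain ⟨-, -, h3⟩ := mem_below.1 h
  have h4 := congrArg (fun q : S => (q.2.2 : ℕ)) (join_rest h)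
  simp only [join, PNat.add_coe] at h4
  have h5 := p'.2.2.pos
  have h6 : (p'.2.2 : ℕ) < p.2.2 := h3
  have h7 : 0 < (p'.2.2 : ℕ) := h5
  refine ⟨h6, ?_⟩
  rw [← h4]
  exact Nat.lt_add_of_pos_left h7

/-- The system without loss is triangular in the mass: the gain of a type depends on strictly
lighter types only. Hence finitely many integrations produce each component of the solution. -/
lemma gain_congr {U U' : S → ℝ} {p : S} (h : ∀ q : S, (q.2.2 : ℕ) < p.2.2 → U q = U' q) :
    gain U p = gain U' p := by
  unfold gain
  congr 1
  refine Finset.sum_congr rfl fun q hq => ?_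
  obtain ⟨h1, h2⟩ := mass_lt_of_mem_below hq
  rw [h _ h1, h _ h2]

lemma continuous_gain {X : Type*} [TopologicalSpace X] {U : X → S → ℝ}
    (h : ∀ p, Continuous fun s => U s p) (p : S) : Continuous fun s => gain (U s) p := by
  unfold gain
  have := h
  fun_prop

lemma continuousOn_gain {X : Type*} [TopologicalSpace X] {U : X → S → ℝ} {s : Set X} {p : S}
    (h : ∀ q : S, (q.2.2 : ℕ) < p.2.2 → ContinuousOn (fun s => U s q) s) :
    ContinuousOn (fun s => gain (U s) p) s := by
  unfold gain
  refine continuousOn_const.mul (continuousOn_finsetSum _ fun q hq => ?_)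
  obtain ⟨h1, h2⟩ := mass_lt_of_mem_below hq
  exact (continuousOn_const.mul (h _ h1)).mul (h _ h2)

/-- Picard iterates of the system `dU/dτ = gain U`. -/
def picard (c₀ : S → ℝ) : ℕ → ℝ → S → ℝ
  | 0 => fun _ => c₀
  | n + 1 => fun τ p => c₀ p + ∫ s in (0 : ℝ)..τ, gain (picard c₀ n s) p

lemma picard_eq_of_mass_le (c₀ : S → ℝ) : ∀ (n : ℕ) (τ : ℝ) (p : S), (p.2.2 : ℕ) ≤ n →
    picard c₀ n τ p = picard c₀ p.2.2 τ p := by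
  suffices h : ∀ (m n : ℕ) (τ : ℝ) (p : S), (p.2.2 : ℕ) ≤ m → m ≤ n →
      picard c₀ n τ p = picard c₀ m τ p from fun n τ p hp => h _ n τ p le_rfl hp
  intro m
  induction m with
  | zero => intro n τ p hp; have := p.2.2.pos; omega
  | succ m ih =>
    intro n τ p hp hn
    obtain ⟨n, rfl⟩ : ∃ k, n = k + 1 := ⟨n - 1, by omega⟩
    simp only [picard]
    congr 1
    refine intervalIntegral.integral_congr fun s _ => gain_congr fun q hq => ?_
    exact ih n s q (by omega) (by omega)

/-- The solution of `dU/dτ = gain U` that starts from `c₀`. -/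
def flow (c₀ : S → ℝ) (τ : ℝ) (p : S) : ℝ := picard c₀ p.2.2 τ p

lemma continuous_picard (c₀ : S → ℝ) (n : ℕ) (p : S) : Continuous fun τ => picard c₀ n τ p := by
  induction n generalizing p with
  | zero => exact continuous_const
  | succ n ih =>
    simp only [picard]
    exact continuous_const.add
      (intervalIntegral.continuous_primitive
        (fun a b => (continuous_gain ih p).intervalIntegrable a b) 0)

lemma flow_eq (c₀ : S → ℝ) (τ : ℝ) (p : S) :
    flow c₀ τ p = c₀ p + ∫ s in (0 : ℝ)..τ, gain (flow c₀ s) p := by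
  obtain ⟨k, hk⟩ : ∃ k : ℕ, (p.2.2 : ℕ) = k + 1 :=
    ⟨p.2.2 - 1, by have := p.2.2.pos; omega⟩
  rw [flow, hk]
  simp only [picard]
  congr 1
  refine intervalIntegral.integral_congr fun s _ => gain_congr fun q hq => ?_
  exact picard_eq_of_mass_le c₀ k s q (by omega)

lemma continuous_flow (c₀ : S → ℝ) (p : S) : Continuous fun τ => flow c₀ τ p :=
  continuous_picard c₀ _ p

@[simp] lemma flow_zero (c₀ : S → ℝ) : flow c₀ 0 = c₀ := by
  funext p; rw [flow_eq]; simp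

lemma hasDerivAt_flow (c₀ : S → ℝ) (τ : ℝ) (p : S) :
    HasDerivAt (fun s => flow c₀ s p) (gain (flow c₀ τ) p) τ := by
  have hc := continuous_gain (continuous_flow c₀) p
  have := (intervalIntegral.integral_hasDerivAt_right (hc.intervalIntegrable 0 τ)
    hc.stronglyMeasurable.stronglyMeasurableAtFilter hc.continuousAt).const_add (c₀ p)
  exact this.congr_of_eventuallyEq (Eventually.of_forall fun s => flow_eq c₀ s p)

lemma flow_nonneg {c₀ : S → ℝ} (h : ∀ p, 0 ≤ c₀ p) {τ : ℝ} (hτ : 0 ≤ τ) (p : S) :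
    0 ≤ flow c₀ τ p := by
  obtain ⟨n, hn⟩ : ∃ n : ℕ, (p.2.2 : ℕ) ≤ n := ⟨_, le_rfl⟩
  induction n generalizing p τ with
  | zero => have := p.2.2.pos; omega
  | succ n ih =>
    rw [flow_eq]
    refine add_nonneg (h p) (intervalIntegral.integral_nonneg hτ fun s hs => ?_)
    refine mul_nonneg (by norm_num) (Finset.sum_nonneg fun q hq => ?_)
    obtain ⟨h1, h2⟩ := mass_lt_of_mem_below hq
    exact mul_nonneg (mul_nonneg (rate_nonneg _ _) (ih hs.1 _ (by omega)))
      (ih hs.1 _ (by omega))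

/-! ### Elementary facts on the monomials and their derivatives -/

section monomials

variable {x y z : ℝ}

lemma monomial_nonneg (hx : 0 ≤ x) (hy : 0 ≤ y) (hz : 0 ≤ z) (p : S) : 0 ≤ monomial x y z p := by
  unfold monomial; positivity

lemma dX_nonneg (hx : 0 ≤ x) (hy : 0 ≤ y) (hz : 0 ≤ z) (p : S) : 0 ≤ dX x y z p := by
  have := male_nonneg p
  unfold dX; positivity

lemma dY_nonneg (hx : 0 ≤ x) (hy : 0 ≤ y) (hz : 0 ≤ z) (p : S) : 0 ≤ dY x y z p := by
  have := female_nonneg p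
  unfold dY; positivity

lemma dZ_nonneg (hx : 0 ≤ x) (hy : 0 ≤ y) (hz : 0 ≤ z) (p : S) : 0 ≤ dZ x y z p := by
  have := mass_nonneg p
  unfold dZ; positivity

lemma natCast_mul_pred_nonneg (n : ℕ) : (0 : ℝ) ≤ n * (n - 1) := by
  rcases n with _ | n
  · simp
  · push_cast; rw [add_sub_cancel_right]; positivity

lemma dXX_nonneg (hx : 0 ≤ x) (hy : 0 ≤ y) (hz : 0 ≤ z) (p : S) : 0 ≤ dXX x y z p := by
  have : 0 ≤ male p * (male p - 1) := natCast_mul_pred_nonneg _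
  unfold dXX; positivity

lemma dYY_nonneg (hx : 0 ≤ x) (hy : 0 ≤ y) (hz : 0 ≤ z) (p : S) : 0 ≤ dYY x y z p := by
  have : 0 ≤ female p * (female p - 1) := natCast_mul_pred_nonneg _
  unfold dYY; positivity

lemma dXY_nonneg (hx : 0 ≤ x) (hy : 0 ≤ y) (hz : 0 ≤ z) (p : S) : 0 ≤ dXY x y z p := by
  have := male_nonneg p
  have := female_nonneg p
  unfold dXY; positivity

lemma dXZ_nonneg (hx : 0 ≤ x) (hy : 0 ≤ y) (hz : 0 ≤ z) (p : S) : 0 ≤ dXZ x y z p := by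
  have := male_nonneg p
  have := mass_nonneg p
  unfold dXZ; positivity

lemma dYZ_nonneg (hx : 0 ≤ x) (hy : 0 ≤ y) (hz : 0 ≤ z) (p : S) : 0 ≤ dYZ x y z p := by
  have := female_nonneg p
  have := mass_nonneg p
  unfold dYZ; positivity

variable {x' y' z' : ℝ}

lemma monomial_mono (hx : 0 ≤ x) (hy : 0 ≤ y) (hz : 0 ≤ z) (hxx : x ≤ x') (hyy : y ≤ y')
    (hzz : z ≤ z') (p : S) : monomial x y z p ≤ monomial x' y' z' p := by
  have := hx.trans hxx
  have := hy.trans hyy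
  unfold monomial; gcongr

lemma dX_mono (hx : 0 ≤ x) (hy : 0 ≤ y) (hz : 0 ≤ z) (hxx : x ≤ x') (hyy : y ≤ y')
    (hzz : z ≤ z') (p : S) : dX x y z p ≤ dX x' y' z' p := by
  have := hx.trans hxx
  have := hy.trans hyy
  have := male_nonneg p
  unfold dX; gcongr

lemma dY_mono (hx : 0 ≤ x) (hy : 0 ≤ y) (hz : 0 ≤ z) (hxx : x ≤ x') (hyy : y ≤ y')
    (hzz : z ≤ z') (p : S) : dY x y z p ≤ dY x' y' z' p := by
  have := hx.trans hxx
  have := hy.trans hyy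
  have := female_nonneg p
  unfold dY; gcongr

lemma dZ_mono (hx : 0 ≤ x) (hy : 0 ≤ y) (hz : 0 ≤ z) (hxx : x ≤ x') (hyy : y ≤ y')
    (hzz : z ≤ z') (p : S) : dZ x y z p ≤ dZ x' y' z' p := by
  have := hx.trans hxx
  have := hy.trans hyy
  have := mass_nonneg p
  unfold dZ; gcongr

lemma dXX_mono (hx : 0 ≤ x) (hy : 0 ≤ y) (hz : 0 ≤ z) (hxx : x ≤ x') (hyy : y ≤ y')
    (hzz : z ≤ z') (p : S) : dXX x y z p ≤ dXX x' y' z' p := by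
  have := hx.trans hxx
  have := hy.trans hyy
  have : 0 ≤ male p * (male p - 1) := natCast_mul_pred_nonneg _
  unfold dXX; gcongr

lemma dYY_mono (hx : 0 ≤ x) (hy : 0 ≤ y) (hz : 0 ≤ z) (hxx : x ≤ x') (hyy : y ≤ y')
    (hzz : z ≤ z') (p : S) : dYY x y z p ≤ dYY x' y' z' p := by
  have := hx.trans hxx
  have := hy.trans hyy
  have : 0 ≤ female p * (female p - 1) := natCast_mul_pred_nonneg _
  unfold dYY; gcongr

lemma dXY_mono (hx : 0 ≤ x) (hy : 0 ≤ y) (hz : 0 ≤ z) (hxx : x ≤ x') (hyy : y ≤ y')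
    (hzz : z ≤ z') (p : S) : dXY x y z p ≤ dXY x' y' z' p := by
  have := hx.trans hxx
  have := hy.trans hyy
  have := male_nonneg p
  have := female_nonneg p
  unfold dXY; gcongr

variable {f g : ℝ → ℝ} {f' g' : ℝ} {s : Set ℝ} {t : ℝ}

lemma hasDerivWithinAt_monomial (hf : HasDerivWithinAt f f' s t) (hg : HasDerivWithinAt g g' s t)
    (z : ℝ) (p : S) : HasDerivWithinAt (fun r => monomial (f r) (g r) z p)
      (dX (f t) (g t) z p * f' + dY (f t) (g t) z p * g') s t := by
  refine (((hf.pow p.1).mul (hg.pow p.2.1)).mul_const (z ^ (p.2.2 : ℕ))).congr_deriv ?_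
  simp only [dX, dY, male, female, Pi.pow_apply]; ring

lemma natCast_mul_cast_pred (n : ℕ) : (n : ℝ) * ((n - 1 : ℕ) : ℝ) = n * (n - 1) := by
  rcases n with _ | n <;> simp

lemma hasDerivWithinAt_dX (hf : HasDerivWithinAt f f' s t) (hg : HasDerivWithinAt g g' s t)
    (z : ℝ) (p : S) : HasDerivWithinAt (fun r => dX (f r) (g r) z p)
      (dXX (f t) (g t) z p * f' + dXY (f t) (g t) z p * g') s t := by
  have := (((hf.pow (p.1 - 1)).mul (hg.pow p.2.1)).mul_const (z ^ (p.2.2 : ℕ))).const_mul (male p)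
  refine (this.congr_deriv ?_).congr_of_eventuallyEq ?_ ?_
  · simp only [dXX, dXY, male, female, Nat.sub_sub, Nat.reduceAdd, Pi.pow_apply]
    linear_combination (f t ^ (p.1 - 2) * g t ^ p.2.1 * z ^ (p.2.2 : ℕ) * f') *
      natCast_mul_cast_pred p.1
  · exact Eventually.of_forall fun r => by simp only [dX, Pi.mul_apply, Pi.pow_apply]; ring
  · simp only [dX, Pi.mul_apply, Pi.pow_apply]; ring

lemma hasDerivWithinAt_dY (hf : HasDerivWithinAt f f' s t) (hg : HasDerivWithinAt g g' s t)
    (z : ℝ) (p : S) : HasDerivWithinAt (fun r => dY (f r) (g r) z p)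
      (dXY (f t) (g t) z p * f' + dYY (f t) (g t) z p * g') s t := by
  have := (((hf.pow p.1).mul (hg.pow (p.2.1 - 1))).mul_const
    (z ^ (p.2.2 : ℕ))).const_mul (female p)
  refine (this.congr_deriv ?_).congr_of_eventuallyEq ?_ ?_
  · simp only [dYY, dXY, male, female, Nat.sub_sub, Nat.reduceAdd, Pi.pow_apply]
    linear_combination (f t ^ p.1 * g t ^ (p.2.1 - 2) * z ^ (p.2.2 : ℕ) * g') *
      natCast_mul_cast_pred p.2.1
  · exact Eventually.of_forall fun r => by simp only [dY, Pi.mul_apply, Pi.pow_apply]; ring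
  · simp only [dY, Pi.mul_apply, Pi.pow_apply]; ring

lemma hasDerivWithinAt_dZ (hf : HasDerivWithinAt f f' s t) (hg : HasDerivWithinAt g g' s t)
    (z : ℝ) (p : S) : HasDerivWithinAt (fun r => dZ (f r) (g r) z p)
      (dXZ (f t) (g t) z p * f' + dYZ (f t) (g t) z p * g') s t := by
  have := (((hf.pow p.1).mul (hg.pow p.2.1)).mul_const
    (z ^ ((p.2.2 : ℕ) - 1))).const_mul (mass p)
  refine (this.congr_deriv ?_).congr_of_eventuallyEq ?_ ?_
  · simp only [dXZ, dYZ, male, female, Pi.pow_apply]; ring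
  · exact Eventually.of_forall fun r => by simp only [dZ, Pi.mul_apply, Pi.pow_apply]; ring
  · simp only [dZ, Pi.mul_apply, Pi.pow_apply]; ring

lemma hasDerivWithinAt_monomial_mass (x y : ℝ) (s : Set ℝ) (z : ℝ) (p : S) :
    HasDerivWithinAt (fun r => monomial x y r p) (dZ x y z p) s z := by
  refine ((hasDerivWithinAt_pow (p.2.2 : ℕ) z (s := s)).const_mul
    (x ^ p.1 * y ^ p.2.1)).congr_deriv ?_
  simp only [dZ, mass]; ring

end monomials

end SexedSmoluchowski

/-! ### A priori bounds on the shrinking square `[0, 1 - τ]²` -/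

namespace SexedSmoluchowski

/-- The hypotheses on the initial condition. -/
structure Admissible (c₀ : S → ℝ) : Prop where
  nonneg : ∀ p, 0 ≤ c₀ p
  summable : Summable c₀
  male : HasSum (fun p => c₀ p * male p) 1
  female : HasSum (fun p => c₀ p * female p) 1
  second : Summable fun p => c₀ p * (SexedSmoluchowski.male p ^ 2 + SexedSmoluchowski.female p ^ 2)

/-- Continuous induction in time. Since `z < 1` strictly, functions that are at most `z` at some
time stay below `1` for a while, and during that while they do not increase, so they remain at most
`z`. -/
lemma le_of_hasDerivAt_nonpos_of_le_one {P Q P' Q' : ℝ → ℝ} {z : ℝ} (hz : z < 1)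
    (hP : ∀ s, HasDerivAt P (P' s) s) (hQ : ∀ s, HasDerivAt Q (Q' s) s)
    (h : ∀ s ∈ Ico (0 : ℝ) 1, P s ≤ 1 → Q s ≤ 1 → P' s ≤ 0 ∧ Q' s ≤ 0)
    (hP0 : P 0 ≤ z) (hQ0 : Q 0 ≤ z) {τ : ℝ} (hτ : τ ∈ Ico (0 : ℝ) 1) : P τ ≤ z ∧ Q τ ≤ z := by
  have hPc : Continuous P := continuous_iff_continuousAt.2 fun s => (hP s).continuousAt
  have hQc : Continuous Q := continuous_iff_continuousAt.2 fun s => (hQ s).continuousAt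
  set A : Set ℝ := {s | P s ≤ z ∧ Q s ≤ z} with hA
  have hcl : IsClosed (A ∩ Icc 0 τ) :=
    ((isClosed_le hPc continuous_const).inter (isClosed_le hQc continuous_const)).inter isClosed_Icc
  refine hcl.Icc_subset_of_forall_mem_nhdsWithin (show (0 : ℝ) ∈ A from ⟨hP0, hQ0⟩) ?_
    (right_mem_Icc.2 hτ.1)
  rintro s ⟨⟨hPs, hQs⟩, hs0, hs1⟩
  have hev : ∀ᶠ r in 𝓝 s, P r < 1 ∧ Q r < 1 ∧ r < 1 :=
    (hPc.continuousAt.eventually_lt continuousAt_const (hPs.trans_lt hz)).and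
      ((hQc.continuousAt.eventually_lt continuousAt_const (hQs.trans_lt hz)).and
        (eventually_lt_nhds (hs1.trans hτ.2)))
  obtain ⟨ε, hε, hball⟩ := Metric.eventually_nhds_iff.1 hev
  have hmem : Ioo s (s + ε) ∈ 𝓝[>] s := Ioo_mem_nhdsGT (by linarith)
  refine mem_of_superset hmem fun r hr => ?_
  have hin : ∀ r' ∈ Ioo s r, P' r' ≤ 0 ∧ Q' r' ≤ 0 := by
    intro r' hr'
    have := hball (y := r') (by
      rw [Real.dist_eq, abs_of_pos (by linarith [hr'.1])]; linarith [hr'.2, hr.2])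
    exact h r' ⟨hs0.trans hr'.1.le, this.2.2⟩ this.1.le this.2.1.le
  have hPa : AntitoneOn P (Icc s r) := by
    refine antitoneOn_of_deriv_nonpos (convex_Icc _ _) hPc.continuousOn
      (fun r' _ => (hP r').differentiableAt.differentiableWithinAt) fun r' hr' => ?_
    rw [(hP r').deriv]; rw [interior_Icc] at hr'; exact (hin r' hr').1
  have hQa : AntitoneOn Q (Icc s r) := by
    refine antitoneOn_of_deriv_nonpos (convex_Icc _ _) hQc.continuousOn
      (fun r' _ => (hQ r').differentiableAt.differentiableWithinAt) fun r' hr' => ?_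
    rw [(hQ r').deriv]; rw [interior_Icc] at hr'; exact (hin r' hr').2
  exact ⟨(hPa (left_mem_Icc.2 hr.1.le) (right_mem_Icc.2 hr.1.le) hr.1.le).trans hPs,
    (hQa (left_mem_Icc.2 hr.1.le) (right_mem_Icc.2 hr.1.le) hr.1.le).trans hQs⟩

namespace Admissible

variable {c₀ : S → ℝ}

lemma flow_nonneg (h : Admissible c₀) {τ : ℝ} (hτ : 0 ≤ τ) (p : S) : 0 ≤ flow c₀ τ p :=
  SexedSmoluchowski.flow_nonneg h.nonneg hτ p

/-- The point `(1 - s, 1 - s)` moves inwards at unit speed in each coordinate. This is the largest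
speed that a characteristic can have once the gradient is bounded by `1`. -/
lemma hasDerivAt_sum {w wx wy : ℝ → ℝ → ℝ → S → ℝ}
    (hw : ∀ (s z : ℝ) (p : S), HasDerivWithinAt (fun r => w (1 - r) (1 - r) z p)
      (wx (1 - s) (1 - s) z p * (-1) + wy (1 - s) (1 - s) z p * (-1)) univ s)
    (c₀ : S → ℝ) (A : Finset S) (z s : ℝ) :
    HasDerivAt (fun r => ∑ p ∈ A, flow c₀ r p * w (1 - r) (1 - r) z p)
      (∑ p ∈ A, w (1 - s) (1 - s) z p * gain (flow c₀ s) p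
        - ∑ p ∈ A, flow c₀ s p * wx (1 - s) (1 - s) z p
        - ∑ p ∈ A, flow c₀ s p * wy (1 - s) (1 - s) z p) s := by
  rw [← Finset.sum_sub_distrib, ← Finset.sum_sub_distrib]
  refine HasDerivAt.fun_sum fun p _ => ?_
  refine ((hasDerivAt_flow c₀ s p).mul (hasDerivWithinAt_univ.1 (hw s z p))).congr_deriv ?_
  ring

lemma hasDerivWithinAt_one_sub (s : ℝ) (t : Set ℝ) :
    HasDerivWithinAt (fun r : ℝ => 1 - r) (-1) t s :=
  ((hasDerivAt_id s).const_sub 1).hasDerivWithinAt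

/-- With `P`, `Q` the truncated derivatives of `g` in `x`, `y` at `(1 - s, 1 - s, z)`, the time
derivative of `P` is at most `P_x (Q - 1) + P_y (P - 1)`, and similarly for `Q`. Both are
nonpositive as long as `P, Q ≤ 1`. -/
lemma trunc_bound (h : Admissible c₀) (N : ℕ) {z : ℝ} (hz0 : 0 < z) (hz : z < 1) {τ : ℝ}
    (hτ : τ ∈ Ico (0 : ℝ) 1) :
    ∑ p ∈ trunc N, flow c₀ τ p * dX (1 - τ) (1 - τ) z p ≤ z ∧
      ∑ p ∈ trunc N, flow c₀ τ p * dY (1 - τ) (1 - τ) z p ≤ z := by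
  have hA := hereditary_trunc N
  refine le_of_hasDerivAt_nonpos_of_le_one hz
    (hasDerivAt_sum (fun s z p => hasDerivWithinAt_dX (hasDerivWithinAt_one_sub s _)
      (hasDerivWithinAt_one_sub s _) z p) c₀ (trunc N) z)
    (hasDerivAt_sum (fun s z p => hasDerivWithinAt_dY (hasDerivWithinAt_one_sub s _)
      (hasDerivWithinAt_one_sub s _) z p) c₀ (trunc N) z) ?_ ?_ ?_ hτ
  · intro s hs hP hQ
    have hx : 0 ≤ 1 - s := by linarith [hs.2]
    have hU := fun p => h.flow_nonneg hs.1 p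
    have hXX : 0 ≤ ∑ p ∈ trunc N, flow c₀ s p * dXX (1 - s) (1 - s) z p :=
      Finset.sum_nonneg fun p _ => mul_nonneg (hU p) (dXX_nonneg hx hx hz0.le p)
    have hXY : 0 ≤ ∑ p ∈ trunc N, flow c₀ s p * dXY (1 - s) (1 - s) z p :=
      Finset.sum_nonneg fun p _ => mul_nonneg (hU p) (dXY_nonneg hx hx hz0.le p)
    have hYY : 0 ≤ ∑ p ∈ trunc N, flow c₀ s p * dYY (1 - s) (1 - s) z p :=
      Finset.sum_nonneg fun p _ => mul_nonneg (hU p) (dYY_nonneg hx hx hz0.le p)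
    have h1 := (leibniz_dX (1 - s) (1 - s) z).sum_gain_le hA hU (dX_nonneg hx hx hz0.le)
    have h2 := (leibniz_dY (1 - s) (1 - s) z).sum_gain_le hA hU (dY_nonneg hx hx hz0.le)
    constructor
    · linarith [mul_le_mul_of_nonneg_left hQ hXX, mul_le_mul_of_nonneg_right hP hXY]
    · linarith [mul_le_mul_of_nonneg_left hQ hXY, mul_le_mul_of_nonneg_right hP hYY]
  all_goals
    simp only [sub_zero, flow_zero]
  · calc _ ≤ ∑ p ∈ trunc N, z * (c₀ p * SexedSmoluchowski.male p) :=
          Finset.sum_le_sum fun p _ => by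
            -- Masses are at least `1`, which provides the strict initial margin `z < 1` needed for
            -- the continuous induction.
            have h1 : z ^ (p.2.2 : ℕ) ≤ z := pow_le_of_le_one hz0.le hz.le p.2.2.ne_zero
            simp only [dX, one_pow, mul_one]
            nlinarith [mul_le_mul_of_nonneg_left h1 (mul_nonneg (h.nonneg p) (male_nonneg p))]
      _ = z * ∑ p ∈ trunc N, (c₀ p * SexedSmoluchowski.male p) := by rw [Finset.mul_sum]
      _ ≤ z := mul_le_of_le_one_right hz0.le
          (sum_le_hasSum _ (fun p _ => mul_nonneg (h.nonneg p) (male_nonneg p)) h.male)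
  · calc _ ≤ ∑ p ∈ trunc N, z * (c₀ p * SexedSmoluchowski.female p) :=
          Finset.sum_le_sum fun p _ => by
            have h1 : z ^ (p.2.2 : ℕ) ≤ z := pow_le_of_le_one hz0.le hz.le p.2.2.ne_zero
            simp only [dY, one_pow, mul_one]
            nlinarith [mul_le_mul_of_nonneg_left h1 (mul_nonneg (h.nonneg p) (female_nonneg p))]
      _ = z * ∑ p ∈ trunc N, (c₀ p * SexedSmoluchowski.female p) := by rw [Finset.mul_sum]
      _ ≤ z := mul_le_of_le_one_right hz0.le
          (sum_le_hasSum _ (fun p _ => mul_nonneg (h.nonneg p) (female_nonneg p)) h.female)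

/-- The truncated sums are polynomials in `z`, so the bounds pass to the limit `z ↑ 1`. -/
lemma trunc_bound_one (h : Admissible c₀) (N : ℕ) {τ : ℝ} (hτ : τ ∈ Ico (0 : ℝ) 1) :
    ∑ p ∈ trunc N, flow c₀ τ p * dX (1 - τ) (1 - τ) 1 p ≤ 1 ∧
      ∑ p ∈ trunc N, flow c₀ τ p * dY (1 - τ) (1 - τ) 1 p ≤ 1 := by
  have hev : ∀ᶠ z : ℝ in 𝓝[<] 1, 0 < z ∧ z < 1 :=
    Ioo_mem_nhdsLT one_pos
  have hid : Tendsto (fun z : ℝ => z) (𝓝[<] 1) (𝓝 1) := nhdsWithin_le_nhds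
  constructor
  · refine le_of_tendsto_of_tendsto (b := 𝓝[<] (1 : ℝ)) (f := fun z =>
      ∑ p ∈ trunc N, flow c₀ τ p * dX (1 - τ) (1 - τ) z p) (g := fun z => z) ?_ hid ?_
    · have : Continuous fun z => ∑ p ∈ trunc N, flow c₀ τ p * dX (1 - τ) (1 - τ) z p := by
        unfold dX; fun_prop
      exact (this.tendsto 1).mono_left nhdsWithin_le_nhds
    · filter_upwards [hev] with z hz using (h.trunc_bound N hz.1 hz.2 hτ).1
  · refine le_of_tendsto_of_tendsto (b := 𝓝[<] (1 : ℝ)) (f := fun z =>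
      ∑ p ∈ trunc N, flow c₀ τ p * dY (1 - τ) (1 - τ) z p) (g := fun z => z) ?_ hid ?_
    · have : Continuous fun z => ∑ p ∈ trunc N, flow c₀ τ p * dY (1 - τ) (1 - τ) z p := by
        unfold dY; fun_prop
      exact (this.tendsto 1).mono_left nhdsWithin_le_nhds
    · filter_upwards [hev] with z hz using (h.trunc_bound N hz.1 hz.2 hτ).2

/-- The derivative along the diagonal is at most `P Q - P - Q`, which is nonpositive for `P, Q ∈ [0,
1]`. -/
lemma trunc_bound_monomial (h : Admissible c₀) (N : ℕ) {τ : ℝ} (hτ : τ ∈ Ico (0 : ℝ) 1) :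
    ∑ p ∈ trunc N, flow c₀ τ p * monomial (1 - τ) (1 - τ) 1 p ≤ ∑' p, c₀ p := by
  have hd := hasDerivAt_sum (fun s z p => hasDerivWithinAt_monomial (hasDerivWithinAt_one_sub s _)
      (hasDerivWithinAt_one_sub s _) z p) c₀ (trunc N) 1
  have hanti : AntitoneOn (fun s => ∑ p ∈ trunc N, flow c₀ s p * monomial (1 - s) (1 - s) 1 p)
      (Ico 0 1) := by
    refine antitoneOn_of_deriv_nonpos (convex_Ico _ _)
      (fun s _ => (hd s).continuousAt.continuousWithinAt)
      (fun s _ => (hd s).differentiableAt.differentiableWithinAt) fun s hs => ?_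
    rw [interior_Ico] at hs
    rw [(hd s).deriv]
    have hx : 0 ≤ 1 - s := by linarith [hs.2]
    have hU := fun p => h.flow_nonneg hs.1.le p
    obtain ⟨hP, hQ⟩ := h.trunc_bound_one N ⟨hs.1.le, hs.2⟩
    have hP0 : 0 ≤ ∑ p ∈ trunc N, flow c₀ s p * dX (1 - s) (1 - s) 1 p :=
      Finset.sum_nonneg fun p _ => mul_nonneg (hU p) (dX_nonneg hx hx one_pos.le p)
    have hQ0 : 0 ≤ ∑ p ∈ trunc N, flow c₀ s p * dY (1 - s) (1 - s) 1 p :=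
      Finset.sum_nonneg fun p _ => mul_nonneg (hU p) (dY_nonneg hx hx one_pos.le p)
    have h1 := sum_gain_monomial_le (hereditary_trunc N) hU hx hx one_pos.le
    nlinarith [mul_le_mul_of_nonneg_left hQ hP0]
  have := hanti (left_mem_Ico.2 one_pos) hτ hτ.1
  refine this.trans ?_
  simp only [sub_zero, flow_zero, monomial, one_pow, mul_one]
  exact h.summable.sum_le_tsum _ fun p _ => h.nonneg p

lemma sum_flow_dX_le (h : Admissible c₀) {τ : ℝ} (hτ : τ ∈ Ico (0 : ℝ) 1) (F : Finset S) :
    ∑ p ∈ F, flow c₀ τ p * dX (1 - τ) (1 - τ) 1 p ≤ 1 := by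
  obtain ⟨N, hN⟩ := exists_subset_trunc F
  have hx : 0 ≤ 1 - τ := by linarith [hτ.2]
  exact (Finset.sum_le_sum_of_subset_of_nonneg hN fun p _ _ =>
    mul_nonneg (h.flow_nonneg hτ.1 p) (dX_nonneg hx hx one_pos.le p)).trans
    (h.trunc_bound_one N hτ).1

lemma sum_flow_dY_le (h : Admissible c₀) {τ : ℝ} (hτ : τ ∈ Ico (0 : ℝ) 1) (F : Finset S) :
    ∑ p ∈ F, flow c₀ τ p * dY (1 - τ) (1 - τ) 1 p ≤ 1 := by
  obtain ⟨N, hN⟩ := exists_subset_trunc F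
  have hx : 0 ≤ 1 - τ := by linarith [hτ.2]
  exact (Finset.sum_le_sum_of_subset_of_nonneg hN fun p _ _ =>
    mul_nonneg (h.flow_nonneg hτ.1 p) (dY_nonneg hx hx one_pos.le p)).trans
    (h.trunc_bound_one N hτ).2

lemma sum_flow_monomial_le (h : Admissible c₀) {τ : ℝ} (hτ : τ ∈ Ico (0 : ℝ) 1) (F : Finset S) :
    ∑ p ∈ F, flow c₀ τ p * monomial (1 - τ) (1 - τ) 1 p ≤ ∑' p, c₀ p := by
  obtain ⟨N, hN⟩ := exists_subset_trunc F
  have hx : 0 ≤ 1 - τ := by linarith [hτ.2]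
  exact (Finset.sum_le_sum_of_subset_of_nonneg hN fun p _ _ =>
    mul_nonneg (h.flow_nonneg hτ.1 p) (monomial_nonneg hx hx one_pos.le p)).trans
    (h.trunc_bound_monomial N hτ)

variable {τ x y z : ℝ}

lemma flow_dX_le (h : Admissible c₀) (hτ : τ ∈ Ico (0 : ℝ) 1) (hx : x ∈ Icc 0 (1 - τ))
    (hy : y ∈ Icc 0 (1 - τ)) (hz : z ∈ Icc (0 : ℝ) 1) (p : S) :
    flow c₀ τ p * dX x y z p ≤ flow c₀ τ p * dX (1 - τ) (1 - τ) 1 p :=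
  mul_le_mul_of_nonneg_left (dX_mono hx.1 hy.1 hz.1 hx.2 hy.2 hz.2 p) (h.flow_nonneg hτ.1 p)

lemma flow_dY_le (h : Admissible c₀) (hτ : τ ∈ Ico (0 : ℝ) 1) (hx : x ∈ Icc 0 (1 - τ))
    (hy : y ∈ Icc 0 (1 - τ)) (hz : z ∈ Icc (0 : ℝ) 1) (p : S) :
    flow c₀ τ p * dY x y z p ≤ flow c₀ τ p * dY (1 - τ) (1 - τ) 1 p :=
  mul_le_mul_of_nonneg_left (dY_mono hx.1 hy.1 hz.1 hx.2 hy.2 hz.2 p) (h.flow_nonneg hτ.1 p)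

lemma flow_monomial_le (h : Admissible c₀) (hτ : τ ∈ Ico (0 : ℝ) 1) (hx : x ∈ Icc 0 (1 - τ))
    (hy : y ∈ Icc 0 (1 - τ)) (hz : z ∈ Icc (0 : ℝ) 1) (p : S) :
    flow c₀ τ p * monomial x y z p ≤ flow c₀ τ p * monomial (1 - τ) (1 - τ) 1 p :=
  mul_le_mul_of_nonneg_left (monomial_mono hx.1 hy.1 hz.1 hx.2 hy.2 hz.2 p) (h.flow_nonneg hτ.1 p)

lemma flow_dX_nonneg (h : Admissible c₀) (hτ : τ ∈ Ico (0 : ℝ) 1) (hx : x ∈ Icc 0 (1 - τ))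
    (hy : y ∈ Icc 0 (1 - τ)) (hz : z ∈ Icc (0 : ℝ) 1) (p : S) : 0 ≤ flow c₀ τ p * dX x y z p :=
  mul_nonneg (h.flow_nonneg hτ.1 p) (dX_nonneg hx.1 hy.1 hz.1 p)

lemma flow_dY_nonneg (h : Admissible c₀) (hτ : τ ∈ Ico (0 : ℝ) 1) (hx : x ∈ Icc 0 (1 - τ))
    (hy : y ∈ Icc 0 (1 - τ)) (hz : z ∈ Icc (0 : ℝ) 1) (p : S) : 0 ≤ flow c₀ τ p * dY x y z p :=
  mul_nonneg (h.flow_nonneg hτ.1 p) (dY_nonneg hx.1 hy.1 hz.1 p)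

lemma flow_monomial_nonneg (h : Admissible c₀) (hτ : τ ∈ Ico (0 : ℝ) 1) (hx : x ∈ Icc 0 (1 - τ))
    (hy : y ∈ Icc 0 (1 - τ)) (hz : z ∈ Icc (0 : ℝ) 1) (p : S) :
    0 ≤ flow c₀ τ p * monomial x y z p :=
  mul_nonneg (h.flow_nonneg hτ.1 p) (monomial_nonneg hx.1 hy.1 hz.1 p)

lemma one_sub_mem (hτ : τ ∈ Ico (0 : ℝ) 1) : 1 - τ ∈ Icc 0 (1 - τ) :=
  right_mem_Icc.2 (by linarith [hτ.2])

lemma one_mem : (1 : ℝ) ∈ Icc (0 : ℝ) 1 := right_mem_Icc.2 zero_le_one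

lemma summable_flow_dX_corner (h : Admissible c₀) (hτ : τ ∈ Ico (0 : ℝ) 1) :
    Summable fun p => flow c₀ τ p * dX (1 - τ) (1 - τ) 1 p :=
  summable_of_sum_le (h.flow_dX_nonneg hτ (one_sub_mem hτ) (one_sub_mem hτ) one_mem)
    (h.sum_flow_dX_le hτ)

lemma summable_flow_dY_corner (h : Admissible c₀) (hτ : τ ∈ Ico (0 : ℝ) 1) :
    Summable fun p => flow c₀ τ p * dY (1 - τ) (1 - τ) 1 p :=
  summable_of_sum_le (h.flow_dY_nonneg hτ (one_sub_mem hτ) (one_sub_mem hτ) one_mem)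
    (h.sum_flow_dY_le hτ)

lemma summable_flow_monomial_corner (h : Admissible c₀) (hτ : τ ∈ Ico (0 : ℝ) 1) :
    Summable fun p => flow c₀ τ p * monomial (1 - τ) (1 - τ) 1 p :=
  summable_of_sum_le (h.flow_monomial_nonneg hτ (one_sub_mem hτ) (one_sub_mem hτ) one_mem)
    (h.sum_flow_monomial_le hτ)

lemma summable_flow_dX (h : Admissible c₀) (hτ : τ ∈ Ico (0 : ℝ) 1) (hx : x ∈ Icc 0 (1 - τ))
    (hy : y ∈ Icc 0 (1 - τ)) (hz : z ∈ Icc (0 : ℝ) 1) :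
    Summable fun p => flow c₀ τ p * dX x y z p :=
  (h.summable_flow_dX_corner hτ).of_nonneg_of_le (h.flow_dX_nonneg hτ hx hy hz)
    (h.flow_dX_le hτ hx hy hz)

lemma summable_flow_dY (h : Admissible c₀) (hτ : τ ∈ Ico (0 : ℝ) 1) (hx : x ∈ Icc 0 (1 - τ))
    (hy : y ∈ Icc 0 (1 - τ)) (hz : z ∈ Icc (0 : ℝ) 1) :
    Summable fun p => flow c₀ τ p * dY x y z p :=
  (h.summable_flow_dY_corner hτ).of_nonneg_of_le (h.flow_dY_nonneg hτ hx hy hz)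
    (h.flow_dY_le hτ hx hy hz)

lemma summable_flow_monomial (h : Admissible c₀) (hτ : τ ∈ Ico (0 : ℝ) 1)
    (hx : x ∈ Icc 0 (1 - τ)) (hy : y ∈ Icc 0 (1 - τ)) (hz : z ∈ Icc (0 : ℝ) 1) :
    Summable fun p => flow c₀ τ p * monomial x y z p :=
  (h.summable_flow_monomial_corner hτ).of_nonneg_of_le (h.flow_monomial_nonneg hτ hx hy hz)
    (h.flow_monomial_le hτ hx hy hz)

lemma tsum_flow_dX_mem (h : Admissible c₀) (hτ : τ ∈ Ico (0 : ℝ) 1) (hx : x ∈ Icc 0 (1 - τ))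
    (hy : y ∈ Icc 0 (1 - τ)) (hz : z ∈ Icc (0 : ℝ) 1) :
    ∑' p, flow c₀ τ p * dX x y z p ∈ Icc (0 : ℝ) 1 :=
  ⟨tsum_nonneg (h.flow_dX_nonneg hτ hx hy hz),
    Real.tsum_le_of_sum_le (h.flow_dX_nonneg hτ hx hy hz) fun F =>
      (Finset.sum_le_sum fun p _ => h.flow_dX_le hτ hx hy hz p).trans (h.sum_flow_dX_le hτ F)⟩

lemma tsum_flow_dY_mem (h : Admissible c₀) (hτ : τ ∈ Ico (0 : ℝ) 1) (hx : x ∈ Icc 0 (1 - τ))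
    (hy : y ∈ Icc 0 (1 - τ)) (hz : z ∈ Icc (0 : ℝ) 1) :
    ∑' p, flow c₀ τ p * dY x y z p ∈ Icc (0 : ℝ) 1 :=
  ⟨tsum_nonneg (h.flow_dY_nonneg hτ hx hy hz),
    Real.tsum_le_of_sum_le (h.flow_dY_nonneg hτ hx hy hz) fun F =>
      (Finset.sum_le_sum fun p _ => h.flow_dY_le hτ hx hy hz p).trans (h.sum_flow_dY_le hτ F)⟩

end Admissible

end SexedSmoluchowski

/-! ### Domination of the weights in the interior of the domain of convergence -/

namespace SexedSmoluchowski

/-- The division by `ρ ^ 2` pays for the at most two exponents lost to differentiation, whether or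
not the subtraction truncates. -/
lemma pow_sub_le {x ρ : ℝ} (hx : 0 ≤ x) (hxρ : x ≤ ρ) (hρ0 : 0 < ρ) (hρ : ρ ≤ 1) (n : ℕ) {k : ℕ}
    (hk : k ≤ 2) : x ^ (n - k) ≤ ρ ^ n / ρ ^ 2 := by
  rw [le_div_iff₀ (by positivity)]
  calc x ^ (n - k) * ρ ^ 2 ≤ ρ ^ (n - k) * ρ ^ 2 := by gcongr
    _ = ρ ^ (n - k + 2) := (pow_add _ _ _).symm
    _ ≤ ρ ^ n := pow_le_pow_of_le_one hρ0.le hρ (by omega)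

/-- The decaying majorant of the weights. -/
def majorant (ρ κ : ℝ) (p : S) : ℝ :=
  (size p : ℝ) ^ 2 * (ρ ^ p.1 / ρ ^ 2 * (ρ ^ p.2.1 / ρ ^ 2) * (κ ^ (p.2.2 : ℕ) / κ ^ 2))

lemma weight_le_majorant {x y z ρ κ c : ℝ} (hx : x ∈ Icc 0 ρ) (hy : y ∈ Icc 0 ρ)
    (hz : z ∈ Icc 0 κ) (hρ : ρ ∈ Ioc (0 : ℝ) 1) (hκ : κ ∈ Ioc (0 : ℝ) 1) (p : S) {i j k : ℕ}
    (hi : i ≤ 2) (hj : j ≤ 2) (hk : k ≤ 2) (hc : c ≤ (size p : ℝ) ^ 2) :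
    c * x ^ (p.1 - i) * y ^ (p.2.1 - j) * z ^ ((p.2.2 : ℕ) - k) ≤ majorant ρ κ p := by
  have h1 := pow_sub_le hx.1 hx.2 hρ.1 hρ.2 p.1 hi
  have h2 := pow_sub_le hy.1 hy.2 hρ.1 hρ.2 p.2.1 hj
  have h3 := pow_sub_le hz.1 hz.2 hκ.1 hκ.2 (p.2.2 : ℕ) hk
  have hx' := pow_nonneg hx.1 (p.1 - i)
  have hy' := pow_nonneg hy.1 (p.2.1 - j)
  have hz' := pow_nonneg hz.1 ((p.2.2 : ℕ) - k)
  have hρ' := hρ.1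
  calc _ = c * (x ^ (p.1 - i) * y ^ (p.2.1 - j) * z ^ ((p.2.2 : ℕ) - k)) := by ring
    _ ≤ (size p : ℝ) ^ 2 * (x ^ (p.1 - i) * y ^ (p.2.1 - j) * z ^ ((p.2.2 : ℕ) - k)) := by gcongr
    _ ≤ _ := by unfold majorant; gcongr

lemma male_le_size (p : S) : male p ≤ size p := by
  simp only [male, size]; exact_mod_cast (by omega)

lemma female_le_size (p : S) : female p ≤ size p := by
  simp only [female, size]; exact_mod_cast (by omega)

lemma mass_le_size (p : S) : mass p ≤ size p := by
  simp only [mass, size]; exact_mod_cast (by omega)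

lemma one_le_size (p : S) : (1 : ℝ) ≤ size p := by
  have := p.2.2.pos
  simp only [size]; exact_mod_cast (by omega)

lemma size_le_sq (p : S) : (size p : ℝ) ≤ (size p : ℝ) ^ 2 := by
  nlinarith [one_le_size p]

/-- A family of nonnegative weights with its first derivatives in `x` and `y`, to which the
method of characteristics applies. -/
structure IsWeight (w wx wy : ℝ → ℝ → ℝ → S → ℝ) : Prop where
  leibniz : ∀ x y z, Leibniz (w x y z) (wx x y z) (wy x y z) (dX x y z) (dY x y z)
  deriv : ∀ {f g : ℝ → ℝ} {f' g' : ℝ} {s : Set ℝ} {t : ℝ}, HasDerivWithinAt f f' s t →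
    HasDerivWithinAt g g' s t → ∀ (z : ℝ) (p : S), HasDerivWithinAt (fun r => w (f r) (g r) z p)
      (wx (f t) (g t) z p * f' + wy (f t) (g t) z p * g') s t
  nonneg : ∀ {x y z : ℝ}, 0 ≤ x → 0 ≤ y → 0 ≤ z → ∀ p,
    0 ≤ w x y z p ∧ 0 ≤ wx x y z p ∧ 0 ≤ wy x y z p
  le_majorant : ∀ {x y z ρ κ : ℝ}, x ∈ Icc 0 ρ → y ∈ Icc 0 ρ → z ∈ Icc 0 κ → ρ ∈ Ioc (0 : ℝ) 1 →
    κ ∈ Ioc (0 : ℝ) 1 → ∀ p, w x y z p ≤ majorant ρ κ p ∧ wx x y z p ≤ majorant ρ κ p ∧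
      wy x y z p ≤ majorant ρ κ p

lemma isWeight_dX : IsWeight dX dXX dXY where
  leibniz := leibniz_dX
  deriv := hasDerivWithinAt_dX
  nonneg hx hy hz p := ⟨dX_nonneg hx hy hz p, dXX_nonneg hx hy hz p, dXY_nonneg hx hy hz p⟩
  le_majorant hx hy hz hρ hκ p := by
    have h1 := male_nonneg p
    have h2 := female_nonneg p
    have h3 := male_le_size p
    have h4 := female_le_size p
    exact ⟨weight_le_majorant hx hy hz hρ hκ p (i := 1) (j := 0) (k := 0) (by simp) (by simp)
        (by simp) (h3.trans (size_le_sq p)),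
      weight_le_majorant hx hy hz hρ hκ p (i := 2) (j := 0) (k := 0) (by simp) (by simp)
        (by simp) (by nlinarith),
      weight_le_majorant hx hy hz hρ hκ p (i := 1) (j := 1) (k := 0) (by simp) (by simp)
        (by simp) (by nlinarith)⟩

lemma isWeight_dY : IsWeight dY dXY dYY where
  leibniz := leibniz_dY
  deriv := hasDerivWithinAt_dY
  nonneg hx hy hz p := ⟨dY_nonneg hx hy hz p, dXY_nonneg hx hy hz p, dYY_nonneg hx hy hz p⟩
  le_majorant hx hy hz hρ hκ p := by
    have h1 := male_nonneg p
    have h2 := female_nonneg p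
    have h3 := male_le_size p
    have h4 := female_le_size p
    exact ⟨weight_le_majorant hx hy hz hρ hκ p (i := 0) (j := 1) (k := 0) (by simp) (by simp)
        (by simp) (h4.trans (size_le_sq p)),
      weight_le_majorant hx hy hz hρ hκ p (i := 1) (j := 1) (k := 0) (by simp) (by simp)
        (by simp) (by nlinarith),
      weight_le_majorant hx hy hz hρ hκ p (i := 0) (j := 2) (k := 0) (by simp) (by simp)
        (by simp) (by nlinarith)⟩

lemma isWeight_dZ : IsWeight dZ dXZ dYZ where
  leibniz := leibniz_dZ
  deriv := hasDerivWithinAt_dZ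
  nonneg hx hy hz p := ⟨dZ_nonneg hx hy hz p, dXZ_nonneg hx hy hz p, dYZ_nonneg hx hy hz p⟩
  le_majorant hx hy hz hρ hκ p := by
    have h1 := male_nonneg p
    have h2 := female_nonneg p
    have h3 := male_le_size p
    have h4 := female_le_size p
    have h5 := mass_nonneg p
    have h6 := mass_le_size p
    exact ⟨weight_le_majorant hx hy hz hρ hκ p (i := 0) (j := 0) (k := 1) (by simp) (by simp)
        (by simp) (h6.trans (size_le_sq p)),
      weight_le_majorant hx hy hz hρ hκ p (i := 1) (j := 0) (k := 1) (by simp) (by simp)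
        (by simp) (by nlinarith),
      weight_le_majorant hx hy hz hρ hκ p (i := 0) (j := 1) (k := 1) (by simp) (by simp)
        (by simp) (by nlinarith)⟩

lemma summable_pow_size {r : ℝ} (h0 : 0 ≤ r) (h1 : r < 1) : Summable fun p : S => r ^ size p := by
  have hg := summable_geometric_of_lt_one h0 h1
  have hg' : Summable fun m : ℕ+ => r ^ (m : ℕ) := hg.comp_injective PNat.coe_injective
  have h2 : Summable fun q : ℕ × ℕ+ => r ^ q.1 * r ^ (q.2 : ℕ) :=
    hg.mul_of_nonneg hg' (fun _ => pow_nonneg h0 _) fun _ => pow_nonneg h0 _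
  have h3 : Summable fun q : ℕ × (ℕ × ℕ+) => r ^ q.1 * (r ^ q.2.1 * r ^ (q.2.2 : ℕ)) :=
    hg.mul_of_nonneg (g := fun q : ℕ × ℕ+ => r ^ q.1 * r ^ (q.2 : ℕ)) h2
      (fun _ => pow_nonneg h0 _) fun _ => mul_nonneg (pow_nonneg h0 _) (pow_nonneg h0 _)
  refine h3.congr fun p => ?_
  rw [size, pow_add, pow_add, mul_assoc]

lemma summable_sq_mul_pow_size {r : ℝ} (h0 : 0 ≤ r) (h1 : r < 1) :
    Summable fun p : S => (size p : ℝ) ^ 2 * r ^ size p := by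
  obtain ⟨q, hq1, hq2⟩ := exists_between h1
  have hq0 : 0 < q := h0.trans_lt hq1
  have hlim := tendsto_pow_const_mul_const_pow_of_lt_one 2 (r := r / q) (by positivity)
    ((div_lt_one hq0).2 hq1)
  obtain ⟨C, hC⟩ := hlim.bddAbove_range
  refine Summable.of_nonneg_of_le (fun p => by positivity) (fun p => ?_)
    ((summable_pow_size hq0.le hq2).mul_left C)
  have := hC ⟨size p, rfl⟩
  simp only [div_pow] at this
  calc (size p : ℝ) ^ 2 * r ^ size p = (size p : ℝ) ^ 2 * (r ^ size p / q ^ size p) * q ^ size p := by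
        field_simp
    _ ≤ _ := by gcongr

namespace Admissible

variable {c₀ : S → ℝ} (h : Admissible c₀)

end Admissible

end SexedSmoluchowski

namespace SexedSmoluchowski

/-- The constant in the domination of the weights up to time `τ`. -/
def domConst (τ δ κ : ℝ) : ℝ := 1 / (((1 - δ) * (1 - τ)) ^ 4 * κ ^ 2)

/-- The summable function that dominates the weights. -/
def domFun (δ κ : ℝ) (p : S) : ℝ := (size p : ℝ) ^ 2 * max (1 - δ) κ ^ size p

lemma domFun_nonneg {δ κ : ℝ} (hκ : κ ∈ Ioo (0 : ℝ) 1) (p : S) : 0 ≤ domFun δ κ p := by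
  have : 0 ≤ max (1 - δ) κ := le_max_of_le_right hκ.1.le
  unfold domFun; positivity

lemma summable_domFun {δ κ : ℝ} (hδ : δ ∈ Ioo (0 : ℝ) 1) (hκ : κ ∈ Ioo (0 : ℝ) 1) :
    Summable (domFun δ κ) :=
  summable_sq_mul_pow_size (le_max_of_le_right hκ.1.le) (max_lt (by linarith [hδ.1]) hκ.2)

lemma domConst_pos {τ δ κ : ℝ} (hτ : τ < 1) (hδ : δ ∈ Ioo (0 : ℝ) 1) (hκ : κ ∈ Ioo (0 : ℝ) 1) :
    0 < domConst τ δ κ := by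
  have h1 : 0 < 1 - δ := by linarith [hδ.2]
  have h2 : 0 < 1 - τ := by linarith
  have h3 := hκ.1
  unfold domConst; positivity

/-- Relative to the monomial at the corner `(1 - s, 1 - s, 1)`, the margin `δ` in `x, y` and the
bound `κ < 1` in `z` leave a geometric factor in the size, which absorbs the polynomial prefactor.
The constant is uniform in `s ≤ τ`. -/
lemma majorant_le {τ δ κ s : ℝ} (hτ : τ < 1) (hδ : δ ∈ Ioo (0 : ℝ) 1) (hκ : κ ∈ Ioo (0 : ℝ) 1)
    (hs : s ≤ τ) (p : S) : majorant ((1 - δ) * (1 - s)) κ p ≤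
      domConst τ δ κ * domFun δ κ p * monomial (1 - s) (1 - s) 1 p := by
  have h1 : 0 < 1 - δ := by linarith [hδ.2]
  have h2 : 0 < 1 - τ := by linarith
  have h3 : 1 - τ ≤ 1 - s := by linarith
  have h4 : 0 < 1 - s := by linarith
  have h5 := hκ.1
  have h6 : (1 - δ) ^ p.1 * (1 - δ) ^ p.2.1 * κ ^ (p.2.2 : ℕ) ≤ max (1 - δ) κ ^ size p := by
    rw [size, pow_add, pow_add]
    gcongr
    · exact le_max_left _ _
    · exact le_max_left _ _
    · exact le_max_right _ _
  calc majorant ((1 - δ) * (1 - s)) κ p = 1 / (((1 - δ) * (1 - s)) ^ 4 * κ ^ 2) *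
        ((size p : ℝ) ^ 2 * ((1 - δ) ^ p.1 * (1 - δ) ^ p.2.1 * κ ^ (p.2.2 : ℕ))) *
        ((1 - s) ^ p.1 * (1 - s) ^ p.2.1) := by
        unfold majorant; rw [mul_pow _ _ p.1, mul_pow _ _ p.2.1]; field_simp
    _ ≤ 1 / (((1 - δ) * (1 - τ)) ^ 4 * κ ^ 2) *
        ((size p : ℝ) ^ 2 * max (1 - δ) κ ^ size p) * ((1 - s) ^ p.1 * (1 - s) ^ p.2.1) := by
        gcongr
    _ = _ := by simp only [domConst, domFun, monomial, one_pow, mul_one]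

namespace Admissible

variable {c₀ : S → ℝ} {τ δ κ s x y z : ℝ} {w wx wy : ℝ → ℝ → ℝ → S → ℝ}

/-- A single gain is one term of a truncated sum that is bounded by the product of the two truncated
first derivatives, each at most `1`. -/
lemma monomial_mul_gain_le_one (h : Admissible c₀) (hs : s ∈ Ico (0 : ℝ) 1) (p : S) :
    monomial (1 - s) (1 - s) 1 p * gain (flow c₀ s) p ≤ 1 := by
  have hx : 0 ≤ 1 - s := by linarith [hs.2]
  have hU := h.flow_nonneg hs.1
  calc _ ≤ ∑ q ∈ trunc (size p), monomial (1 - s) (1 - s) 1 q * gain (flow c₀ s) q :=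
        Finset.single_le_sum (f := fun q => monomial (1 - s) (1 - s) 1 q * gain (flow c₀ s) q)
          (fun q _ => mul_nonneg (monomial_nonneg hx hx one_pos.le q) (gain_nonneg hU q))
          (mem_trunc.2 le_rfl)
    _ ≤ _ := sum_gain_monomial_le (hereditary_trunc _) hU hx hx one_pos.le
    _ ≤ 1 := mul_le_one₀ (h.trunc_bound_one _ hs).1
          (Finset.sum_nonneg fun q _ => mul_nonneg (hU q) (dY_nonneg hx hx one_pos.le q))
          (h.trunc_bound_one _ hs).2

lemma flow_mul_monomial_le (h : Admissible c₀) (hs : s ∈ Ico (0 : ℝ) 1) (p : S) :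
    flow c₀ s p * monomial (1 - s) (1 - s) 1 p ≤ ∑' p, c₀ p := by
  simpa using h.sum_flow_monomial_le hs {p}

lemma flow_mul_weight_le (h : Admissible c₀) (hτ : τ < 1) (hδ : δ ∈ Ioo (0 : ℝ) 1)
    (hκ : κ ∈ Ioo (0 : ℝ) 1) (hs : s ∈ Icc 0 τ) {p : S} {a : ℝ}
    (ha : a ≤ majorant ((1 - δ) * (1 - s)) κ p) :
    flow c₀ s p * a ≤ domConst τ δ κ * (∑' p, c₀ p) * domFun δ κ p := by
  have h1 := h.flow_nonneg hs.1 p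
  have h2 := domConst_pos hτ hδ hκ
  have h3 := domFun_nonneg (δ := δ) hκ p
  calc _ ≤ flow c₀ s p * (domConst τ δ κ * domFun δ κ p * monomial (1 - s) (1 - s) 1 p) := by
        gcongr; exact ha.trans (majorant_le hτ hδ hκ hs.2 p)
    _ = domConst τ δ κ * domFun δ κ p * (flow c₀ s p * monomial (1 - s) (1 - s) 1 p) := by ring
    _ ≤ domConst τ δ κ * domFun δ κ p * ∑' p, c₀ p := by
        gcongr; exact h.flow_mul_monomial_le ⟨hs.1, hs.2.trans_lt hτ⟩ p
    _ = _ := by ring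

lemma weight_mul_gain_le (h : Admissible c₀) (hτ : τ < 1) (hδ : δ ∈ Ioo (0 : ℝ) 1)
    (hκ : κ ∈ Ioo (0 : ℝ) 1) (hs : s ∈ Icc 0 τ) {p : S} {a : ℝ}
    (ha : a ≤ majorant ((1 - δ) * (1 - s)) κ p) :
    a * gain (flow c₀ s) p ≤ domConst τ δ κ * domFun δ κ p := by
  have h1 := gain_nonneg (h.flow_nonneg hs.1) p
  have h2 := domConst_pos hτ hδ hκ
  have h3 := domFun_nonneg (δ := δ) hκ p
  calc _ ≤ (domConst τ δ κ * domFun δ κ p * monomial (1 - s) (1 - s) 1 p) *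
        gain (flow c₀ s) p := by
        gcongr; exact ha.trans (majorant_le hτ hδ hκ hs.2 p)
    _ = domConst τ δ κ * domFun δ κ p *
        (monomial (1 - s) (1 - s) 1 p * gain (flow c₀ s) p) := by ring
    _ ≤ _ := mul_le_of_le_one_right (by positivity)
        (h.monomial_mul_gain_le_one ⟨hs.1, hs.2.trans_lt hτ⟩ p)

/-- The interior of the domain of convergence at time `s`, with margin `δ`. -/
lemma interior_Icc_subset (hτ : τ < 1) (hδ : δ ∈ Ioo (0 : ℝ) 1) (hs : s ∈ Icc 0 τ) :
    Icc 0 ((1 - δ) * (1 - s)) ⊆ Icc 0 (1 - s) ∧ (1 - δ) * (1 - s) ∈ Ioc (0 : ℝ) 1 := by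
  have h1 : 0 < 1 - δ := by linarith [hδ.2]
  have h2 : 0 < 1 - s := by linarith [hs.2]
  have h3 : (1 - δ) * (1 - s) ≤ 1 - s := mul_le_of_le_one_left h2.le (by linarith [hδ.1])
  exact ⟨Icc_subset_Icc_right h3, by positivity, by linarith [hs.1]⟩

/-- The uniform bound of the sums of `flow` against the derivatives of a weight. -/
def sumBound (c₀ : S → ℝ) (τ δ κ : ℝ) : ℝ := ∑' p, domConst τ δ κ * (∑' p, c₀ p) * domFun δ κ p

lemma summable_flow_weight (h : Admissible c₀) (hτ : τ < 1) (hδ : δ ∈ Ioo (0 : ℝ) 1)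
    (hκ : κ ∈ Ioo (0 : ℝ) 1) (hs : s ∈ Icc 0 τ) {a : S → ℝ}
    (ha0 : ∀ p, 0 ≤ a p) (ha : ∀ p, a p ≤ majorant ((1 - δ) * (1 - s)) κ p) :
    Summable (fun p => flow c₀ s p * a p) ∧
      0 ≤ ∑' p, flow c₀ s p * a p ∧ ∑' p, flow c₀ s p * a p ≤ sumBound c₀ τ δ κ := by
  have h1 : ∀ p, 0 ≤ flow c₀ s p * a p := fun p => mul_nonneg (h.flow_nonneg hs.1 p) (ha0 p)
  have h2 := fun p => h.flow_mul_weight_le hτ hδ hκ hs (ha p)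
  have h3 := (summable_domFun hδ hκ).mul_left (domConst τ δ κ * (∑' p, c₀ p))
  have h4 := h3.of_nonneg_of_le h1 h2
  exact ⟨h4, tsum_nonneg h1, h4.tsum_le_tsum h2 h3⟩

/-- Evolution of a weighted sum along a curve that moves at constant speed. -/
lemma hasDerivWithinAt_tsum_flow (h : Admissible c₀) (hW : IsWeight w wx wy) (hτ : τ ∈ Ico (0 : ℝ) 1)
    (hδ : δ ∈ Ioo (0 : ℝ) 1) (hκ : κ ∈ Ioo (0 : ℝ) 1) (hz : z ∈ Icc 0 κ) {X Y : ℝ → ℝ}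
    {P Q : ℝ} (hP : P ∈ Icc (0 : ℝ) 1) (hQ : Q ∈ Icc (0 : ℝ) 1)
    (hX : ∀ r ∈ Icc 0 τ, X r ∈ Icc 0 ((1 - δ) * (1 - (τ - r))))
    (hY : ∀ r ∈ Icc 0 τ, Y r ∈ Icc 0 ((1 - δ) * (1 - (τ - r))))
    (hX' : ∀ r, HasDerivAt X Q r) (hY' : ∀ r, HasDerivAt Y P r) {r : ℝ} (hr : r ∈ Icc 0 τ) :
    HasDerivWithinAt (fun r => ∑' p, flow c₀ (τ - r) p * w (X r) (Y r) z p)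
      ((∑' p, flow c₀ (τ - r) p * wx (X r) (Y r) z p) *
          (Q - ∑' p, flow c₀ (τ - r) p * dY (X r) (Y r) z p) +
        (P - ∑' p, flow c₀ (τ - r) p * dX (X r) (Y r) z p) *
          ∑' p, flow c₀ (τ - r) p * wy (X r) (Y r) z p) (Icc 0 τ) r := by
  have hs : ∀ r ∈ Icc 0 τ, τ - r ∈ Icc 0 τ := fun r hr => ⟨by linarith [hr.2], by linarith [hr.1]⟩
  have hmaj : ∀ r ∈ Icc 0 τ, ∀ p, w (X r) (Y r) z p ≤ majorant ((1 - δ) * (1 - (τ - r))) κ p ∧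
      wx (X r) (Y r) z p ≤ majorant ((1 - δ) * (1 - (τ - r))) κ p ∧
      wy (X r) (Y r) z p ≤ majorant ((1 - δ) * (1 - (τ - r))) κ p := fun r hr =>
    hW.le_majorant (hX r hr) (hY r hr) hz (interior_Icc_subset hτ.2 hδ (hs r hr)).2
      ⟨hκ.1, hκ.2.le⟩
  have hnn : ∀ r ∈ Icc 0 τ, ∀ p, 0 ≤ w (X r) (Y r) z p ∧ 0 ≤ wx (X r) (Y r) z p ∧
      0 ≤ wy (X r) (Y r) z p := fun r hr => hW.nonneg (hX r hr).1 (hY r hr).1 hz.1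
  set D := domConst τ δ κ
  set C := ∑' p, c₀ p
  have hderiv := hasDerivWithinAt_tsum (convex_Icc 0 τ)
    (f := fun p r => flow c₀ (τ - r) p * w (X r) (Y r) z p)
    (f' := fun p r => -(w (X r) (Y r) z p * gain (flow c₀ (τ - r)) p) +
      (flow c₀ (τ - r) p * wx (X r) (Y r) z p * Q + flow c₀ (τ - r) p * wy (X r) (Y r) z p * P))
    (u := fun p => D * domFun δ κ p + (D * C * domFun δ κ p + D * C * domFun δ κ p))
    (((summable_domFun hδ hκ).mul_left D).add
      (((summable_domFun hδ hκ).mul_left (D * C)).add ((summable_domFun hδ hκ).mul_left (D * C))))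
    (fun p r _ => by
      have h1 := (hasDerivAt_flow c₀ (τ - r) p).comp_const_sub τ r
      refine (h1.hasDerivWithinAt.mul (hW.deriv (hX' r).hasDerivWithinAt
        (hY' r).hasDerivWithinAt z p)).congr_deriv ?_
      ring)
    (fun p r hr => by
      have h1 := h.weight_mul_gain_le hτ.2 hδ hκ (hs r hr) (hmaj r hr p).1
      have h2 := h.flow_mul_weight_le hτ.2 hδ hκ (hs r hr) (hmaj r hr p).2.1
      have h3 := h.flow_mul_weight_le hτ.2 hδ hκ (hs r hr) (hmaj r hr p).2.2
      have hU := h.flow_nonneg (hs r hr).1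
      have h4 := mul_nonneg (hnn r hr p).1 (gain_nonneg hU p)
      have h5 := mul_nonneg (hU p) (hnn r hr p).2.1
      have h6 := mul_nonneg (hU p) (hnn r hr p).2.2
      refine (abs_add_le _ _).trans (add_le_add ?_ ((abs_add_le _ _).trans (add_le_add ?_ ?_)))
      · rwa [abs_neg, abs_of_nonneg h4]
      · rw [abs_of_nonneg (mul_nonneg h5 hQ.1)]
        exact (mul_le_of_le_one_right h5 hQ.2).trans h2
      · rw [abs_of_nonneg (mul_nonneg h6 hP.1)]
        exact (mul_le_of_le_one_right h6 hP.2).trans h3)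
    hr (h.summable_flow_weight hτ.2 hδ hκ (hs r hr) (fun p => (hnn r hr p).1)
      fun p => (hmaj r hr p).1).1 hr
  refine hderiv.congr_deriv ?_
  have hτr : τ - r ∈ Ico (0 : ℝ) 1 := ⟨(hs r hr).1, (hs r hr).2.trans_lt hτ.2⟩
  have hsub := (interior_Icc_subset hτ.2 hδ (hs r hr)).1
  have hz1 : z ∈ Icc (0 : ℝ) 1 := ⟨hz.1, hz.2.trans hκ.2.le⟩
  have hsx := (h.summable_flow_weight hτ.2 hδ hκ (hs r hr) (fun p => (hnn r hr p).2.1)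
      fun p => (hmaj r hr p).2.1).1
  have hsy := (h.summable_flow_weight hτ.2 hδ hκ (hs r hr) (fun p => (hnn r hr p).2.2)
      fun p => (hmaj r hr p).2.2).1
  -- The curve runs backwards in time, so the gain enters with a minus sign and the motion of the
  -- point with a plus sign. Both contain the derivatives of the weight, which leaves the factors `Q
  -- - g_y` and `P - g_x`.
  have hg := (hW.leibniz (X r) (Y r) z).hasSum_gain hsx hsy
    (h.summable_flow_dX hτr (hsub (hX r hr)) (hsub (hY r hr)) hz1)
    (h.summable_flow_dY hτr (hsub (hX r hr)) (hsub (hY r hr)) hz1)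
  have := (hg.neg.add ((hsx.hasSum.mul_right Q).add (hsy.hasSum.mul_right P))).tsum_eq
  rw [this]
  ring

end Admissible

end SexedSmoluchowski

/-! ### The method of characteristics -/

namespace SexedSmoluchowski

/-- `∂g/∂x` for the generating function `g` at time `τ` of the system without loss term. -/
def flowDx (c₀ : S → ℝ) (τ x y z : ℝ) : ℝ := ∑' p, flow c₀ τ p * dX x y z p

/-- `∂g/∂y` for the generating function `g` at time `τ` of the system without loss term. -/
def flowDy (c₀ : S → ℝ) (τ x y z : ℝ) : ℝ := ∑' p, flow c₀ τ p * dY x y z p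

lemma flowDx_zero (c₀ : S → ℝ) (x y z : ℝ) : flowDx c₀ 0 x y z = ∑' p, c₀ p * dX x y z p := by
  simp only [flowDx, flow_zero]

lemma flowDy_zero (c₀ : S → ℝ) (x y z : ℝ) : flowDy c₀ 0 x y z = ∑' p, c₀ p * dY x y z p := by
  simp only [flowDy, flow_zero]

namespace Admissible

variable {c₀ : S → ℝ} {τ x y z : ℝ}

/-- The method of characteristics. -/
lemma characteristics (h : Admissible c₀) (hτ : τ ∈ Ico (0 : ℝ) 1) (hx : x ∈ Ico 0 (1 - τ))
    (hy : y ∈ Ico 0 (1 - τ)) (hz : z ∈ Ico (0 : ℝ) 1) :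
    ∑' p, c₀ p * dX (x + τ * flowDy c₀ τ x y z) (y + τ * flowDx c₀ τ x y z) z p
        = flowDx c₀ τ x y z ∧
    ∑' p, c₀ p * dY (x + τ * flowDy c₀ τ x y z) (y + τ * flowDx c₀ τ x y z) z p
        = flowDy c₀ τ x y z ∧
    ∑' p, c₀ p * dZ (x + τ * flowDy c₀ τ x y z) (y + τ * flowDx c₀ τ x y z) z p
        = ∑' p, flow c₀ τ p * dZ x y z p := by
  have hxI : x ∈ Icc 0 (1 - τ) := ⟨hx.1, hx.2.le⟩
  have hyI : y ∈ Icc 0 (1 - τ) := ⟨hy.1, hy.2.le⟩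
  have hzI : z ∈ Icc (0 : ℝ) 1 := ⟨hz.1, hz.2.le⟩
  have hP : flowDx c₀ τ x y z ∈ Icc (0 : ℝ) 1 := h.tsum_flow_dX_mem hτ hxI hyI hzI
  have hQ : flowDy c₀ τ x y z ∈ Icc (0 : ℝ) 1 := h.tsum_flow_dY_mem hτ hxI hyI hzI
  set P := flowDx c₀ τ x y z with hPdef
  set Q := flowDy c₀ τ x y z with hQdef
  obtain ⟨κ, hκz, hκ1⟩ := exists_between hz.2
  have hκ : κ ∈ Ioo (0 : ℝ) 1 := ⟨hz.1.trans_lt hκz, hκ1⟩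
  have hzκ : z ∈ Icc 0 κ := ⟨hz.1, hκz.le⟩
  -- A margin at the end point survives along the whole line: speeds are at most `1`, and `1 - τ - δ
  -- + r ≤ (1 - δ)(1 - (τ - r))`.
  obtain ⟨δ, hδ, hδx, hδy⟩ : ∃ δ ∈ Ioo (0 : ℝ) 1, x ≤ 1 - τ - δ ∧ y ≤ 1 - τ - δ := by
    refine ⟨min (1 - τ - x) (1 - τ - y) / 2, ⟨?_, ?_⟩, ?_, ?_⟩
    · have := lt_min (sub_pos.2 hx.2) (sub_pos.2 hy.2); linarith
    · have := min_le_left (1 - τ - x) (1 - τ - y); linarith [hx.1, hτ.1]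
    · have := min_le_left (1 - τ - x) (1 - τ - y); linarith [hx.2]
    · have := min_le_right (1 - τ - x) (1 - τ - y); linarith [hy.2]
  -- The candidate characteristic: the line traced back from `(x, y)`, with the speeds frozen at the
  -- values of the gradient at its end point.
  let X : ℝ → ℝ := fun r => x + r * Q
  let Y : ℝ → ℝ := fun r => y + r * P
  have hX : ∀ r ∈ Icc 0 τ, X r ∈ Icc 0 ((1 - δ) * (1 - (τ - r))) := fun r hr => by
    have h1 := mul_nonneg hr.1 hQ.1
    have h2 := mul_le_of_le_one_right hr.1 hQ.2
    exact ⟨add_nonneg hx.1 h1, by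
      change x + r * Q ≤ _
      nlinarith [mul_nonneg hδ.1.le (show 0 ≤ τ - r by linarith [hr.2])]⟩
  have hY : ∀ r ∈ Icc 0 τ, Y r ∈ Icc 0 ((1 - δ) * (1 - (τ - r))) := fun r hr => by
    have h1 := mul_nonneg hr.1 hP.1
    have h2 := mul_le_of_le_one_right hr.1 hP.2
    exact ⟨add_nonneg hy.1 h1, by
      change y + r * P ≤ _
      nlinarith [mul_nonneg hδ.1.le (show 0 ≤ τ - r by linarith [hr.2])]⟩
  have hX' : ∀ r, HasDerivAt X Q r := fun r => by
    exact (((hasDerivAt_id r).mul_const Q).const_add x).congr_deriv (one_mul Q)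
  have hY' : ∀ r, HasDerivAt Y P r := fun r => by
    exact (((hasDerivAt_id r).mul_const P).const_add y).congr_deriv (one_mul P)
  have hs : ∀ r ∈ Icc 0 τ, τ - r ∈ Icc 0 τ := fun r hr => ⟨by linarith [hr.2], by linarith [hr.1]⟩
  have hbound : ∀ {w wx wy : ℝ → ℝ → ℝ → S → ℝ}, IsWeight w wx wy → ∀ r ∈ Icc 0 τ,
      (0 ≤ ∑' p, flow c₀ (τ - r) p * wx (X r) (Y r) z p ∧
        ∑' p, flow c₀ (τ - r) p * wx (X r) (Y r) z p ≤ sumBound c₀ τ δ κ) ∧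
      (0 ≤ ∑' p, flow c₀ (τ - r) p * wy (X r) (Y r) z p ∧
        ∑' p, flow c₀ (τ - r) p * wy (X r) (Y r) z p ≤ sumBound c₀ τ δ κ) := by
    intro w wx wy hW r hr
    have hmaj := hW.le_majorant (hX r hr) (hY r hr) hzκ (interior_Icc_subset hτ.2 hδ (hs r hr)).2
      ⟨hκ.1, hκ.2.le⟩
    have hnn := hW.nonneg (hX r hr).1 (hY r hr).1 hz.1
    exact ⟨(h.summable_flow_weight hτ.2 hδ hκ (hs r hr) (fun p => (hnn p).2.1)
        fun p => (hmaj p).2.1).2,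
      (h.summable_flow_weight hτ.2 hδ hκ (hs r hr) (fun p => (hnn p).2.2)
        fun p => (hmaj p).2.2).2⟩
  have dP := fun r hr => h.hasDerivWithinAt_tsum_flow isWeight_dX hτ hδ hκ hzκ hP hQ hX hY hX' hY'
    (r := r) hr
  have dQ := fun r hr => h.hasDerivWithinAt_tsum_flow isWeight_dY hτ hδ hκ hzκ hP hQ hX hY hX' hY'
    (r := r) hr
  have dR := fun r hr => h.hasDerivWithinAt_tsum_flow isWeight_dZ hτ hδ hκ hzκ hP hQ hX hY hX' hY'
    (r := r) hr
  have hright : ∀ r ∈ Ico 0 τ, Icc 0 τ ∈ 𝓝[Ici r] r := fun r hr =>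
    mem_of_superset (Icc_mem_nhdsGE hr.2) (Icc_subset_Icc_left hr.1)
  set K := sumBound c₀ τ δ κ with hK
  -- The deviation of the gradient from its frozen value. It vanishes at `r = 0` and its derivative
  -- is at most `2 K ‖E‖`, so it vanishes identically by Grönwall; the line is thus a true
  -- characteristic.
  let E : ℝ → ℝ × ℝ := fun r => (∑' p, flow c₀ (τ - r) p * dX (X r) (Y r) z p - P,
    ∑' p, flow c₀ (τ - r) p * dY (X r) (Y r) z p - Q)
  have dE := fun r hr => ((dP r hr).sub_const P).prodMk ((dQ r hr).sub_const Q)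
  have hest : ∀ {a b u v : ℝ}, (0 ≤ a ∧ a ≤ K) → (0 ≤ b ∧ b ≤ K) →
      |a * (Q - v) + (P - u) * b| ≤ 2 * K * ‖((u - P, v - Q) : ℝ × ℝ)‖ := by
    intro a b u v ha hb
    have h1 : |Q - v| ≤ ‖((u - P, v - Q) : ℝ × ℝ)‖ := by
      rw [abs_sub_comm]; exact norm_snd_le ((u - P, v - Q) : ℝ × ℝ)
    have h2 : |P - u| ≤ ‖((u - P, v - Q) : ℝ × ℝ)‖ := by
      rw [abs_sub_comm]; exact norm_fst_le ((u - P, v - Q) : ℝ × ℝ)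
    calc _ ≤ |a * (Q - v)| + |(P - u) * b| := abs_add_le _ _
      _ = a * |Q - v| + |P - u| * b := by
        rw [abs_mul, abs_mul, abs_of_nonneg ha.1, abs_of_nonneg hb.1]
      _ ≤ K * ‖((u - P, v - Q) : ℝ × ℝ)‖ + ‖((u - P, v - Q) : ℝ × ℝ)‖ * K := by
        exact add_le_add (mul_le_mul ha.2 h1 (abs_nonneg _) (ha.1.trans ha.2))
          (mul_le_mul h2 hb.2 hb.1 (norm_nonneg _))
      _ = _ := by ring
  have hE0 : ∀ r ∈ Icc 0 τ, E r = 0 := by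
    refine eq_zero_of_abs_deriv_le_mul_abs_self_of_eq_zero_right (f := E) (K := 2 * K)
      (fun r hr => (dE r hr).continuousWithinAt)
      (fun r hr => (dE r ⟨hr.1, hr.2.le⟩).mono_of_mem_nhdsWithin (hright r hr)) ?_ ?_
    · simp only [E, X, Y, sub_zero, zero_mul, add_zero]
      rw [hPdef, hQdef]
      simp [flowDx, flowDy]
    · intro r hr
      have hr' : r ∈ Icc 0 τ := ⟨hr.1, hr.2.le⟩
      rw [Prod.norm_def]
      refine max_le ?_ ?_
      · exact hest (hbound isWeight_dX r hr').1 (hbound isWeight_dX r hr').2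
      · exact hest (hbound isWeight_dY r hr').1 (hbound isWeight_dY r hr').2
  have hEr : ∀ r ∈ Icc 0 τ, ∑' p, flow c₀ (τ - r) p * dX (X r) (Y r) z p = P ∧
      ∑' p, flow c₀ (τ - r) p * dY (X r) (Y r) z p = Q := fun r hr =>
    ⟨sub_eq_zero.1 (congrArg Prod.fst (hE0 r hr)), sub_eq_zero.1 (congrArg Prod.snd (hE0 r hr))⟩
  -- Along a true characteristic both factors in the derivative of the `z`-derivative are zero.
  have hRc := constant_of_has_deriv_right_zero (fun r hr => (dR r hr).continuousWithinAt)
    (fun r hr => by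
      have hr' : r ∈ Icc 0 τ := ⟨hr.1, hr.2.le⟩
      have := (dR r hr').mono_of_mem_nhdsWithin (hright r hr)
      rw [(hEr r hr').1, (hEr r hr').2] at this
      simpa using this) τ (right_mem_Icc.2 hτ.1)
  have hEτ := hEr τ (right_mem_Icc.2 hτ.1)
  simp only [sub_self, flow_zero, sub_zero] at hEτ hRc
  refine ⟨hEτ.1, hEτ.2, hRc.trans ?_⟩
  simp only [X, Y, zero_mul, add_zero]

/-! ### Continuity of the series -/

lemma continuous_dX (p : S) : Continuous fun v : ℝ × ℝ × ℝ => dX v.1 v.2.1 v.2.2 p := by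
  unfold dX; fun_prop

lemma continuous_dY (p : S) : Continuous fun v : ℝ × ℝ × ℝ => dY v.1 v.2.1 v.2.2 p := by
  unfold dY; fun_prop

lemma continuous_monomial (p : S) : Continuous fun v : ℝ × ℝ × ℝ => monomial v.1 v.2.1 v.2.2 p := by
  unfold monomial; fun_prop

lemma continuousOn_flowDx (h : Admissible c₀) (hτ : τ ∈ Ico (0 : ℝ) 1) :
    ContinuousOn (fun v : ℝ × ℝ × ℝ => flowDx c₀ τ v.1 v.2.1 v.2.2)
      (Icc 0 (1 - τ) ×ˢ Icc 0 (1 - τ) ×ˢ Icc 0 1) :=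
  continuousOn_tsum (fun p => (continuous_const.mul (continuous_dX p)).continuousOn)
    (h.summable_flow_dX_corner hτ) fun p v hv => by
      rw [Real.norm_eq_abs, abs_of_nonneg (h.flow_dX_nonneg hτ hv.1 hv.2.1 hv.2.2 p)]
      exact h.flow_dX_le hτ hv.1 hv.2.1 hv.2.2 p

lemma continuousOn_flowDy (h : Admissible c₀) (hτ : τ ∈ Ico (0 : ℝ) 1) :
    ContinuousOn (fun v : ℝ × ℝ × ℝ => flowDy c₀ τ v.1 v.2.1 v.2.2)
      (Icc 0 (1 - τ) ×ˢ Icc 0 (1 - τ) ×ˢ Icc 0 1) :=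
  continuousOn_tsum (fun p => (continuous_const.mul (continuous_dY p)).continuousOn)
    (h.summable_flow_dY_corner hτ) fun p v hv => by
      rw [Real.norm_eq_abs, abs_of_nonneg (h.flow_dY_nonneg hτ hv.1 hv.2.1 hv.2.2 p)]
      exact h.flow_dY_le hτ hv.1 hv.2.1 hv.2.2 p

lemma continuousOn_flow_monomial (h : Admissible c₀) (hτ : τ ∈ Ico (0 : ℝ) 1) :
    ContinuousOn (fun v : ℝ × ℝ × ℝ => ∑' p, flow c₀ τ p * monomial v.1 v.2.1 v.2.2 p)
      (Icc 0 (1 - τ) ×ˢ Icc 0 (1 - τ) ×ˢ Icc 0 1) :=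
  continuousOn_tsum (fun p => (continuous_const.mul (continuous_monomial p)).continuousOn)
    (h.summable_flow_monomial_corner hτ) fun p v hv => by
      rw [Real.norm_eq_abs, abs_of_nonneg (h.flow_monomial_nonneg hτ hv.1 hv.2.1 hv.2.2 p)]
      exact h.flow_monomial_le hτ hv.1 hv.2.1 hv.2.2 p

/-- The points at time `0` of the characteristics lie in the unit square. -/
lemma foot_mem (h : Admissible c₀) (hτ : τ ∈ Ico (0 : ℝ) 1) (hx : x ∈ Icc 0 (1 - τ))
    (hy : y ∈ Icc 0 (1 - τ)) (hz : z ∈ Icc (0 : ℝ) 1) :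
    x + τ * flowDy c₀ τ x y z ∈ Icc (0 : ℝ) 1 ∧ y + τ * flowDx c₀ τ x y z ∈ Icc (0 : ℝ) 1 := by
  have hP : flowDx c₀ τ x y z ∈ Icc (0 : ℝ) 1 := h.tsum_flow_dX_mem hτ hx hy hz
  have hQ : flowDy c₀ τ x y z ∈ Icc (0 : ℝ) 1 := h.tsum_flow_dY_mem hτ hx hy hz
  have h1 := mul_le_of_le_one_right hτ.1 hP.2
  have h2 := mul_le_of_le_one_right hτ.1 hQ.2
  have h3 := mul_nonneg hτ.1 hP.1
  have h4 := mul_nonneg hτ.1 hQ.1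
  exact ⟨⟨by linarith [hx.1], by linarith [hx.2]⟩, ⟨by linarith [hy.1], by linarith [hy.2]⟩⟩

/-- The characteristics up to the boundary of the domain of convergence. -/
lemma flowDx_eq_and_flowDy_eq (h : Admissible c₀) (hτ : τ ∈ Ico (0 : ℝ) 1) (hx : x ∈ Icc 0 (1 - τ))
    (hy : y ∈ Icc 0 (1 - τ)) (hz : z ∈ Icc (0 : ℝ) 1) :
    flowDx c₀ 0 (x + τ * flowDy c₀ τ x y z) (y + τ * flowDx c₀ τ x y z) z = flowDx c₀ τ x y z ∧
    flowDy c₀ 0 (x + τ * flowDy c₀ τ x y z) (y + τ * flowDx c₀ τ x y z) z = flowDy c₀ τ x y z := by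
  have h1τ : 0 < 1 - τ := by linarith [hτ.2]
  have h0 : (0 : ℝ) ∈ Ico (0 : ℝ) 1 := ⟨le_rfl, one_pos⟩
  set B : Set (ℝ × ℝ × ℝ) := Icc 0 (1 - τ) ×ˢ Icc 0 (1 - τ) ×ˢ Icc 0 1 with hB
  have hcx := h.continuousOn_flowDx hτ
  have hcy := h.continuousOn_flowDy hτ
  have hfoot : ContinuousOn (fun v : ℝ × ℝ × ℝ =>
      ((v.1 + τ * flowDy c₀ τ v.1 v.2.1 v.2.2, v.2.1 + τ * flowDx c₀ τ v.1 v.2.1 v.2.2, v.2.2) :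
        ℝ × ℝ × ℝ)) B :=
    (continuousOn_fst.add (continuousOn_const.mul hcy)).prodMk
      ((continuous_snd.fst.continuousOn.add (continuousOn_const.mul hcx)).prodMk
        continuous_snd.snd.continuousOn)
  have hmaps : MapsTo (fun v : ℝ × ℝ × ℝ =>
      ((v.1 + τ * flowDy c₀ τ v.1 v.2.1 v.2.2, v.2.1 + τ * flowDx c₀ τ v.1 v.2.1 v.2.2, v.2.2) :
        ℝ × ℝ × ℝ)) B (Icc 0 (1 - 0) ×ˢ Icc 0 (1 - 0) ×ˢ Icc 0 1) := fun v hv => by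
    have := h.foot_mem hτ hv.1 hv.2.1 hv.2.2
    rw [sub_zero]
    exact ⟨this.1, this.2, hv.2.2⟩
  have hx0 := (h.continuousOn_flowDx h0).comp hfoot hmaps
  have hy0 := (h.continuousOn_flowDy h0).comp hfoot hmaps
  -- The identities hold on the half-open box, which is dense in the closed one, and both sides are
  -- continuous there.
  have hcl : closure (Ico 0 (1 - τ) ×ˢ Ico 0 (1 - τ) ×ˢ Ico 0 1 : Set (ℝ × ℝ × ℝ)) = B := by
    rw [closure_prod_eq, closure_prod_eq, closure_Ico h1τ.ne, closure_Ico (zero_ne_one' ℝ)]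
  have hBcl : (x, y, z) ∈ closure (Ico 0 (1 - τ) ×ˢ Ico 0 (1 - τ) ×ˢ Ico 0 1 : Set (ℝ × ℝ × ℝ)) := by
    rw [hcl]; exact ⟨hx, hy, hz⟩
  have hsub : (Ico 0 (1 - τ) ×ˢ Ico 0 (1 - τ) ×ˢ Ico 0 1 : Set (ℝ × ℝ × ℝ)) ⊆ B :=
    prod_mono Ico_subset_Icc_self (prod_mono Ico_subset_Icc_self Ico_subset_Icc_self)
  have e1 := EqOn.of_subset_closure (s := (Ico 0 (1 - τ) ×ˢ Ico 0 (1 - τ) ×ˢ Ico 0 1 : Set (ℝ × ℝ × ℝ)))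
    (fun v hv => by
      have := (h.characteristics hτ hv.1 hv.2.1 hv.2.2).1
      exact (flowDx_zero ..).trans this) hx0 hcx hsub hcl.ge
  have e2 := EqOn.of_subset_closure (s := (Ico 0 (1 - τ) ×ˢ Ico 0 (1 - τ) ×ˢ Ico 0 1 : Set (ℝ × ℝ × ℝ)))
    (fun v hv => by
      have := (h.characteristics hτ hv.1 hv.2.1 hv.2.2).2.1
      exact (flowDy_zero ..).trans this) hy0 hcy hsub hcl.ge
  have hmem : (x, y, z) ∈ B := ⟨hx, hy, hz⟩
  exact ⟨e1 hmem, e2 hmem⟩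

end Admissible

end SexedSmoluchowski

namespace SexedSmoluchowski

/-! ### The gradient of the initial generating function on the unit cube -/

lemma abs_pow_sub_pow_le_natCast_mul {x x' : ℝ} (hx : x ∈ Icc (0 : ℝ) 1) (hx' : x' ∈ Icc (0 : ℝ) 1)
    (n : ℕ) : |x ^ n - x' ^ n| ≤ n * |x - x'| := by
  refine (abs_pow_sub_pow_le x x' n).trans ?_
  have h1 : max |x| |x'| ^ (n - 1) ≤ 1 := by
    refine pow_le_one₀ (le_max_of_le_left (abs_nonneg _)) (max_le ?_ ?_)
    · rw [abs_of_nonneg hx.1]; exact hx.2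
    · rw [abs_of_nonneg hx'.1]; exact hx'.2
  calc _ ≤ |x - x'| * n * 1 := by gcongr
    _ = _ := by ring

lemma abs_mul_sub_mul_le {a b a' b' A B : ℝ} (hb : b ∈ Icc (0 : ℝ) 1) (ha' : a' ∈ Icc (0 : ℝ) 1)
    (hA : |a - a'| ≤ A) (hB : |b - b'| ≤ B) : |a * b - a' * b'| ≤ A + B := by
  calc |a * b - a' * b'| = |(a - a') * b + a' * (b - b')| := by congr 1; ring
    _ ≤ |(a - a') * b| + |a' * (b - b')| := abs_add_le _ _
    _ = |a - a'| * b + a' * |b - b'| := by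
      rw [abs_mul, abs_mul, abs_of_nonneg hb.1, abs_of_nonneg ha'.1]
    _ ≤ |a - a'| * 1 + 1 * |b - b'| := by gcongr; exacts [hb.2, ha'.2]
    _ ≤ A + B := by linarith

lemma pow_mem_Icc {x : ℝ} (hx : x ∈ Icc (0 : ℝ) 1) (n : ℕ) : x ^ n ∈ Icc (0 : ℝ) 1 :=
  ⟨pow_nonneg hx.1 _, pow_le_one₀ hx.1 hx.2⟩

variable {x y z x' y' : ℝ}

lemma abs_dX_sub_le (hx : x ∈ Icc (0 : ℝ) 1) (hx' : x' ∈ Icc (0 : ℝ) 1) (hy : y ∈ Icc (0 : ℝ) 1)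
    (hy' : y' ∈ Icc (0 : ℝ) 1) (hz : z ∈ Icc (0 : ℝ) 1) (p : S) :
    |dX x y z p - dX x' y' z p| ≤ dXX 1 1 1 p * |x - x'| + dXY 1 1 1 p * |y - y'| := by
  have h1 := abs_mul_sub_mul_le (pow_mem_Icc hy p.2.1) (pow_mem_Icc hx' (p.1 - 1))
    (abs_pow_sub_pow_le_natCast_mul hx hx' (p.1 - 1))
    (abs_pow_sub_pow_le_natCast_mul hy hy' p.2.1)
  have h2 := male_nonneg p
  have h3 := pow_mem_Icc hz (p.2.2 : ℕ)
  have h4 : 0 ≤ ((p.1 - 1 : ℕ) : ℝ) * |x - x'| + p.2.1 * |y - y'| := by positivity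
  calc _ = male p * |x ^ (p.1 - 1) * y ^ p.2.1 - x' ^ (p.1 - 1) * y' ^ p.2.1| *
        z ^ (p.2.2 : ℕ) := by
        have : dX x y z p - dX x' y' z p =
            male p * (x ^ (p.1 - 1) * y ^ p.2.1 - x' ^ (p.1 - 1) * y' ^ p.2.1) * z ^ (p.2.2 : ℕ) := by
          simp only [dX]; ring
        rw [this, abs_mul, abs_mul, abs_of_nonneg h2, abs_of_nonneg h3.1]
    _ ≤ male p * (((p.1 - 1 : ℕ) : ℝ) * |x - x'| + p.2.1 * |y - y'|) * 1 := by
        gcongr; exacts [h3.1, h3.2]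
    _ = _ := by
        have := natCast_mul_cast_pred p.1
        simp only [dXX, dXY, one_pow, male, female]
        linear_combination |x - x'| * this

lemma abs_dY_sub_le (hx : x ∈ Icc (0 : ℝ) 1) (hx' : x' ∈ Icc (0 : ℝ) 1) (hy : y ∈ Icc (0 : ℝ) 1)
    (hy' : y' ∈ Icc (0 : ℝ) 1) (hz : z ∈ Icc (0 : ℝ) 1) (p : S) :
    |dY x y z p - dY x' y' z p| ≤ dXY 1 1 1 p * |x - x'| + dYY 1 1 1 p * |y - y'| := by
  have h1 := abs_mul_sub_mul_le (pow_mem_Icc hy (p.2.1 - 1)) (pow_mem_Icc hx' p.1)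
    (abs_pow_sub_pow_le_natCast_mul hx hx' p.1)
    (abs_pow_sub_pow_le_natCast_mul hy hy' (p.2.1 - 1))
  have h2 := female_nonneg p
  have h3 := pow_mem_Icc hz (p.2.2 : ℕ)
  have h4 : 0 ≤ (p.1 : ℝ) * |x - x'| + ((p.2.1 - 1 : ℕ) : ℝ) * |y - y'| := by positivity
  calc _ = female p * |x ^ p.1 * y ^ (p.2.1 - 1) - x' ^ p.1 * y' ^ (p.2.1 - 1)| *
        z ^ (p.2.2 : ℕ) := by
        have : dY x y z p - dY x' y' z p =
            female p * (x ^ p.1 * y ^ (p.2.1 - 1) - x' ^ p.1 * y' ^ (p.2.1 - 1)) * z ^ (p.2.2 : ℕ) := by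
          simp only [dY]; ring
        rw [this, abs_mul, abs_mul, abs_of_nonneg h2, abs_of_nonneg h3.1]
    _ ≤ female p * ((p.1 : ℝ) * |x - x'| + ((p.2.1 - 1 : ℕ) : ℝ) * |y - y'|) * 1 := by
        gcongr; exacts [h3.1, h3.2]
    _ = _ := by
        have := natCast_mul_cast_pred p.2.1
        simp only [dYY, dXY, one_pow, male, female]
        linear_combination |y - y'| * this

/-- `⟨a² - a, c₀⟩`. -/
def momXX (c₀ : S → ℝ) : ℝ := ∑' p, c₀ p * dXX 1 1 1 p

/-- `⟨ab, c₀⟩`. -/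
def momXY (c₀ : S → ℝ) : ℝ := ∑' p, c₀ p * dXY 1 1 1 p

/-- `⟨b² - b, c₀⟩`. -/
def momYY (c₀ : S → ℝ) : ℝ := ∑' p, c₀ p * dYY 1 1 1 p

/-- In this form `M` is the largest eigenvalue of the matrix with rows `(momXY, momYY)` and `(momXX,
momXY)`, the derivative at `(1, 1, 1)` of `(x, y) ↦ (∂g₀/∂y, ∂g₀/∂x)`. -/
lemma bigM_eq (c₀ : S → ℝ) : bigM c₀ = momXY c₀ + √(momXX c₀ * momYY c₀) := by
  have h1 : ∀ p, male p ^ 2 - male p = dXX 1 1 1 p := fun p => by simp only [dXX, one_pow]; ring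
  have h2 : ∀ p, female p ^ 2 - female p = dYY 1 1 1 p := fun p => by
    simp only [dYY, one_pow]; ring
  have h3 : ∀ p, male p * female p = dXY 1 1 1 p := fun p => by simp only [dXY, one_pow]; ring
  simp only [bigM, bracket, h1, h2, h3, momXX, momXY, momYY]

lemma second_le (p : S) : dXX 1 1 1 p ≤ male p ^ 2 + female p ^ 2 ∧
    dXY 1 1 1 p ≤ male p ^ 2 + female p ^ 2 ∧ dYY 1 1 1 p ≤ male p ^ 2 + female p ^ 2 := by
  have h1 := male_nonneg p
  have h2 := female_nonneg p
  simp only [dXX, dXY, dYY, one_pow, mul_one]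
  refine ⟨?_, ?_, ?_⟩ <;> nlinarith [sq_nonneg (male p - female p)]

namespace Admissible

variable {c₀ : S → ℝ} {τ ξ η ξ' η' : ℝ}

lemma summable_dXX (h : Admissible c₀) : Summable fun p => c₀ p * dXX 1 1 1 p :=
  h.second.of_nonneg_of_le
    (fun p => mul_nonneg (h.nonneg p) (dXX_nonneg one_pos.le one_pos.le one_pos.le p))
    fun p => mul_le_mul_of_nonneg_left (second_le p).1 (h.nonneg p)

lemma summable_dXY (h : Admissible c₀) : Summable fun p => c₀ p * dXY 1 1 1 p :=
  h.second.of_nonneg_of_le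
    (fun p => mul_nonneg (h.nonneg p) (dXY_nonneg one_pos.le one_pos.le one_pos.le p))
    fun p => mul_le_mul_of_nonneg_left (second_le p).2.1 (h.nonneg p)

lemma summable_dYY (h : Admissible c₀) : Summable fun p => c₀ p * dYY 1 1 1 p :=
  h.second.of_nonneg_of_le
    (fun p => mul_nonneg (h.nonneg p) (dYY_nonneg one_pos.le one_pos.le one_pos.le p))
    fun p => mul_le_mul_of_nonneg_left (second_le p).2.2 (h.nonneg p)

lemma momXX_nonneg (h : Admissible c₀) : 0 ≤ momXX c₀ :=
  tsum_nonneg fun p => mul_nonneg (h.nonneg p) (dXX_nonneg one_pos.le one_pos.le one_pos.le p)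

lemma momXY_nonneg (h : Admissible c₀) : 0 ≤ momXY c₀ :=
  tsum_nonneg fun p => mul_nonneg (h.nonneg p) (dXY_nonneg one_pos.le one_pos.le one_pos.le p)

lemma momYY_nonneg (h : Admissible c₀) : 0 ≤ momYY c₀ :=
  tsum_nonneg fun p => mul_nonneg (h.nonneg p) (dYY_nonneg one_pos.le one_pos.le one_pos.le p)

lemma summable_dX (h : Admissible c₀) (hx : x ∈ Icc (0 : ℝ) 1) (hy : y ∈ Icc (0 : ℝ) 1)
    (hz : z ∈ Icc (0 : ℝ) 1) : Summable fun p => c₀ p * dX x y z p := by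
  have := h.summable_flow_dX (τ := 0) (x := x) (y := y) ⟨le_rfl, one_pos⟩ (by rwa [sub_zero]) (by rwa [sub_zero]) hz
  simpa using this

lemma summable_dY (h : Admissible c₀) (hx : x ∈ Icc (0 : ℝ) 1) (hy : y ∈ Icc (0 : ℝ) 1)
    (hz : z ∈ Icc (0 : ℝ) 1) : Summable fun p => c₀ p * dY x y z p := by
  have := h.summable_flow_dY (τ := 0) (x := x) (y := y) ⟨le_rfl, one_pos⟩ (by rwa [sub_zero]) (by rwa [sub_zero]) hz
  simpa using this

lemma abs_tsum_dX_sub_le (h : Admissible c₀) (hx : x ∈ Icc (0 : ℝ) 1) (hx' : x' ∈ Icc (0 : ℝ) 1)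
    (hy : y ∈ Icc (0 : ℝ) 1) (hy' : y' ∈ Icc (0 : ℝ) 1) (hz : z ∈ Icc (0 : ℝ) 1) :
    |∑' p, c₀ p * dX x y z p - ∑' p, c₀ p * dX x' y' z p| ≤
      momXX c₀ * |x - x'| + momXY c₀ * |y - y'| := by
  rw [← (h.summable_dX hx hy hz).tsum_sub (h.summable_dX hx' hy' hz)]
  have hs := (h.summable_dXX.hasSum.mul_right |x - x'|).add
    (h.summable_dXY.hasSum.mul_right |y - y'|)
  rw [← Real.norm_eq_abs]
  refine tsum_of_norm_bounded hs fun p => ?_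
  rw [← mul_sub, Real.norm_eq_abs, abs_mul, abs_of_nonneg (h.nonneg p)]
  calc _ ≤ c₀ p * (dXX 1 1 1 p * |x - x'| + dXY 1 1 1 p * |y - y'|) :=
        mul_le_mul_of_nonneg_left (abs_dX_sub_le hx hx' hy hy' hz p) (h.nonneg p)
    _ = _ := by ring

lemma abs_tsum_dY_sub_le (h : Admissible c₀) (hx : x ∈ Icc (0 : ℝ) 1) (hx' : x' ∈ Icc (0 : ℝ) 1)
    (hy : y ∈ Icc (0 : ℝ) 1) (hy' : y' ∈ Icc (0 : ℝ) 1) (hz : z ∈ Icc (0 : ℝ) 1) :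
    |∑' p, c₀ p * dY x y z p - ∑' p, c₀ p * dY x' y' z p| ≤
      momXY c₀ * |x - x'| + momYY c₀ * |y - y'| := by
  rw [← (h.summable_dY hx hy hz).tsum_sub (h.summable_dY hx' hy' hz)]
  have hs := (h.summable_dXY.hasSum.mul_right |x - x'|).add
    (h.summable_dYY.hasSum.mul_right |y - y'|)
  rw [← Real.norm_eq_abs]
  refine tsum_of_norm_bounded hs fun p => ?_
  rw [← mul_sub, Real.norm_eq_abs, abs_mul, abs_of_nonneg (h.nonneg p)]
  calc _ ≤ c₀ p * (dXY 1 1 1 p * |x - x'| + dYY 1 1 1 p * |y - y'|) :=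
        mul_le_mul_of_nonneg_left (abs_dY_sub_le hx hx' hy hy' hz p) (h.nonneg p)
    _ = _ := by ring

end Admissible

/-! ### The critical time and conservation of arms -/

/-- The determinant of `1 - τ D`, where `D` is the derivative at `(1, 1, 1)` of the gradient. -/
def jacobian (c₀ : S → ℝ) (τ : ℝ) : ℝ := (1 - τ * momXY c₀) ^ 2 - τ ^ 2 * (momXX c₀ * momYY c₀)

/-- The times, in the variable `τ = t / (1 + t)`, before the critical time. -/
structure Subcritical (c₀ : S → ℝ) (τ : ℝ) : Prop where
  mem : τ ∈ Ico (0 : ℝ) 1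
  mul_momXY_lt : τ * momXY c₀ < 1
  jacobian_pos : 0 < jacobian c₀ τ

namespace Admissible

variable {c₀ : S → ℝ} {τ ξ η ξ' η' : ℝ}

lemma subcritical (h : Admissible c₀) (hτ : τ ∈ Ico (0 : ℝ) 1) (hM : τ * bigM c₀ < 1) :
    Subcritical c₀ τ := by
  have h0 := mul_nonneg h.momXX_nonneg h.momYY_nonneg
  have h1 := Real.sqrt_nonneg (momXX c₀ * momYY c₀)
  have h2 := Real.sq_sqrt h0
  rw [bigM_eq] at hM
  have h3 := mul_nonneg hτ.1 h1
  have h4 : τ * √(momXX c₀ * momYY c₀) < 1 - τ * momXY c₀ := by linarith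
  refine ⟨hτ, by linarith, ?_⟩
  have h5 := pow_lt_pow_left₀ h4 h3 two_ne_zero
  rw [mul_pow, h2] at h5
  exact sub_pos.2 h5

/-- The equation of the characteristics has stable solutions before the critical time. -/
lemma fixed_point_lipschitz (h : Admissible c₀) (hτ : Subcritical c₀ τ) (hx : x ∈ Icc (0 : ℝ) 1)
    (hx' : x' ∈ Icc (0 : ℝ) 1) (hy : y ∈ Icc (0 : ℝ) 1) (hy' : y' ∈ Icc (0 : ℝ) 1)
    (hz : z ∈ Icc (0 : ℝ) 1)
    (e1 : x = ξ + τ * ∑' p, c₀ p * dY x y z p) (e2 : y = η + τ * ∑' p, c₀ p * dX x y z p)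
    (e1' : x' = ξ' + τ * ∑' p, c₀ p * dY x' y' z p)
    (e2' : y' = η' + τ * ∑' p, c₀ p * dX x' y' z p) :
    jacobian c₀ τ * |x - x'| ≤
      (1 - τ * momXY c₀) * |ξ - ξ'| + τ * momYY c₀ * |η - η'| ∧
    jacobian c₀ τ * |y - y'| ≤
      (1 - τ * momXY c₀) * |η - η'| + τ * momXX c₀ * |ξ - ξ'| := by
  have hτ0 := hτ.mem.1
  have hY := h.abs_tsum_dY_sub_le hx hx' hy hy' hz
  have hX := h.abs_tsum_dX_sub_le hx hx' hy hy' hz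
  set a := |x - x'|
  set b := |y - y'|
  have ha : a ≤ |ξ - ξ'| + τ * (momXY c₀ * a + momYY c₀ * b) := by
    calc a = |(ξ - ξ') + τ * (∑' p, c₀ p * dY x y z p - ∑' p, c₀ p * dY x' y' z p)| := by
          rw [show a = |x - x'| from rfl]; congr 1; linear_combination e1 - e1'
      _ ≤ |ξ - ξ'| + |τ * (∑' p, c₀ p * dY x y z p - ∑' p, c₀ p * dY x' y' z p)| :=
          abs_add_le _ _
      _ ≤ _ := by rw [abs_mul, abs_of_nonneg hτ0]; gcongr
  have hb : b ≤ |η - η'| + τ * (momXX c₀ * a + momXY c₀ * b) := by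
    calc b = |(η - η') + τ * (∑' p, c₀ p * dX x y z p - ∑' p, c₀ p * dX x' y' z p)| := by
          rw [show b = |y - y'| from rfl]; congr 1; linear_combination e2 - e2'
      _ ≤ |η - η'| + |τ * (∑' p, c₀ p * dX x y z p - ∑' p, c₀ p * dX x' y' z p)| :=
          abs_add_le _ _
      _ ≤ _ := by rw [abs_mul, abs_of_nonneg hτ0]; gcongr
  have h1 : 0 < 1 - τ * momXY c₀ := sub_pos.2 hτ.mul_momXY_lt
  have h2 := mul_nonneg hτ0 h.momYY_nonneg
  have h3 := mul_nonneg hτ0 h.momXX_nonneg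
  have ha' : (1 - τ * momXY c₀) * a ≤ |ξ - ξ'| + τ * momYY c₀ * b := by linarith
  have hb' : (1 - τ * momXY c₀) * b ≤ |η - η'| + τ * momXX c₀ * a := by linarith
  -- Cramer's rule for inequalities: the multipliers are the entries of the adjugate of `1 - τ D`,
  -- all nonnegative before the critical time.
  have k1 := mul_le_mul_of_nonneg_left ha' h1.le
  have k2 := mul_le_mul_of_nonneg_left hb' h1.le
  have k3 := mul_le_mul_of_nonneg_left hb' h2
  have k4 := mul_le_mul_of_nonneg_left ha' h3
  unfold jacobian
  constructor <;> linarith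

lemma fixed_point_unique (h : Admissible c₀) (hτ : Subcritical c₀ τ) (hx : x ∈ Icc (0 : ℝ) 1)
    (hx' : x' ∈ Icc (0 : ℝ) 1) (hy : y ∈ Icc (0 : ℝ) 1) (hy' : y' ∈ Icc (0 : ℝ) 1)
    (hz : z ∈ Icc (0 : ℝ) 1)
    (e1 : x = ξ + τ * ∑' p, c₀ p * dY x y z p) (e2 : y = η + τ * ∑' p, c₀ p * dX x y z p)
    (e1' : x' = ξ + τ * ∑' p, c₀ p * dY x' y' z p)
    (e2' : y' = η + τ * ∑' p, c₀ p * dX x' y' z p) : x = x' ∧ y = y' := by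
  obtain ⟨h1, h2⟩ := h.fixed_point_lipschitz hτ hx hx' hy hy' hz e1 e2 e1' e2'
  simp only [sub_self, abs_zero, mul_zero, add_zero] at h1 h2
  have hj := hτ.jacobian_pos
  constructor
  · refine sub_eq_zero.1 (abs_eq_zero.1 (le_antisymm ?_ (abs_nonneg _)))
    exact nonpos_of_mul_nonpos_right h1 hj
  · refine sub_eq_zero.1 (abs_eq_zero.1 (le_antisymm ?_ (abs_nonneg _)))
    exact nonpos_of_mul_nonpos_right h2 hj

lemma tsum_dX_one (h : Admissible c₀) : ∑' p, c₀ p * dX 1 1 1 p = 1 := by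
  simpa only [dX, one_pow, mul_one] using h.male.tsum_eq

lemma tsum_dY_one (h : Admissible c₀) : ∑' p, c₀ p * dY 1 1 1 p = 1 := by
  simpa only [dY, one_pow, mul_one] using h.female.tsum_eq

/-- No arm is lost before the critical time. -/
lemma flowD_corner (h : Admissible c₀) (hτ : Subcritical c₀ τ) :
    flowDx c₀ τ (1 - τ) (1 - τ) 1 = 1 ∧ flowDy c₀ τ (1 - τ) (1 - τ) 1 = 1 := by
  have hm := one_sub_mem hτ.mem
  obtain ⟨h1, h2⟩ := h.flowDx_eq_and_flowDy_eq hτ.mem hm hm one_mem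
  obtain ⟨hX, hY⟩ := h.foot_mem hτ.mem hm hm one_mem
  rw [flowDx_zero] at h1
  rw [flowDy_zero] at h2
  -- As both first moments of `c₀` are `1`, the point `(1, 1)` solves the equation with end point
  -- `(1 - τ, 1 - τ)`. By uniqueness it is the foot of the characteristic.
  obtain ⟨k1, k2⟩ := h.fixed_point_unique hτ hX one_mem hY one_mem one_mem (ξ := 1 - τ)
    (η := 1 - τ) (by rw [h2]) (by rw [h1]) (by rw [h.tsum_dY_one]; ring)
    (by rw [h.tsum_dX_one]; ring)
  rw [k1, k2] at h1 h2
  exact ⟨h1.symm.trans h.tsum_dX_one, h2.symm.trans h.tsum_dY_one⟩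

end Admissible

end SexedSmoluchowski

namespace SexedSmoluchowski

variable {c₀ : S → ℝ} {τ t x y z : ℝ}

/-! ### Partial derivatives of generating functions -/

lemma exists_natCast_mul_pow_pred_le {κ : ℝ} (hκ : κ ∈ Ioo (0 : ℝ) 1) :
    ∃ C, ∀ n : ℕ, (n : ℝ) * κ ^ (n - 1) ≤ C := by
  obtain ⟨C, hC⟩ := (tendsto_self_mul_const_pow_of_lt_one hκ.1.le hκ.2).bddAbove_range
  have h0 := hκ.1
  refine ⟨C / κ, fun n => ?_⟩
  have h1 : (n : ℝ) * κ ^ n ≤ C := hC ⟨n, rfl⟩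
  rw [le_div_iff₀ h0]
  rcases n with _ | n
  · simpa using h1
  · rwa [Nat.add_sub_cancel, mul_assoc, ← pow_succ]

/-- A power series in `z` with summable coefficients has a one-sided derivative on `[0, 1)`. -/
lemma hasDerivWithinAt_tsum_monomial_mass {U : S → ℝ} {x y : ℝ}
    (hU : Summable fun p => U p * monomial x y 1 p) (hz : z ∈ Ico (0 : ℝ) 1) :
    HasDerivWithinAt (fun r => ∑' p, U p * monomial x y r p) (∑' p, U p * dZ x y z p)
      (Icc 0 1) z := by
  -- The derivatives are dominated only away from `z = 1`: at `z = 1` their sum is a total mass,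
  -- which may be infinite.
  obtain ⟨κ, hκz, hκ1⟩ := exists_between hz.2
  have hκ : κ ∈ Ioo (0 : ℝ) 1 := ⟨hz.1.trans_lt hκz, hκ1⟩
  obtain ⟨C, hC⟩ := exists_natCast_mul_pow_pred_le hκ
  have hm : ∀ (r : ℝ) (p : S), monomial x y r p = monomial x y 1 p * r ^ (p.2.2 : ℕ) := fun r p => by
    simp only [monomial, one_pow, mul_one]
  have h1 := hasDerivWithinAt_tsum (convex_Icc 0 κ) (f := fun p r => U p * monomial x y r p)
    (f' := fun p r => U p * dZ x y r p) (u := fun p => |U p * monomial x y 1 p| * C)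
    (hU.norm.mul_right C)
    (fun p r _ => (hasDerivWithinAt_monomial_mass x y _ r p).const_mul (U p))
    (fun p r hr => by
      have h2 : U p * dZ x y r p = U p * monomial x y 1 p * (mass p * r ^ ((p.2.2 : ℕ) - 1)) := by
        simp only [dZ, monomial, one_pow]; ring
      have h3 := mass_nonneg p
      have h4 := hr.1
      rw [h2, abs_mul, abs_of_nonneg (a := mass p * r ^ ((p.2.2 : ℕ) - 1)) (by positivity)]
      gcongr
      refine le_trans ?_ (hC p.2.2)
      simp only [mass]
      gcongr
      exact hr.2)
    (x₀ := 0) (left_mem_Icc.2 hκ.1.le) (by simp [monomial]) (x := z) ⟨hz.1, hκz.le⟩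
  refine h1.mono_of_mem_nhdsWithin ?_
  refine mem_of_superset (inter_mem_nhdsWithin _ (Iio_mem_nhds hκz)) ?_
  exact fun r hr => ⟨hr.1.1, le_of_lt hr.2⟩

lemma uniqueDiffWithinAt_unit (hx : x ∈ Icc (0 : ℝ) 1) : UniqueDiffWithinAt ℝ (Icc (0 : ℝ) 1) x :=
  uniqueDiffOn_Icc one_pos x hx

lemma abs_monomial_le_one (hx : x ∈ Icc (0 : ℝ) 1) (hy : y ∈ Icc (0 : ℝ) 1)
    (hz : z ∈ Icc (0 : ℝ) 1) (p : S) : |monomial x y z p| ≤ 1 := by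
  rw [abs_of_nonneg (monomial_nonneg hx.1 hy.1 hz.1 p)]
  simpa [monomial] using monomial_mono hx.1 hy.1 hz.1 hx.2 hy.2 hz.2 p

namespace Admissible

lemma summable_monomial (h : Admissible c₀) (hx : x ∈ Icc (0 : ℝ) 1) (hy : y ∈ Icc (0 : ℝ) 1)
    (hz : z ∈ Icc (0 : ℝ) 1) : Summable fun p => c₀ p * monomial x y z p :=
  h.summable.of_nonneg_of_le
    (fun p => mul_nonneg (h.nonneg p) (monomial_nonneg hx.1 hy.1 hz.1 p))
    fun p => mul_le_of_le_one_right (h.nonneg p)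
      ((le_abs_self _).trans (abs_monomial_le_one hx hy hz p))

lemma genFunDx_eq (h : Admissible c₀) (hx : x ∈ Icc (0 : ℝ) 1) (hy : y ∈ Icc (0 : ℝ) 1)
    (hz : z ∈ Icc (0 : ℝ) 1) : genFunDx c₀ x y z = ∑' p, c₀ p * dX x y z p := by
  refine HasDerivWithinAt.derivWithin ?_ (uniqueDiffWithinAt_unit hx)
  refine hasDerivWithinAt_tsum (convex_Icc 0 1) (f := fun p r => c₀ p * monomial r y z p)
    (f' := fun p r => c₀ p * dX r y z p) h.male.summable (fun p r _ => ?_) (fun p r hr => ?_) hx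
    (h.summable_monomial hx hy hz) hx
  · refine ((hasDerivWithinAt_monomial (hasDerivWithinAt_id r _)
      (hasDerivWithinAt_const r _ y) z p).const_mul (c₀ p)).congr_deriv ?_
    simp
  · rw [abs_of_nonneg (mul_nonneg (h.nonneg p) (dX_nonneg hr.1 hy.1 hz.1 p))]
    refine mul_le_mul_of_nonneg_left ?_ (h.nonneg p)
    simpa [dX] using dX_mono hr.1 hy.1 hz.1 hr.2 hy.2 hz.2 p

lemma genFunDy_eq (h : Admissible c₀) (hx : x ∈ Icc (0 : ℝ) 1) (hy : y ∈ Icc (0 : ℝ) 1)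
    (hz : z ∈ Icc (0 : ℝ) 1) : genFunDy c₀ x y z = ∑' p, c₀ p * dY x y z p := by
  refine HasDerivWithinAt.derivWithin ?_ (uniqueDiffWithinAt_unit hy)
  refine hasDerivWithinAt_tsum (convex_Icc 0 1) (f := fun p r => c₀ p * monomial x r z p)
    (f' := fun p r => c₀ p * dY x r z p) h.female.summable (fun p r _ => ?_) (fun p r hr => ?_) hy
    (h.summable_monomial hx hy hz) hy
  · refine ((hasDerivWithinAt_monomial (hasDerivWithinAt_const r _ x)
      (hasDerivWithinAt_id r _) z p).const_mul (c₀ p)).congr_deriv ?_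
    simp
  · rw [abs_of_nonneg (mul_nonneg (h.nonneg p) (dY_nonneg hx.1 hr.1 hz.1 p))]
    refine mul_le_mul_of_nonneg_left ?_ (h.nonneg p)
    simpa [dY] using dY_mono hx.1 hr.1 hz.1 hx.2 hr.2 hz.2 p

lemma genFunDz_eq (h : Admissible c₀) (hx : x ∈ Icc (0 : ℝ) 1) (hy : y ∈ Icc (0 : ℝ) 1)
    (hz : z ∈ Ico (0 : ℝ) 1) : genFunDz c₀ x y z = ∑' p, c₀ p * dZ x y z p :=
  (hasDerivWithinAt_tsum_monomial_mass (h.summable_monomial hx hy one_mem) hz).derivWithin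
    (uniqueDiffWithinAt_unit ⟨hz.1, hz.2.le⟩)

end Admissible

/-! ### The change of time -/

/-- The time scale of the system without loss term. -/
def tau (t : ℝ) : ℝ := t / (1 + t)

lemma one_sub_tau (ht : 0 ≤ t) : 1 - tau t = 1 / (1 + t) := by
  unfold tau; field_simp; ring

lemma tau_mem (ht : 0 ≤ t) : tau t ∈ Ico (0 : ℝ) 1 := by
  refine ⟨by unfold tau; positivity, ?_⟩
  have h1 := one_sub_tau ht
  have h2 : 0 < 1 / (1 + t) := by positivity
  linarith

/-- In the variable `τ = t / (1 + t) < 1` the two cases in the definition of `T_c` merge into the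
single condition `τ M < 1`. -/
lemma lt_critTime_iff (c₀ : S → ℝ) (ht : 0 ≤ t) :
    (t : EReal) < critTime c₀ ↔ tau t * bigM c₀ < 1 := by
  have h1 : (0 : ℝ) < 1 + t := by linarith
  unfold critTime
  rw [tau, div_mul_eq_mul_div, div_lt_one h1]
  split_ifs with hM
  · refine ⟨fun _ => ?_, fun _ => EReal.coe_lt_top t⟩
    nlinarith
  · rw [EReal.coe_lt_coe_iff, lt_div_iff₀ (by linarith)]
    constructor <;> intro _ <;> linarith

lemma mem_timeInterval_iff {t : ℝ} :
    t ∈ timeInterval (critTime c₀) ↔ 0 ≤ t ∧ tau t * bigM c₀ < 1 :=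
  and_congr_right fun ht => lt_critTime_iff c₀ ht

lemma Admissible.subcritical_tau (h : Admissible c₀) (ht : t ∈ timeInterval (critTime c₀)) :
    Subcritical c₀ (tau t) :=
  h.subcritical (tau_mem ht.1) (mem_timeInterval_iff.1 ht).2

/-! ### The right inverse of `φ` -/

/-- The feet of the characteristics, as a function of the rescaled end points. -/
def foot (c₀ : S → ℝ) (τ z : ℝ) (q : ℝ × ℝ) : ℝ × ℝ :=
  ((1 - τ) * q.1 + τ * flowDy c₀ τ ((1 - τ) * q.1) ((1 - τ) * q.2) z,
    (1 - τ) * q.2 + τ * flowDx c₀ τ ((1 - τ) * q.1) ((1 - τ) * q.2) z)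

lemma mul_mem_Icc (hτ : τ ∈ Ico (0 : ℝ) 1) (hx : x ∈ Icc (0 : ℝ) 1) :
    (1 - τ) * x ∈ Icc 0 (1 - τ) := by
  have : 0 ≤ 1 - τ := by linarith [hτ.2]
  exact ⟨mul_nonneg this hx.1, mul_le_of_le_one_right this hx.2⟩

lemma mul_mem_Ico (hτ : τ ∈ Ico (0 : ℝ) 1) (hx : x ∈ Ico (0 : ℝ) 1) :
    (1 - τ) * x ∈ Ico 0 (1 - τ) := by
  have : 0 < 1 - τ := by linarith [hτ.2]
  exact ⟨mul_nonneg this.le hx.1, mul_lt_of_lt_one_right this hx.2⟩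

namespace Admissible

/-- Division by `1 + t` turns the equation for a preimage under `φ_t` into the equation for the foot
of a characteristic that ends at `(1 - τ) q`. -/
lemma phi_eq_iff (h : Admissible c₀) (ht : 0 ≤ t) (hz : z ∈ Icc (0 : ℝ) 1) {q r : ℝ × ℝ}
    (hr : r ∈ square) : phi c₀ t z r = q ↔
      r.1 = (1 - tau t) * q.1 + tau t * ∑' p, c₀ p * dY r.1 r.2 z p ∧
      r.2 = (1 - tau t) * q.2 + tau t * ∑' p, c₀ p * dX r.1 r.2 z p := by
  have h1 : 1 + t ≠ 0 := by positivity
  rw [phi, h.genFunDx_eq hr.1 hr.2 hz, h.genFunDy_eq hr.1 hr.2 hz, Prod.ext_iff, one_sub_tau ht, tau]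
  refine and_congr ?_ ?_ <;> field_simp <;> constructor <;> intro h' <;> linarith

lemma foot_mem_square (h : Admissible c₀) (hτ : τ ∈ Ico (0 : ℝ) 1) (hz : z ∈ Icc (0 : ℝ) 1)
    {q : ℝ × ℝ} (hq : q ∈ square) : foot c₀ τ z q ∈ square :=
  h.foot_mem hτ (mul_mem_Icc hτ hq.1) (mul_mem_Icc hτ hq.2) hz

lemma foot_eq (h : Admissible c₀) (hτ : τ ∈ Ico (0 : ℝ) 1) (hz : z ∈ Icc (0 : ℝ) 1)
    {q : ℝ × ℝ} (hq : q ∈ square) :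
    (foot c₀ τ z q).1 = (1 - τ) * q.1 +
      τ * ∑' p, c₀ p * dY (foot c₀ τ z q).1 (foot c₀ τ z q).2 z p ∧
    (foot c₀ τ z q).2 = (1 - τ) * q.2 +
      τ * ∑' p, c₀ p * dX (foot c₀ τ z q).1 (foot c₀ τ z q).2 z p := by
  obtain ⟨h1, h2⟩ := h.flowDx_eq_and_flowDy_eq hτ (mul_mem_Icc hτ hq.1) (mul_mem_Icc hτ hq.2) hz
  rw [flowDx_zero] at h1
  rw [flowDy_zero] at h2
  constructor
  · conv_rhs => rw [foot]
    rw [h2, foot]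
  · conv_rhs => rw [foot]
    rw [h1, foot]

lemma isRightInverse_foot (h : Admissible c₀) (ht : 0 ≤ t) (hz : z ∈ Icc (0 : ℝ) 1) :
    IsRightInverse c₀ t z (foot c₀ (tau t) z) :=
  ⟨fun _ hq => h.foot_mem_square (tau_mem ht) hz hq, fun _ hq =>
    (h.phi_eq_iff ht hz (h.foot_mem_square (tau_mem ht) hz hq)).2 (h.foot_eq (tau_mem ht) hz hq)⟩

lemma eqOn_foot (h : Admissible c₀) (ht : t ∈ timeInterval (critTime c₀))
    (hz : z ∈ Icc (0 : ℝ) 1) {h' : ℝ × ℝ → ℝ × ℝ} (hh : IsRightInverse c₀ t z h') :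
    EqOn h' (foot c₀ (tau t) z) square := by
  intro q hq
  have h1 := hh.1 hq
  have h2 := h.foot_mem_square (tau_mem ht.1) hz hq
  obtain ⟨e1, e2⟩ := (h.phi_eq_iff ht.1 hz h1).1 (hh.2 q hq)
  obtain ⟨e3, e4⟩ := h.foot_eq (tau_mem ht.1) hz hq
  have := h.fixed_point_unique (h.subcritical_tau ht) h1.1 h2.1 h1.2 h2.2 hz e1 e2 e3 e4
  exact Prod.ext this.1 this.2

lemma continuousOn_foot (h : Admissible c₀) (hτ : τ ∈ Ico (0 : ℝ) 1) :
    ContinuousOn (fun v : ℝ × ℝ × ℝ => foot c₀ τ v.2.2 (v.1, v.2.1))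
      (Icc 0 1 ×ˢ Icc 0 1 ×ˢ Icc 0 1) := by
  have hs : ContinuousOn (fun v : ℝ × ℝ × ℝ => (((1 - τ) * v.1, (1 - τ) * v.2.1, v.2.2) : ℝ × ℝ × ℝ))
      (Icc 0 1 ×ˢ Icc 0 1 ×ˢ Icc 0 1) := by fun_prop
  have hm : MapsTo (fun v : ℝ × ℝ × ℝ => (((1 - τ) * v.1, (1 - τ) * v.2.1, v.2.2) : ℝ × ℝ × ℝ))
      (Icc 0 1 ×ˢ Icc 0 1 ×ˢ Icc 0 1) (Icc 0 (1 - τ) ×ˢ Icc 0 (1 - τ) ×ˢ Icc 0 1) := fun v hv =>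
    ⟨mul_mem_Icc hτ hv.1, mul_mem_Icc hτ hv.2.1, hv.2.2⟩
  have h1 := (h.continuousOn_flowDx hτ).comp hs hm
  have h2 := (h.continuousOn_flowDy hτ).comp hs hm
  exact ((continuousOn_const.mul continuousOn_fst).add (continuousOn_const.mul h2)).prodMk
    ((continuousOn_const.mul continuous_snd.fst.continuousOn).add (continuousOn_const.mul h1))

lemma continuousOn_foot_square (h : Admissible c₀) (hτ : τ ∈ Ico (0 : ℝ) 1)
    (hz : z ∈ Icc (0 : ℝ) 1) : ContinuousOn (foot c₀ τ z) square :=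
  (h.continuousOn_foot hτ).comp (f := fun q : ℝ × ℝ => (q.1, q.2, z)) (by fun_prop)
    fun _ hq => ⟨hq.1, hq.2, hz⟩

lemma analyticOnNhd_flowDx (h : Admissible c₀) (hτ : τ ∈ Ico (0 : ℝ) 1) (hz : z ∈ Icc (0 : ℝ) 1) :
    AnalyticOnNhd ℝ (fun q : ℝ × ℝ => flowDx c₀ τ ((1 - τ) * q.1) ((1 - τ) * q.2) z)
      (Ioo 0 1 ×ˢ Ioo 0 1) := by
  have hs := h.summable_flow_dX hτ (one_sub_mem hτ) (one_sub_mem hτ) hz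
  -- Terms without male arms vanish. Shifting `a` by one absorbs the exponent lowered by the
  -- derivative, and leaves a genuine power series.
  set e : S → S := fun p => (p.1 + 1, p.2)
  have he : Function.Injective e := fun p q hpq => by
    simp only [e, Prod.mk.injEq, Nat.add_right_cancel_iff] at hpq
    exact Prod.ext hpq.1 hpq.2
  have hse : Summable fun p => flow c₀ τ (e p) * dX (1 - τ) (1 - τ) z (e p) := hs.comp_injective he
  convert analyticOnNhd_tsum hse using 1
  funext q
  rw [flowDx, ← he.tsum_eq]
  · refine tsum_congr fun p => ?_
    simp only [dX, e, Nat.add_sub_cancel, mul_pow]; ring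
  · intro p hp
    rcases p with ⟨_ | a, r⟩
    · simp [dX, SexedSmoluchowski.male] at hp
    · exact ⟨(a, r), rfl⟩

lemma analyticOnNhd_flowDy (h : Admissible c₀) (hτ : τ ∈ Ico (0 : ℝ) 1) (hz : z ∈ Icc (0 : ℝ) 1) :
    AnalyticOnNhd ℝ (fun q : ℝ × ℝ => flowDy c₀ τ ((1 - τ) * q.1) ((1 - τ) * q.2) z)
      (Ioo 0 1 ×ˢ Ioo 0 1) := by
  have hs := h.summable_flow_dY hτ (one_sub_mem hτ) (one_sub_mem hτ) hz
  set e : S → S := fun p => (p.1, p.2.1 + 1, p.2.2)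
  have he : Function.Injective e := fun p q hpq => by
    simp only [e, Prod.mk.injEq, Nat.add_right_cancel_iff] at hpq
    exact Prod.ext hpq.1 (Prod.ext hpq.2.1 hpq.2.2)
  have hse : Summable fun p => flow c₀ τ (e p) * dY (1 - τ) (1 - τ) z (e p) := hs.comp_injective he
  convert analyticOnNhd_tsum hse using 1
  funext q
  rw [flowDy, ← he.tsum_eq]
  · refine tsum_congr fun p => ?_
    simp only [dY, e, Nat.add_sub_cancel, mul_pow]; ring
  · intro p hp
    rcases p with ⟨a, _ | b, m⟩
    · simp [dY, SexedSmoluchowski.female] at hp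
    · exact ⟨(a, b, m), rfl⟩

lemma analyticOnNhd_foot (h : Admissible c₀) (hτ : τ ∈ Ico (0 : ℝ) 1) (hz : z ∈ Icc (0 : ℝ) 1) :
    AnalyticOnNhd ℝ (foot c₀ τ z) (Ioo 0 1 ×ˢ Ioo 0 1) := fun q hq =>
  ((analyticAt_const.mul analyticAt_fst).add
    (analyticAt_const.mul (h.analyticOnNhd_flowDy hτ hz q hq))).prod
  ((analyticAt_const.mul analyticAt_snd).add
    (analyticAt_const.mul (h.analyticOnNhd_flowDx hτ hz q hq)))

end Admissible

end SexedSmoluchowski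

/-! ### The candidate solution and its generating function -/

namespace SexedSmoluchowski

variable {c₀ : S → ℝ} {τ t x y z : ℝ}

/-- The solution of the sexed Smoluchowski system. -/
def sol (c₀ : S → ℝ) (t : ℝ) (p : S) : ℝ :=
  flow c₀ (tau t) p * monomial (1 - tau t) (1 - tau t) 1 p

lemma monomial_mul_monomial (r x y z : ℝ) (p : S) :
    monomial r r 1 p * monomial x y z p = monomial (r * x) (r * y) z p := by
  simp only [monomial, mul_pow, one_pow]; ring

lemma sol_mul_monomial (c₀ : S → ℝ) (t x y z : ℝ) (p : S) : sol c₀ t p * monomial x y z p =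
    flow c₀ (tau t) p * monomial ((1 - tau t) * x) ((1 - tau t) * y) z p := by
  rw [sol, mul_assoc, monomial_mul_monomial]

lemma integral_eq_sub_of_hasDerivWithinAt_unit {F f : ℝ → ℝ}
    (hF : ∀ r ∈ Icc (0 : ℝ) 1, HasDerivWithinAt F (f r) (Icc 0 1) r)
    (hf : ContinuousOn f (Icc 0 1)) (hx : x ∈ Icc (0 : ℝ) 1) :
    ∫ r in (0 : ℝ)..x, f r = F x - F 0 := by
  have hsub : Icc 0 x ⊆ Icc (0 : ℝ) 1 := Icc_subset_Icc_right hx.2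
  refine intervalIntegral.integral_eq_sub_of_hasDerivAt_of_le hx.1
    (fun r hr => (hF r (hsub hr)).continuousWithinAt.mono hsub) (fun r hr => ?_) ?_
  · exact (hF r ⟨hr.1.le, hr.2.le.trans hx.2⟩).hasDerivAt
      (Icc_mem_nhds hr.1 (hr.2.trans_le hx.2))
  · exact (hf.mono (by rwa [uIcc_of_le hx.1])).intervalIntegrable

lemma hasDerivWithinAt_one_sub_mul (τ : ℝ) (s : Set ℝ) (r : ℝ) :
    HasDerivWithinAt (fun r : ℝ => (1 - τ) * r) (1 - τ) s r := by
  simpa using (hasDerivWithinAt_id r s).const_mul (1 - τ)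

namespace Admissible

lemma integral_flowDx (h : Admissible c₀) (hτ : τ ∈ Ico (0 : ℝ) 1) (hx : x ∈ Icc (0 : ℝ) 1)
    (hy : y ∈ Icc (0 : ℝ) 1) (hz : z ∈ Icc (0 : ℝ) 1) :
    (1 - τ) * ∫ r in (0 : ℝ)..x, flowDx c₀ τ ((1 - τ) * r) ((1 - τ) * y) z =
      ∑' p, flow c₀ τ p * monomial ((1 - τ) * x) ((1 - τ) * y) z p -
      ∑' p, flow c₀ τ p * monomial 0 ((1 - τ) * y) z p := by
  have h1 : 0 < 1 - τ := by linarith [hτ.2]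
  have hd : ∀ r ∈ Icc (0 : ℝ) 1, HasDerivWithinAt
      (fun r => ∑' p, flow c₀ τ p * monomial ((1 - τ) * r) ((1 - τ) * y) z p)
      ((1 - τ) * flowDx c₀ τ ((1 - τ) * r) ((1 - τ) * y) z) (Icc 0 1) r := by
    intro r hr
    rw [flowDx, ← tsum_mul_left]
    refine hasDerivWithinAt_tsum (convex_Icc 0 1)
      (f := fun p r => flow c₀ τ p * monomial ((1 - τ) * r) ((1 - τ) * y) z p)
      (f' := fun p r => (1 - τ) * (flow c₀ τ p * dX ((1 - τ) * r) ((1 - τ) * y) z p))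
      ((h.summable_flow_dX_corner hτ).mul_left (1 - τ)) (fun p r _ => ?_) (fun p r hr => ?_) hr
      (h.summable_flow_monomial hτ (mul_mem_Icc hτ hr) (mul_mem_Icc hτ hy) hz) hr
    · refine ((hasDerivWithinAt_monomial (hasDerivWithinAt_one_sub_mul τ _ r)
        (hasDerivWithinAt_const r _ ((1 - τ) * y)) z p).const_mul (flow c₀ τ p)).congr_deriv ?_
      ring
    · have h2 := h.flow_dX_nonneg hτ (mul_mem_Icc hτ hr) (mul_mem_Icc hτ hy) hz p
      rw [abs_of_nonneg (mul_nonneg h1.le h2)]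
      exact mul_le_mul_of_nonneg_left
        (h.flow_dX_le hτ (mul_mem_Icc hτ hr) (mul_mem_Icc hτ hy) hz p) h1.le
  have hc : ContinuousOn (fun r => (1 - τ) * flowDx c₀ τ ((1 - τ) * r) ((1 - τ) * y) z)
      (Icc 0 1) :=
    continuousOn_const.mul ((h.continuousOn_flowDx hτ).comp
      (f := fun r : ℝ => (((1 - τ) * r, (1 - τ) * y, z) : ℝ × ℝ × ℝ)) (by fun_prop)
      fun r hr => ⟨mul_mem_Icc hτ hr, mul_mem_Icc hτ hy, hz⟩)
  rw [← intervalIntegral.integral_const_mul, integral_eq_sub_of_hasDerivWithinAt_unit hd hc hx,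
    mul_zero]

lemma integral_flowDy (h : Admissible c₀) (hτ : τ ∈ Ico (0 : ℝ) 1) (hx : x ∈ Icc (0 : ℝ) 1)
    (hy : y ∈ Icc (0 : ℝ) 1) (hz : z ∈ Icc (0 : ℝ) 1) :
    (1 - τ) * ∫ r in (0 : ℝ)..y, flowDy c₀ τ ((1 - τ) * x) ((1 - τ) * r) z =
      ∑' p, flow c₀ τ p * monomial ((1 - τ) * x) ((1 - τ) * y) z p -
      ∑' p, flow c₀ τ p * monomial ((1 - τ) * x) 0 z p := by
  have h1 : 0 < 1 - τ := by linarith [hτ.2]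
  have hd : ∀ r ∈ Icc (0 : ℝ) 1, HasDerivWithinAt
      (fun r => ∑' p, flow c₀ τ p * monomial ((1 - τ) * x) ((1 - τ) * r) z p)
      ((1 - τ) * flowDy c₀ τ ((1 - τ) * x) ((1 - τ) * r) z) (Icc 0 1) r := by
    intro r hr
    rw [flowDy, ← tsum_mul_left]
    refine hasDerivWithinAt_tsum (convex_Icc 0 1)
      (f := fun p r => flow c₀ τ p * monomial ((1 - τ) * x) ((1 - τ) * r) z p)
      (f' := fun p r => (1 - τ) * (flow c₀ τ p * dY ((1 - τ) * x) ((1 - τ) * r) z p))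
      ((h.summable_flow_dY_corner hτ).mul_left (1 - τ)) (fun p r _ => ?_) (fun p r hr => ?_) hr
      (h.summable_flow_monomial hτ (mul_mem_Icc hτ hx) (mul_mem_Icc hτ hr) hz) hr
    · refine ((hasDerivWithinAt_monomial (hasDerivWithinAt_const r _ ((1 - τ) * x))
        (hasDerivWithinAt_one_sub_mul τ _ r) z p).const_mul (flow c₀ τ p)).congr_deriv ?_
      ring
    · have h2 := h.flow_dY_nonneg hτ (mul_mem_Icc hτ hx) (mul_mem_Icc hτ hr) hz p
      rw [abs_of_nonneg (mul_nonneg h1.le h2)]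
      exact mul_le_mul_of_nonneg_left
        (h.flow_dY_le hτ (mul_mem_Icc hτ hx) (mul_mem_Icc hτ hr) hz p) h1.le
  have hc : ContinuousOn (fun r => (1 - τ) * flowDy c₀ τ ((1 - τ) * x) ((1 - τ) * r) z)
      (Icc 0 1) :=
    continuousOn_const.mul ((h.continuousOn_flowDy hτ).comp
      (f := fun r : ℝ => (((1 - τ) * x, (1 - τ) * r, z) : ℝ × ℝ × ℝ)) (by fun_prop)
      fun r hr => ⟨mul_mem_Icc hτ hx, mul_mem_Icc hτ hr, hz⟩)
  rw [← intervalIntegral.integral_const_mul, integral_eq_sub_of_hasDerivWithinAt_unit hd hc hy,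
    mul_zero]

lemma zero_mem_Ico (hτ : τ ∈ Ico (0 : ℝ) 1) : (0 : ℝ) ∈ Ico 0 (1 - τ) :=
  ⟨le_rfl, by linarith [hτ.2]⟩

lemma massIntegrand_eq (h : Admissible c₀) (hτ : τ ∈ Ico (0 : ℝ) 1) (hz : z ∈ Ico (0 : ℝ) 1) :
    massIntegrand c₀ (foot c₀ τ) z = ∑' p, flow c₀ τ p * dZ 0 0 z p := by
  have hz1 : z ∈ Icc (0 : ℝ) 1 := ⟨hz.1, hz.2.le⟩
  have h0 : ((0 : ℝ), (0 : ℝ)) ∈ square :=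
    ⟨left_mem_Icc.2 zero_le_one, left_mem_Icc.2 zero_le_one⟩
  have hf := h.foot_mem_square hτ hz1 h0
  rw [massIntegrand, h.genFunDz_eq hf.1 hf.2 hz, ← (h.characteristics hτ (zero_mem_Ico hτ)
    (zero_mem_Ico hτ) hz).2.2]
  simp only [foot, mul_zero]

/-- The integrand may be unbounded near `z = 1`. It is nonnegative and is the derivative on `(0, 1)`
of a function continuous on `[0, 1]`, hence integrable. -/
lemma massIntegrand_spec (h : Admissible c₀) (hτ : τ ∈ Ico (0 : ℝ) 1) :
    IntervalIntegrable (massIntegrand c₀ (foot c₀ τ)) volume 0 1 ∧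
      ∀ z ∈ Icc (0 : ℝ) 1, bigG c₀ (foot c₀ τ) z = ∑' p, flow c₀ τ p * monomial 0 0 z p := by
  have h0 : (0 : ℝ) ∈ Icc 0 (1 - τ) := Ico_subset_Icc_self (zero_mem_Ico hτ)
  have hc : ContinuousOn (fun r => ∑' p, flow c₀ τ p * monomial 0 0 r p) (Icc 0 1) :=
    (h.continuousOn_flow_monomial hτ).comp
      (f := fun r : ℝ => ((0, 0, r) : ℝ × ℝ × ℝ)) (by fun_prop) fun r hr => ⟨h0, h0, hr⟩
  have hd : ∀ r ∈ Ioo (0 : ℝ) 1, HasDerivAt (fun r => ∑' p, flow c₀ τ p * monomial 0 0 r p)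
      (massIntegrand c₀ (foot c₀ τ) r) r := fun r hr => by
    rw [h.massIntegrand_eq hτ ⟨hr.1.le, hr.2⟩]
    exact (hasDerivWithinAt_tsum_monomial_mass (h.summable_flow_monomial hτ h0 h0 one_mem)
      ⟨hr.1.le, hr.2⟩).hasDerivAt (Icc_mem_nhds hr.1 hr.2)
  have hint : IntervalIntegrable (massIntegrand c₀ (foot c₀ τ)) volume 0 1 := by
    rw [intervalIntegrable_iff_integrableOn_Ioc_of_le zero_le_one]
    refine intervalIntegral.integrableOn_deriv_of_nonneg hc hd fun r hr => ?_
    rw [h.massIntegrand_eq hτ ⟨hr.1.le, hr.2⟩]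
    exact tsum_nonneg fun p => mul_nonneg (h.flow_nonneg hτ.1 p) (dZ_nonneg le_rfl le_rfl hr.1.le p)
  refine ⟨hint, fun z hz => ?_⟩
  rw [bigG, intervalIntegral.integral_eq_sub_of_hasDerivAt_of_le hz.1
    (hc.mono (Icc_subset_Icc_right hz.2)) (fun r hr => hd r ⟨hr.1, hr.2.trans_le hz.2⟩)
    (hint.mono_set (by
      rw [uIcc_of_le hz.1, uIcc_of_le zero_le_one]; exact Icc_subset_Icc_right hz.2))]
  simp [monomial]

/-- Since `(1 + t) / t = 1 / τ` and `1 / t = (1 - τ) / τ`, the normalisation solves the definition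
of the foot for the gradient. -/
lemma tilde1_foot (ht : 0 < t) (z : ℝ) (x y : ℝ) : tilde1 t (foot c₀ (tau t) z) x y =
    flowDy c₀ (tau t) ((1 - tau t) * x) ((1 - tau t) * y) z := by
  rw [tilde1, foot]
  set Q := flowDy c₀ (tau t) ((1 - tau t) * x) ((1 - tau t) * y) z
  simp only
  rw [one_sub_tau ht.le, tau]
  field_simp
  ring

lemma tilde2_foot (ht : 0 < t) (z : ℝ) (x y : ℝ) : tilde2 t (foot c₀ (tau t) z) x y =
    flowDx c₀ (tau t) ((1 - tau t) * x) ((1 - tau t) * y) z := by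
  rw [tilde2, foot]
  set Q := flowDx c₀ (tau t) ((1 - tau t) * x) ((1 - tau t) * y) z
  simp only
  rw [one_sub_tau ht.le, tau]
  field_simp
  ring

/-- The generating function is recovered from its gradient along the broken line from `(0, 0, 0)`
through `(0, 0, z)` and `(0, y, z)` to `(x, y, z)`. The prefactor `1 / (1 + t) = 1 - τ` is the
Jacobian of the rescaling. -/
lemma hasSum_sol_monomial (h : Admissible c₀) (ht : 0 < t) (hx : x ∈ Icc (0 : ℝ) 1)
    (hy : y ∈ Icc (0 : ℝ) 1) (hz : z ∈ Icc (0 : ℝ) 1) :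
    HasSum (fun p => sol c₀ t p * monomial x y z p)
      (1 / (1 + t) * (bigTilde2 t (foot c₀ (tau t) z) x y + bigTilde1 t (foot c₀ (tau t) z) 0 y)
        + bigG c₀ (foot c₀ (tau t)) z) := by
  have hτ := tau_mem ht.le
  simp only [sol_mul_monomial]
  have hs := (h.summable_flow_monomial hτ (mul_mem_Icc hτ hx) (mul_mem_Icc hτ hy) hz).hasSum
  convert hs using 1
  have h1 := h.integral_flowDx hτ hx hy hz
  have h2 := h.integral_flowDy hτ (left_mem_Icc.2 zero_le_one) hy hz
  have h3 := (h.massIntegrand_spec hτ).2 z hz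
  simp only [bigTilde1, bigTilde2, tilde1_foot ht, tilde2_foot ht]
  rw [← one_sub_tau ht.le, h3]
  rw [mul_zero] at h2 ⊢
  linear_combination h1 + h2

/-! ### Conservation of mass -/

lemma summable_mul_dZ {U : S → ℝ} (hU : ∀ p, 0 ≤ U p)
    (hs : Summable fun p => U p * monomial x y 1 p) (hx : 0 ≤ x) (hy : 0 ≤ y)
    (hz : z ∈ Ioo (0 : ℝ) 1) : Summable fun p => U p * dZ x y z p := by
  obtain ⟨C, hC⟩ := exists_natCast_mul_pow_pred_le hz
  refine (hs.mul_right C).of_nonneg_of_le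
    (fun p => mul_nonneg (hU p) (dZ_nonneg hx hy hz.1.le p)) fun p => ?_
  have h2 : U p * dZ x y z p = U p * monomial x y 1 p * (mass p * z ^ ((p.2.2 : ℕ) - 1)) := by
    simp only [dZ, monomial, one_pow]; ring
  rw [h2]
  exact mul_le_mul_of_nonneg_left (hC p.2.2)
    (mul_nonneg (hU p) (monomial_nonneg hx hy one_pos.le p))

lemma continuous_dZ (p : S) : Continuous fun v : ℝ × ℝ × ℝ => dZ v.1 v.2.1 v.2.2 p := by
  unfold dZ; fun_prop

lemma sol_mul_mass (c₀ : S → ℝ) (t : ℝ) (p : S) : sol c₀ t p * SexedSmoluchowski.mass p =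
    flow c₀ (tau t) p * dZ (1 - tau t) (1 - tau t) 1 p := by
  simp only [sol, monomial, dZ, one_pow]; ring

/-- The `z`-derivative is constant along characteristics, but only inside the domain of convergence.
End points `(θ, θ, θ)` with `θ ↑ 1` have feet that tend to `(1, 1)`, because no arm is lost. As the
mass may be infinite, each inequality combines Fatou on one side with monotonicity in `θ` on the
other. -/
lemma mass_conservation (h : Admissible c₀) (ht : t ∈ timeInterval (critTime c₀)) :
    ((Summable fun p => sol c₀ t p * SexedSmoluchowski.mass p) ↔
      Summable fun p => c₀ p * SexedSmoluchowski.mass p) ∧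
    bracket (sol c₀ t) SexedSmoluchowski.mass = bracket c₀ SexedSmoluchowski.mass := by
  have hτ := tau_mem ht.1
  have hsub := h.subcritical_tau ht
  set τ := tau t
  have hm0 : ∀ p, c₀ p * SexedSmoluchowski.mass p = c₀ p * dZ 1 1 1 p := fun p => by
    simp only [dZ, one_pow, mul_one]
  simp only [bracket, sol_mul_mass, hm0]
  have h1τ : 0 < 1 - τ := by linarith [hτ.2]
  -- the identity inside the domain of convergence
  have hfoot : ∀ θ ∈ Ioo (0 : ℝ) 1, foot c₀ τ θ (θ, θ) ∈ square := fun θ hθ =>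
    h.foot_mem_square hτ ⟨hθ.1.le, hθ.2.le⟩ ⟨⟨hθ.1.le, hθ.2.le⟩, ⟨hθ.1.le, hθ.2.le⟩⟩
  have hid : ∀ θ ∈ Ioo (0 : ℝ) 1,
      ∑' p, c₀ p * dZ (foot c₀ τ θ (θ, θ)).1 (foot c₀ τ θ (θ, θ)).2 θ p =
        ∑' p, flow c₀ τ p * dZ ((1 - τ) * θ) ((1 - τ) * θ) θ p := fun θ hθ =>
    (h.characteristics hτ (mul_mem_Ico hτ ⟨hθ.1.le, hθ.2⟩) (mul_mem_Ico hτ ⟨hθ.1.le, hθ.2⟩)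
      ⟨hθ.1.le, hθ.2⟩).2.2
  have hev : ∀ᶠ θ : ℝ in 𝓝[<] 1, θ ∈ Ioo (0 : ℝ) 1 := Ioo_mem_nhdsLT one_pos
  have hfoot1 : foot c₀ τ 1 (1, 1) = (1, 1) := by
    obtain ⟨e1, e2⟩ := h.flowD_corner hsub
    simp only [foot, mul_one, e1, e2, sub_add_cancel]
  have hlimf : Tendsto (fun θ : ℝ => foot c₀ τ θ (θ, θ)) (𝓝[<] 1) (𝓝 (1, 1)) := by
    have hc := (h.continuousOn_foot hτ).comp (f := fun θ : ℝ => ((θ, θ, θ) : ℝ × ℝ × ℝ))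
      (s := Icc 0 1) (by fun_prop) fun θ hθ => ⟨hθ, hθ, hθ⟩
    have := hc 1 one_mem
    simp only [ContinuousWithinAt, Function.comp, hfoot1] at this
    exact this.mono_left (nhdsWithin_le_of_mem
      (mem_of_superset (Ioo_mem_nhdsLT one_pos) Ioo_subset_Icc_self))
  have hlim1 : ∀ p, Tendsto (fun θ : ℝ => c₀ p *
      dZ (foot c₀ τ θ (θ, θ)).1 (foot c₀ τ θ (θ, θ)).2 θ p) (𝓝[<] 1) (𝓝 (c₀ p * dZ 1 1 1 p)) := by
    intro p
    have hh := hlimf.fst_nhds.prodMk_nhds (hlimf.snd_nhds.prodMk_nhds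
      (nhdsWithin_le_nhds : 𝓝[<] (1 : ℝ) ≤ 𝓝 1))
    exact (((continuous_dZ p).tendsto (1, 1, 1)).comp hh).const_mul (c₀ p)
  have hlim2 : ∀ p, Tendsto (fun θ : ℝ => flow c₀ τ p * dZ ((1 - τ) * θ) ((1 - τ) * θ) θ p)
      (𝓝[<] 1) (𝓝 (flow c₀ τ p * dZ (1 - τ) (1 - τ) 1 p)) := by
    intro p
    have hc : Continuous fun θ : ℝ => flow c₀ τ p * dZ ((1 - τ) * θ) ((1 - τ) * θ) θ p := by
      unfold dZ; fun_prop
    have := hc.tendsto 1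
    rw [mul_one] at this
    exact this.mono_left nhdsWithin_le_nhds
  have hU := h.flow_nonneg hτ.1
  have hsum1 : ∀ θ ∈ Ioo (0 : ℝ) 1, Summable fun p =>
      c₀ p * dZ (foot c₀ τ θ (θ, θ)).1 (foot c₀ τ θ (θ, θ)).2 θ p := fun θ hθ =>
    summable_mul_dZ h.nonneg (h.summable_monomial (hfoot θ hθ).1 (hfoot θ hθ).2 one_mem)
      (hfoot θ hθ).1.1 (hfoot θ hθ).2.1 hθ
  have hsum2 : ∀ θ ∈ Ioo (0 : ℝ) 1, Summable fun p =>
      flow c₀ τ p * dZ ((1 - τ) * θ) ((1 - τ) * θ) θ p := fun θ hθ => by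
    have hm := mul_mem_Icc hτ ⟨hθ.1.le, hθ.2.le⟩
    exact summable_mul_dZ hU (h.summable_flow_monomial hτ hm hm one_mem) hm.1 hm.1 hθ
  have key1 : (Summable fun p => flow c₀ τ p * dZ (1 - τ) (1 - τ) 1 p) →
      (Summable fun p => c₀ p * dZ 1 1 1 p) ∧
        ∑' p, c₀ p * dZ 1 1 1 p ≤ ∑' p, flow c₀ τ p * dZ (1 - τ) (1 - τ) 1 p := by
    intro hs
    refine summable_and_tsum_le_of_tendsto
      (fun p => mul_nonneg (h.nonneg p) (dZ_nonneg one_pos.le one_pos.le one_pos.le p)) hlim1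
      fun F => ?_
    filter_upwards [hev] with θ hθ
    have hm := mul_mem_Icc hτ ⟨hθ.1.le, hθ.2.le⟩
    calc _ ≤ ∑' p, c₀ p * dZ (foot c₀ τ θ (θ, θ)).1 (foot c₀ τ θ (θ, θ)).2 θ p :=
          (hsum1 θ hθ).sum_le_tsum F fun p _ => mul_nonneg (h.nonneg p)
            (dZ_nonneg (hfoot θ hθ).1.1 (hfoot θ hθ).2.1 hθ.1.le p)
      _ = _ := hid θ hθ
      _ ≤ _ := (hsum2 θ hθ).tsum_le_tsum (fun p => mul_le_mul_of_nonneg_left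
          (dZ_mono hm.1 hm.1 hθ.1.le hm.2 hm.2 hθ.2.le p) (hU p)) hs
  have key2 : (Summable fun p => c₀ p * dZ 1 1 1 p) →
      (Summable fun p => flow c₀ τ p * dZ (1 - τ) (1 - τ) 1 p) ∧
        ∑' p, flow c₀ τ p * dZ (1 - τ) (1 - τ) 1 p ≤ ∑' p, c₀ p * dZ 1 1 1 p := by
    intro hs
    refine summable_and_tsum_le_of_tendsto
      (fun p => mul_nonneg (hU p) (dZ_nonneg h1τ.le h1τ.le one_pos.le p)) hlim2 fun F => ?_
    filter_upwards [hev] with θ hθ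
    have hm := mul_mem_Icc hτ ⟨hθ.1.le, hθ.2.le⟩
    calc _ ≤ ∑' p, flow c₀ τ p * dZ ((1 - τ) * θ) ((1 - τ) * θ) θ p :=
          (hsum2 θ hθ).sum_le_tsum F fun p _ => mul_nonneg (hU p)
            (dZ_nonneg hm.1 hm.1 hθ.1.le p)
      _ = _ := (hid θ hθ).symm
      _ ≤ _ := (hsum1 θ hθ).tsum_le_tsum (fun p => mul_le_mul_of_nonneg_left
          (dZ_mono (hfoot θ hθ).1.1 (hfoot θ hθ).2.1 hθ.1.le (hfoot θ hθ).1.2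
            (hfoot θ hθ).2.2 hθ.2.le p) (h.nonneg p)) hs
  refine ⟨⟨fun hs => (key1 hs).1, fun hs => (key2 hs).1⟩, ?_⟩
  by_cases hs : Summable fun p => c₀ p * dZ 1 1 1 p
  · exact le_antisymm (key2 hs).2 (key1 (key2 hs).1).2
  -- Infinite mass: neither series is summable, and both brackets take the default value `0`.
  · rw [tsum_eq_zero_of_not_summable hs, tsum_eq_zero_of_not_summable fun hs' => hs (key1 hs').1]

end Admissible

end SexedSmoluchowski

namespace SexedSmoluchowski

variable {c₀ : S → ℝ} {τ t x y z r : ℝ}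

/-! ### Second moments -/

/-- If a series of monotone functions is Lipschitz at the right end point, then the series of the
derivatives converges there. -/
lemma summable_deriv_of_lipschitz {ι : Type*} {f : ι → ℝ → ℝ} {f' : ι → ℝ} {L : ℝ}
    (hmono : ∀ i, MonotoneOn (f i) (Icc 0 1))
    (hd : ∀ i, HasDerivWithinAt (f i) (f' i) (Icc 0 1) 1)
    (hs : ∀ r ∈ Icc (0 : ℝ) 1, Summable fun i => f i r)
    (hL : ∀ r ∈ Icc (0 : ℝ) 1, ∑' i, f i 1 - ∑' i, f i r ≤ L * (1 - r)) : Summable f' := by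
  have hone : (1 : ℝ) ∈ Icc (0 : ℝ) 1 := right_mem_Icc.2 zero_le_one
  have hle : 𝓝[<] (1 : ℝ) ≤ 𝓝[Icc 0 1 \ {1}] 1 := nhdsWithin_le_of_mem
    (mem_of_superset (Ioo_mem_nhdsLT one_pos) fun r hr => ⟨⟨hr.1.le, hr.2.le⟩, hr.2.ne⟩)
  have hlim : ∀ i, Tendsto (fun r => slope (f i) 1 r) (𝓝[<] 1) (𝓝 (f' i)) := fun i =>
    (hasDerivWithinAt_iff_tendsto_slope.1 (hd i)).mono_left hle
  have hslope : ∀ r i, slope (f i) 1 r = (f i 1 - f i r) / (1 - r) := fun r i => by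
    rw [slope_def_field, ← neg_div_neg_eq]; congr 1 <;> ring
  have hnn : ∀ r ∈ Ioo (0 : ℝ) 1, ∀ i, 0 ≤ slope (f i) 1 r := fun r hr i => by
    rw [hslope]
    exact div_nonneg (sub_nonneg.2 (hmono i ⟨hr.1.le, hr.2.le⟩ hone hr.2.le)) (by linarith [hr.2])
  refine (summable_and_tsum_le_of_tendsto (C := L)
    (fun i => ge_of_tendsto (hlim i) ?_) hlim fun F => ?_).1
  · filter_upwards [Ioo_mem_nhdsLT one_pos] with r hr using hnn r hr i
  · filter_upwards [Ioo_mem_nhdsLT one_pos] with r hr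
    have hr' : r ∈ Icc (0 : ℝ) 1 := ⟨hr.1.le, hr.2.le⟩
    have h1 : 0 < 1 - r := by linarith [hr.2]
    simp only [hslope]
    rw [← Finset.sum_div, div_le_iff₀ h1]
    refine le_trans ?_ (hL r hr')
    rw [← (hs 1 hone).tsum_sub (hs r hr')]
    exact ((hs 1 hone).sub (hs r hr')).sum_le_tsum F fun i _ =>
      sub_nonneg.2 (hmono i hr' hone hr'.2)

namespace Admissible

/-- The difference of the feet of two characteristics that end on the diagonal. -/
lemma exists_lipschitz_foot (h : Admissible c₀) (hτ : Subcritical c₀ τ) :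
    ∃ L, ∀ r ∈ Icc (0 : ℝ) 1, |(foot c₀ τ 1 (1, 1)).1 - (foot c₀ τ 1 (r, r)).1| ≤ L * (1 - r) ∧
      |(foot c₀ τ 1 (1, 1)).2 - (foot c₀ τ 1 (r, r)).2| ≤ L * (1 - r) := by
  set J := jacobian c₀ τ with hJdef
  have hJ : 0 < J := hτ.jacobian_pos
  set α := 1 - τ * momXY c₀
  have h1 : 0 < 1 - τ := by linarith [hτ.mem.2]
  have hα : 0 < α := sub_pos.2 hτ.mul_momXY_lt
  have hs := mul_nonneg hτ.mem.1 h.momYY_nonneg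
  have hu := mul_nonneg hτ.mem.1 h.momXX_nonneg
  -- Both end points differ by `(1 - τ)(1 - r)` in each coordinate; the constant adds the
  -- coefficients of the two estimates of `fixed_point_lipschitz`, so as to serve for both.
  refine ⟨(α + τ * momYY c₀ + τ * momXX c₀) * (1 - τ) / J, fun r hr => ?_⟩
  have hsq1 : ((1 : ℝ), (1 : ℝ)) ∈ square := ⟨one_mem, one_mem⟩
  have hsqr : (r, r) ∈ square := ⟨hr, hr⟩
  have m1 := h.foot_mem_square hτ.mem one_mem hsq1
  have mr := h.foot_mem_square hτ.mem one_mem hsqr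
  obtain ⟨e1, e2⟩ := h.foot_eq hτ.mem one_mem hsq1
  obtain ⟨e3, e4⟩ := h.foot_eq hτ.mem one_mem hsqr
  obtain ⟨k1, k2⟩ := h.fixed_point_lipschitz hτ m1.1 mr.1 m1.2 mr.2 one_mem e1 e2 e3 e4
  have hr1 : 0 ≤ 1 - r := by linarith [hr.2]
  have hd : |(1 - τ) * 1 - (1 - τ) * r| = (1 - τ) * (1 - r) := by
    rw [← mul_sub, abs_of_nonneg (mul_nonneg h1.le hr1)]
  simp only [hd] at k1 k2
  have hprod := mul_nonneg h1.le hr1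
  have l1 := mul_nonneg hs hprod
  have l2 := mul_nonneg hu hprod
  rw [div_mul_eq_mul_div, le_div_iff₀ hJ, le_div_iff₀ hJ]
  constructor <;> linarith

lemma flowDx_eq_foot (h : Admissible c₀) (hτ : τ ∈ Ico (0 : ℝ) 1) (hr : r ∈ Icc (0 : ℝ) 1) :
    flowDx c₀ τ ((1 - τ) * r) ((1 - τ) * r) 1 =
      ∑' p, c₀ p * dX (foot c₀ τ 1 (r, r)).1 (foot c₀ τ 1 (r, r)).2 1 p := by
  rw [← (h.flowDx_eq_and_flowDy_eq hτ (mul_mem_Icc hτ hr) (mul_mem_Icc hτ hr) one_mem).1,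
    flowDx_zero, foot]

lemma flowDy_eq_foot (h : Admissible c₀) (hτ : τ ∈ Ico (0 : ℝ) 1) (hr : r ∈ Icc (0 : ℝ) 1) :
    flowDy c₀ τ ((1 - τ) * r) ((1 - τ) * r) 1 =
      ∑' p, c₀ p * dY (foot c₀ τ 1 (r, r)).1 (foot c₀ τ 1 (r, r)).2 1 p := by
  rw [← (h.flowDx_eq_and_flowDy_eq hτ (mul_mem_Icc hτ hr) (mul_mem_Icc hτ hr) one_mem).2,
    flowDy_zero, foot]

lemma hasDerivWithinAt_dX_diag (c₀ : S → ℝ) (τ : ℝ) (s : Set ℝ) (r : ℝ) (p : S) :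
    HasDerivWithinAt (fun r => flow c₀ τ p * dX ((1 - τ) * r) ((1 - τ) * r) 1 p)
      ((1 - τ) * (flow c₀ τ p * dXX ((1 - τ) * r) ((1 - τ) * r) 1 p
        + flow c₀ τ p * dXY ((1 - τ) * r) ((1 - τ) * r) 1 p)) s r :=
  ((hasDerivWithinAt_dX (hasDerivWithinAt_one_sub_mul τ s r)
    (hasDerivWithinAt_one_sub_mul τ s r) 1 p).const_mul (flow c₀ τ p)).congr_deriv (by ring)

lemma hasDerivWithinAt_dY_diag (c₀ : S → ℝ) (τ : ℝ) (s : Set ℝ) (r : ℝ) (p : S) :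
    HasDerivWithinAt (fun r => flow c₀ τ p * dY ((1 - τ) * r) ((1 - τ) * r) 1 p)
      ((1 - τ) * (flow c₀ τ p * dXY ((1 - τ) * r) ((1 - τ) * r) 1 p
        + flow c₀ τ p * dYY ((1 - τ) * r) ((1 - τ) * r) 1 p)) s r :=
  ((hasDerivWithinAt_dY (hasDerivWithinAt_one_sub_mul τ s r)
    (hasDerivWithinAt_one_sub_mul τ s r) 1 p).const_mul (flow c₀ τ p)).congr_deriv (by ring)

/-- The second derivatives at the corner of the domain of convergence are finite before the
critical time. -/
lemma summable_flow_second (h : Admissible c₀) (hτ : Subcritical c₀ τ) :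
    (Summable fun p => flow c₀ τ p * dXX (1 - τ) (1 - τ) 1 p
        + flow c₀ τ p * dXY (1 - τ) (1 - τ) 1 p) ∧
      Summable fun p => flow c₀ τ p * dXY (1 - τ) (1 - τ) 1 p
        + flow c₀ τ p * dYY (1 - τ) (1 - τ) 1 p := by
  obtain ⟨L, hL⟩ := h.exists_lipschitz_foot hτ
  have h1 : 0 < 1 - τ := by linarith [hτ.mem.2]
  have hU := h.flow_nonneg hτ.mem.1
  have hsq : ∀ r ∈ Icc (0 : ℝ) 1, foot c₀ τ 1 (r, r) ∈ square := fun r hr =>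
    h.foot_mem_square hτ.mem one_mem ⟨hr, hr⟩
  constructor
  -- Along the diagonal the gradient at time `τ` is the initial gradient at the foot. Both the
  -- initial gradient and the foot are Lipschitz, so the derivative series converges at the corner.
  · refine (summable_mul_left_iff h1.ne').1 (summable_deriv_of_lipschitz
      (f := fun p r => flow c₀ τ p * dX ((1 - τ) * r) ((1 - τ) * r) 1 p)
      (L := momXX c₀ * L + momXY c₀ * L) (fun p r hr r' _ hrr => ?_) (fun p => ?_)
      (fun r hr => h.summable_flow_dX hτ.mem (mul_mem_Icc hτ.mem hr) (mul_mem_Icc hτ.mem hr)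
        one_mem) fun r hr => ?_)
    · have h2 := mul_nonneg h1.le hr.1
      have h3 := mul_le_mul_of_nonneg_left hrr h1.le
      exact mul_le_mul_of_nonneg_left (dX_mono h2 h2 one_pos.le h3 h3 le_rfl p) (hU p)
    · simpa only [mul_one] using hasDerivWithinAt_dX_diag c₀ τ (Icc 0 1) 1 p
    · have e1 := h.flowDx_eq_foot hτ.mem one_mem
      have er := h.flowDx_eq_foot hτ.mem hr
      have h2 := h.abs_tsum_dX_sub_le (hsq 1 one_mem).1 (hsq r hr).1 (hsq 1 one_mem).2 (hsq r hr).2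
        one_mem
      rw [← e1, ← er] at h2
      have h3 := mul_le_mul_of_nonneg_left (hL r hr).1 h.momXX_nonneg
      have h4 := mul_le_mul_of_nonneg_left (hL r hr).2 h.momXY_nonneg
      have h5 := (le_abs_self _).trans h2
      change flowDx c₀ τ ((1 - τ) * 1) ((1 - τ) * 1) 1 - flowDx c₀ τ ((1 - τ) * r) ((1 - τ) * r) 1
        ≤ _
      linarith
  · refine (summable_mul_left_iff h1.ne').1 (summable_deriv_of_lipschitz
      (f := fun p r => flow c₀ τ p * dY ((1 - τ) * r) ((1 - τ) * r) 1 p)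
      (L := momXY c₀ * L + momYY c₀ * L) (fun p r hr r' _ hrr => ?_) (fun p => ?_)
      (fun r hr => h.summable_flow_dY hτ.mem (mul_mem_Icc hτ.mem hr) (mul_mem_Icc hτ.mem hr)
        one_mem) fun r hr => ?_)
    · have h2 := mul_nonneg h1.le hr.1
      have h3 := mul_le_mul_of_nonneg_left hrr h1.le
      exact mul_le_mul_of_nonneg_left (dY_mono h2 h2 one_pos.le h3 h3 le_rfl p) (hU p)
    · simpa only [mul_one] using hasDerivWithinAt_dY_diag c₀ τ (Icc 0 1) 1 p
    · have e1 := h.flowDy_eq_foot hτ.mem one_mem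
      have er := h.flowDy_eq_foot hτ.mem hr
      have h2 := h.abs_tsum_dY_sub_le (hsq 1 one_mem).1 (hsq r hr).1 (hsq 1 one_mem).2 (hsq r hr).2
        one_mem
      rw [← e1, ← er] at h2
      have h3 := mul_le_mul_of_nonneg_left (hL r hr).1 h.momXY_nonneg
      have h4 := mul_le_mul_of_nonneg_left (hL r hr).2 h.momYY_nonneg
      have h5 := (le_abs_self _).trans h2
      change flowDy c₀ τ ((1 - τ) * 1) ((1 - τ) * 1) 1 - flowDy c₀ τ ((1 - τ) * r) ((1 - τ) * r) 1
        ≤ _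
      linarith

/-- The linear equations for the second derivatives at the corner of the domain of convergence. -/
lemma second_derivatives_eq (h : Admissible c₀) (hτ : Subcritical c₀ τ) :
    let A := ∑' p, (1 - τ) * (flow c₀ τ p * dXX (1 - τ) (1 - τ) 1 p
        + flow c₀ τ p * dXY (1 - τ) (1 - τ) 1 p)
    let B := ∑' p, (1 - τ) * (flow c₀ τ p * dXY (1 - τ) (1 - τ) 1 p
        + flow c₀ τ p * dYY (1 - τ) (1 - τ) 1 p)
    A = momXX c₀ * ((1 - τ) + τ * B) + momXY c₀ * ((1 - τ) + τ * A) ∧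
      B = momXY c₀ * ((1 - τ) + τ * B) + momYY c₀ * ((1 - τ) + τ * A) := by
  intro A B
  have hm := hτ.mem
  have h1 : 0 < 1 - τ := by linarith [hm.2]
  have hU := h.flow_nonneg hm.1
  obtain ⟨sA, sB⟩ := h.summable_flow_second hτ
  have sA' := sA.mul_left (1 - τ)
  have sB' := sB.mul_left (1 - τ)
  have hr0 : ∀ r ∈ Icc (0 : ℝ) 1, 0 ≤ (1 - τ) * r ∧ (1 - τ) * r ≤ 1 - τ := fun r hr =>
    mul_mem_Icc hm hr
  have bA : ∀ p, ∀ r ∈ Icc (0 : ℝ) 1,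
      |(1 - τ) * (flow c₀ τ p * dXX ((1 - τ) * r) ((1 - τ) * r) 1 p
        + flow c₀ τ p * dXY ((1 - τ) * r) ((1 - τ) * r) 1 p)| ≤
      (1 - τ) * (flow c₀ τ p * dXX (1 - τ) (1 - τ) 1 p
        + flow c₀ τ p * dXY (1 - τ) (1 - τ) 1 p) := fun p r hr => by
    obtain ⟨h2, h3⟩ := hr0 r hr
    rw [abs_of_nonneg (mul_nonneg h1.le (add_nonneg
      (mul_nonneg (hU p) (dXX_nonneg h2 h2 one_pos.le p))
      (mul_nonneg (hU p) (dXY_nonneg h2 h2 one_pos.le p))))]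
    exact mul_le_mul_of_nonneg_left (add_le_add
      (mul_le_mul_of_nonneg_left (dXX_mono h2 h2 one_pos.le h3 h3 le_rfl p) (hU p))
      (mul_le_mul_of_nonneg_left (dXY_mono h2 h2 one_pos.le h3 h3 le_rfl p) (hU p))) h1.le
  have bB : ∀ p, ∀ r ∈ Icc (0 : ℝ) 1,
      |(1 - τ) * (flow c₀ τ p * dXY ((1 - τ) * r) ((1 - τ) * r) 1 p
        + flow c₀ τ p * dYY ((1 - τ) * r) ((1 - τ) * r) 1 p)| ≤
      (1 - τ) * (flow c₀ τ p * dXY (1 - τ) (1 - τ) 1 p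
        + flow c₀ τ p * dYY (1 - τ) (1 - τ) 1 p) := fun p r hr => by
    obtain ⟨h2, h3⟩ := hr0 r hr
    rw [abs_of_nonneg (mul_nonneg h1.le (add_nonneg
      (mul_nonneg (hU p) (dXY_nonneg h2 h2 one_pos.le p))
      (mul_nonneg (hU p) (dYY_nonneg h2 h2 one_pos.le p))))]
    exact mul_le_mul_of_nonneg_left (add_le_add
      (mul_le_mul_of_nonneg_left (dXY_mono h2 h2 one_pos.le h3 h3 le_rfl p) (hU p))
      (mul_le_mul_of_nonneg_left (dYY_mono h2 h2 one_pos.le h3 h3 le_rfl p) (hU p))) h1.le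
  set dA : ℝ → ℝ := fun r => ∑' p, (1 - τ) * (flow c₀ τ p * dXX ((1 - τ) * r) ((1 - τ) * r) 1 p
        + flow c₀ τ p * dXY ((1 - τ) * r) ((1 - τ) * r) 1 p) with hdA
  set dB : ℝ → ℝ := fun r => ∑' p, (1 - τ) * (flow c₀ τ p * dXY ((1 - τ) * r) ((1 - τ) * r) 1 p
        + flow c₀ τ p * dYY ((1 - τ) * r) ((1 - τ) * r) 1 p) with hdB
  have hA1 : dA 1 = A := by simp only [hdA, mul_one, A]
  have hB1 : dB 1 = B := by simp only [hdB, mul_one, B]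
  have hP : ∀ r ∈ Icc (0 : ℝ) 1, HasDerivWithinAt
      (fun r => flowDx c₀ τ ((1 - τ) * r) ((1 - τ) * r) 1) (dA r) (Icc 0 1) r := fun r hr =>
    hasDerivWithinAt_tsum (convex_Icc 0 1) sA'
      (fun p r _ => hasDerivWithinAt_dX_diag c₀ τ (Icc 0 1) r p) bA hr
      (h.summable_flow_dX hm (mul_mem_Icc hm hr) (mul_mem_Icc hm hr) one_mem) hr
  have hQ : ∀ r ∈ Icc (0 : ℝ) 1, HasDerivWithinAt
      (fun r => flowDy c₀ τ ((1 - τ) * r) ((1 - τ) * r) 1) (dB r) (Icc 0 1) r := fun r hr =>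
    hasDerivWithinAt_tsum (convex_Icc 0 1) sB'
      (fun p r _ => hasDerivWithinAt_dY_diag c₀ τ (Icc 0 1) r p) bB hr
      (h.summable_flow_dY hm (mul_mem_Icc hm hr) (mul_mem_Icc hm hr) one_mem) hr
  have nA : ∀ r ∈ Icc (0 : ℝ) 1, |dA r| ≤ A := fun r hr => by
    rw [← Real.norm_eq_abs]
    exact tsum_of_norm_bounded sA'.hasSum fun p => bA p r hr
  have nB : ∀ r ∈ Icc (0 : ℝ) 1, |dB r| ≤ B := fun r hr => by
    rw [← Real.norm_eq_abs]
    exact tsum_of_norm_bounded sB'.hasSum fun p => bB p r hr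
  have hX : ∀ r ∈ Icc (0 : ℝ) 1, HasDerivWithinAt (fun r => (foot c₀ τ 1 (r, r)).1)
      ((1 - τ) + τ * dB r) (Icc 0 1) r := fun r hr =>
    (hasDerivWithinAt_one_sub_mul τ _ r).add ((hQ r hr).const_mul τ)
  have hY : ∀ r ∈ Icc (0 : ℝ) 1, HasDerivWithinAt (fun r => (foot c₀ τ 1 (r, r)).2)
      ((1 - τ) + τ * dA r) (Icc 0 1) r := fun r hr =>
    (hasDerivWithinAt_one_sub_mul τ _ r).add ((hP r hr).const_mul τ)
  have hXb : ∀ r ∈ Icc (0 : ℝ) 1, |(1 - τ) + τ * dB r| ≤ (1 - τ) + τ * B := fun r hr => by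
    refine (abs_add_le _ _).trans ?_
    rw [abs_of_pos h1, abs_mul, abs_of_nonneg hm.1]
    exact add_le_add le_rfl (mul_le_mul_of_nonneg_left (nB r hr) hm.1)
  have hYb : ∀ r ∈ Icc (0 : ℝ) 1, |(1 - τ) + τ * dA r| ≤ (1 - τ) + τ * A := fun r hr => by
    refine (abs_add_le _ _).trans ?_
    rw [abs_of_pos h1, abs_mul, abs_of_nonneg hm.1]
    exact add_le_add le_rfl (mul_le_mul_of_nonneg_left (nA r hr) hm.1)
  have hsq : ∀ r ∈ Icc (0 : ℝ) 1, foot c₀ τ 1 (r, r) ∈ square := fun r hr =>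
    h.foot_mem_square hm one_mem ⟨hr, hr⟩
  have hfoot1 : foot c₀ τ 1 (1, 1) = (1, 1) := by
    obtain ⟨e1, e2⟩ := h.flowD_corner hτ
    simp only [foot, mul_one, e1, e2, sub_add_cancel]
  have hbd : ∀ {a b a' b' α β α' β' c : ℝ}, 0 ≤ c → 0 ≤ a → 0 ≤ b → a ≤ a' → b ≤ b' →
      |α| ≤ α' → |β| ≤ β' → |c * (a * α + b * β)| ≤ c * a' * α' + c * b' * β' := by
    intro a b a' b' α β α' β' c hc ha hb haa hbb hα hβ
    rw [abs_mul, abs_of_nonneg hc]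
    have : |a * α + b * β| ≤ a' * α' + b' * β' := by
      refine (abs_add_le _ _).trans ?_
      rw [abs_mul, abs_mul, abs_of_nonneg ha, abs_of_nonneg hb]
      exact add_le_add (mul_le_mul haa hα (abs_nonneg _) (ha.trans haa))
        (mul_le_mul hbb hβ (abs_nonneg _) (hb.trans hbb))
    calc _ ≤ c * (a' * α' + b' * β') := mul_le_mul_of_nonneg_left this hc
      _ = _ := by ring
  have huniq := uniqueDiffWithinAt_unit (x := 1) one_mem
  constructor
  · have hD := hasDerivWithinAt_tsum (convex_Icc 0 1)
      (f := fun p r => c₀ p * dX (foot c₀ τ 1 (r, r)).1 (foot c₀ τ 1 (r, r)).2 1 p)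
      (f' := fun p r => c₀ p * (dXX (foot c₀ τ 1 (r, r)).1 (foot c₀ τ 1 (r, r)).2 1 p *
        ((1 - τ) + τ * dB r) + dXY (foot c₀ τ 1 (r, r)).1 (foot c₀ τ 1 (r, r)).2 1 p *
        ((1 - τ) + τ * dA r)))
      ((h.summable_dXX.mul_right ((1 - τ) + τ * B)).add
        (h.summable_dXY.mul_right ((1 - τ) + τ * A)))
      (fun p r hr => (hasDerivWithinAt_dX (hX r hr) (hY r hr) 1 p).const_mul (c₀ p))
      (fun p r hr => by
        obtain ⟨m1, m2⟩ := hsq r hr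
        exact hbd (h.nonneg p) (dXX_nonneg m1.1 m2.1 one_pos.le p)
          (dXY_nonneg m1.1 m2.1 one_pos.le p) (dXX_mono m1.1 m2.1 one_pos.le m1.2 m2.2 le_rfl p)
          (dXY_mono m1.1 m2.1 one_pos.le m1.2 m2.2 le_rfl p) (hXb r hr) (hYb r hr))
      one_mem (h.summable_dX (hsq 1 one_mem).1 (hsq 1 one_mem).2 one_mem) one_mem
    -- The function of `r` has two expressions, directly and through the foot. Equating their
    -- derivatives at `r = 1`, where the foot is `(1, 1)`, gives the linear equation.
    have hP' := (hP 1 one_mem).congr (fun r hr => (h.flowDx_eq_foot hm hr).symm)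
      (h.flowDx_eq_foot hm one_mem).symm
    have key := huniq.eq_deriv _ hP' hD
    rw [hA1] at key
    simp only [hfoot1, hB1] at key
    have hsum := (h.summable_dXX.hasSum.mul_right ((1 - τ) + τ * B)).add
        (h.summable_dXY.hasSum.mul_right ((1 - τ) + τ * A))
    rw [← momXX, ← momXY] at hsum
    exact key.trans ((tsum_congr fun p => by ring).trans hsum.tsum_eq)
  · have hD := hasDerivWithinAt_tsum (convex_Icc 0 1)
      (f := fun p r => c₀ p * dY (foot c₀ τ 1 (r, r)).1 (foot c₀ τ 1 (r, r)).2 1 p)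
      (f' := fun p r => c₀ p * (dXY (foot c₀ τ 1 (r, r)).1 (foot c₀ τ 1 (r, r)).2 1 p *
        ((1 - τ) + τ * dB r) + dYY (foot c₀ τ 1 (r, r)).1 (foot c₀ τ 1 (r, r)).2 1 p *
        ((1 - τ) + τ * dA r)))
      ((h.summable_dXY.mul_right ((1 - τ) + τ * B)).add
        (h.summable_dYY.mul_right ((1 - τ) + τ * A)))
      (fun p r hr => (hasDerivWithinAt_dY (hX r hr) (hY r hr) 1 p).const_mul (c₀ p))
      (fun p r hr => by
        obtain ⟨m1, m2⟩ := hsq r hr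
        exact hbd (h.nonneg p) (dXY_nonneg m1.1 m2.1 one_pos.le p)
          (dYY_nonneg m1.1 m2.1 one_pos.le p) (dXY_mono m1.1 m2.1 one_pos.le m1.2 m2.2 le_rfl p)
          (dYY_mono m1.1 m2.1 one_pos.le m1.2 m2.2 le_rfl p) (hXb r hr) (hYb r hr))
      one_mem (h.summable_dY (hsq 1 one_mem).1 (hsq 1 one_mem).2 one_mem) one_mem
    have hQ' := (hQ 1 one_mem).congr (fun r hr => (h.flowDy_eq_foot hm hr).symm)
      (h.flowDy_eq_foot hm one_mem).symm
    have key := huniq.eq_deriv _ hQ' hD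
    rw [hB1] at key
    simp only [hfoot1, hA1] at key
    have hsum := (h.summable_dXY.hasSum.mul_right ((1 - τ) + τ * B)).add
        (h.summable_dYY.hasSum.mul_right ((1 - τ) + τ * A))
    rw [← momYY, ← momXY] at hsum
    exact key.trans ((tsum_congr fun p => by ring).trans hsum.tsum_eq)

end Admissible

end SexedSmoluchowski

namespace SexedSmoluchowski

variable {c₀ : S → ℝ} {τ t x y z r : ℝ}

/-! ### Moments of the solution -/

lemma mul_dX_self (x y z : ℝ) (p : S) : x * dX x y z p = male p * monomial x y z p := by
  rcases p with ⟨_ | a, b, m⟩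
  · simp [dX, male]
  · simp only [dX, monomial, Nat.add_sub_cancel]; ring

lemma mul_dY_self (x y z : ℝ) (p : S) : y * dY x y z p = female p * monomial x y z p := by
  rcases p with ⟨a, _ | b, m⟩
  · simp [dY, female]
  · simp only [dY, monomial, Nat.add_sub_cancel]; ring

lemma sq_mul_dXX_self (x y z : ℝ) (p : S) :
    x ^ 2 * dXX x y z p = male p * (male p - 1) * monomial x y z p := by
  rcases p with ⟨_ | _ | a, b, m⟩
  · simp [dXX, male]
  · simp [dXX, male]
  · simp only [dXX, monomial, show a + 1 + 1 - 2 = a by omega]; ring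

lemma sq_mul_dYY_self (x y z : ℝ) (p : S) :
    y ^ 2 * dYY x y z p = female p * (female p - 1) * monomial x y z p := by
  rcases p with ⟨a, _ | _ | b, m⟩
  · simp [dYY, female]
  · simp [dYY, female]
  · simp only [dYY, monomial, show b + 1 + 1 - 2 = b by omega]; ring

lemma mul_mul_dXY_self (x y z : ℝ) (p : S) :
    x * y * dXY x y z p = male p * female p * monomial x y z p := by
  rcases p with ⟨_ | a, b, m⟩
  · simp [dXY, male]
  rcases b with _ | b
  · simp [dXY, female]
  · simp only [dXY, monomial, Nat.add_sub_cancel]; ring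

/-- Together the reagents have one male and one female arm more than the product, hence the factor
`x y`. At `x = y = 1 - τ` this factor is `dτ/dt`. -/
lemma gain_mul_monomial (U : S → ℝ) (x y : ℝ) (p : S) :
    gain (fun q => U q * monomial x y 1 q) p = x * y * monomial x y 1 p * gain U p := by
  simp only [gain]
  rw [mul_left_comm (x * y * monomial x y 1 p), Finset.mul_sum (below p) _ (x * y * monomial x y 1 p)]
  congr 1
  refine Finset.sum_congr rfl fun q hq => ?_
  obtain ⟨h1, h2, -⟩ := mem_below.1 hq
  have h3 : q.1 + (rest p q).1 = p.1 + 1 := by simp only [rest]; omega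
  have h4 : q.2.1 + (rest p q).2.1 = p.2.1 + 1 := by simp only [rest]; omega
  have h5 : monomial x y 1 q * monomial x y 1 (rest p q) = x * y * monomial x y 1 p := by
    simp only [monomial, one_pow, mul_one]
    calc _ = x ^ (q.1 + (rest p q).1) * y ^ (q.2.1 + (rest p q).2.1) := by
          rw [pow_add, pow_add]; ring
      _ = _ := by rw [h3, h4]; ring
  calc _ = rate q (rest p q) * U q * U (rest p q) *
        (monomial x y 1 q * monomial x y 1 (rest p q)) := by ring
    _ = _ := by rw [h5]; ring

lemma sol_eq (c₀ : S → ℝ) (t : ℝ) :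
    sol c₀ t = fun q => flow c₀ (tau t) q * monomial (1 - tau t) (1 - tau t) 1 q := rfl

lemma sol_zero (c₀ : S → ℝ) : sol c₀ 0 = c₀ := by
  funext p; simp [sol, tau, monomial]

lemma mem_timeInterval_of_le {T : EReal} (ht : t ∈ timeInterval T) {s : ℝ} (hs : 0 ≤ s)
    (hst : s ≤ t) : s ∈ timeInterval T :=
  ⟨hs, (EReal.coe_le_coe_iff.2 hst).trans_lt ht.2⟩

namespace Admissible

lemma sol_nonneg (h : Admissible c₀) (ht : 0 ≤ t) (p : S) : 0 ≤ sol c₀ t p :=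
  h.flow_monomial_nonneg (tau_mem ht) (one_sub_mem (tau_mem ht)) (one_sub_mem (tau_mem ht)) one_mem p

lemma hasSum_sol_male (h : Admissible c₀) (ht : t ∈ timeInterval (critTime c₀)) :
    HasSum (fun p => sol c₀ t p * SexedSmoluchowski.male p) (1 - tau t) := by
  have h1 := (h.summable_flow_dX_corner (tau_mem ht.1)).hasSum
  rw [← flowDx, (h.flowD_corner (h.subcritical_tau ht)).1] at h1
  have h2 := h1.mul_left (1 - tau t)
  rw [mul_one] at h2
  refine h2.congr_fun fun p => ?_
  rw [mul_left_comm, mul_dX_self, sol]; ring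

lemma hasSum_sol_female (h : Admissible c₀) (ht : t ∈ timeInterval (critTime c₀)) :
    HasSum (fun p => sol c₀ t p * SexedSmoluchowski.female p) (1 - tau t) := by
  have h1 := (h.summable_flow_dY_corner (tau_mem ht.1)).hasSum
  rw [← flowDy, (h.flowD_corner (h.subcritical_tau ht)).2] at h1
  have h2 := h1.mul_left (1 - tau t)
  rw [mul_one] at h2
  refine h2.congr_fun fun p => ?_
  rw [mul_left_comm, mul_dY_self, sol]; ring

lemma summable_sol_second (h : Admissible c₀) (ht : t ∈ timeInterval (critTime c₀)) :
    Summable fun p => sol c₀ t p * (SexedSmoluchowski.male p ^ 2 + SexedSmoluchowski.female p ^ 2) := by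
  obtain ⟨h1, h2⟩ := h.summable_flow_second (h.subcritical_tau ht)
  have h3 := ((h1.add h2).mul_left ((1 - tau t) ^ 2)).add
    ((h.hasSum_sol_male ht).summable.add (h.hasSum_sol_female ht).summable)
  refine h3.of_nonneg_of_le (fun p => mul_nonneg (h.sol_nonneg ht.1 p) (by positivity)) fun p => ?_
  have e1 := sq_mul_dXX_self (1 - tau t) (1 - tau t) 1 p
  have e2 := mul_mul_dXY_self (1 - tau t) (1 - tau t) 1 p
  have e3 := sq_mul_dYY_self (1 - tau t) (1 - tau t) 1 p
  have e4 := mul_nonneg (h.sol_nonneg ht.1 p) (mul_nonneg (male_nonneg p) (female_nonneg p))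
  simp only [sol] at e4 ⊢
  linear_combination 2 * e4 - flow c₀ (tau t) p * (e1 + 2 * e2 + e3)

/-- The sum of the second moments is bounded below by the inverse of the Jacobian. -/
lemma le_jacobian_mul_second_moment (h : Admissible c₀) (ht : t ∈ timeInterval (critTime c₀)) :
    (1 - tau t) ^ 2 * (momXX c₀ + momYY c₀) ≤ jacobian c₀ (tau t) *
      (2 * bracket (sol c₀ t)
        fun p => SexedSmoluchowski.male p ^ 2 + SexedSmoluchowski.female p ^ 2) := by
  have hsub := h.subcritical_tau ht
  obtain ⟨s1, s2⟩ := h.summable_flow_second hsub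
  have hAB := h.second_derivatives_eq hsub
  set τ := tau t with hτdef
  have h1 : 0 < 1 - τ := by linarith [hsub.mem.2]
  set A := ∑' p, (1 - τ) * (flow c₀ τ p * dXX (1 - τ) (1 - τ) 1 p
        + flow c₀ τ p * dXY (1 - τ) (1 - τ) 1 p)
  set B := ∑' p, (1 - τ) * (flow c₀ τ p * dXY (1 - τ) (1 - τ) 1 p
        + flow c₀ τ p * dYY (1 - τ) (1 - τ) 1 p)
  obtain ⟨hA, hB⟩ : A = momXX c₀ * ((1 - τ) + τ * B) + momXY c₀ * ((1 - τ) + τ * A) ∧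
      B = momXY c₀ * ((1 - τ) + τ * B) + momYY c₀ * ((1 - τ) + τ * A) := hAB
  -- The left side is `⟨a² - a + 2ab + b² - b, c_t⟩`, and the weight is at most `2 (a² + b²)`.
  have hmom : (1 - τ) * (A + B) ≤ 2 * bracket (sol c₀ t)
      fun p => SexedSmoluchowski.male p ^ 2 + SexedSmoluchowski.female p ^ 2 := by
    rw [bracket, ← tsum_mul_left, ← (s1.mul_left (1 - τ)).tsum_add (s2.mul_left (1 - τ)),
      ← tsum_mul_left]
    refine Summable.tsum_le_tsum (fun p => ?_)
      (((s1.mul_left (1 - τ)).add (s2.mul_left (1 - τ))).mul_left (1 - τ))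
      ((h.summable_sol_second ht).mul_left 2)
    have e1 := sq_mul_dXX_self (1 - τ) (1 - τ) 1 p
    have e2 := mul_mul_dXY_self (1 - τ) (1 - τ) 1 p
    have e3 := sq_mul_dYY_self (1 - τ) (1 - τ) 1 p
    have e4 := mul_nonneg (h.sol_nonneg ht.1 p)
      (sq_nonneg (SexedSmoluchowski.male p - SexedSmoluchowski.female p))
    have e5 := mul_nonneg (h.sol_nonneg ht.1 p) (male_nonneg p)
    have e6 := mul_nonneg (h.sol_nonneg ht.1 p) (female_nonneg p)
    simp only [sol, ← hτdef] at e4 e5 e6 ⊢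
    linear_combination e4 + e5 + e6 + flow c₀ τ p * (e1 + 2 * e2 + e3)
  have hj := hsub.jacobian_pos
  have hr : 0 ≤ 1 - τ * momXY c₀ := (sub_pos.2 hsub.mul_momXY_lt).le
  have hu := h.momXX_nonneg
  have hs := h.momYY_nonneg
  have hr0 := h.momXY_nonneg
  have hτ0 := hsub.mem.1
  have hdet : (1 - τ) * (momXX c₀ + momYY c₀) ≤ jacobian c₀ τ * (A + B) := by
    -- Cramer's rule for the linear system; the last two terms on the right are nonnegative and are
    -- dropped afterwards.
    have key : jacobian c₀ τ * (A + B) = (1 - τ) * (momXX c₀ + momYY c₀ +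
        2 * (momXY c₀ * (1 - τ * momXY c₀)) + 2 * (τ * (momXX c₀ * momYY c₀))) := by
      unfold jacobian
      linear_combination (1 - τ * momXY c₀ + τ * momYY c₀) * hA +
        (1 - τ * momXY c₀ + τ * momXX c₀) * hB
    rw [key]
    have p1 := mul_nonneg hr0 hr
    have p2 := mul_nonneg hτ0 (mul_nonneg hu hs)
    exact mul_le_mul_of_nonneg_left (by linarith) h1.le
  calc _ = (1 - τ) * ((1 - τ) * (momXX c₀ + momYY c₀)) := by ring
    _ ≤ (1 - τ) * (jacobian c₀ τ * (A + B)) := mul_le_mul_of_nonneg_left hdet h1.le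
    _ = jacobian c₀ τ * ((1 - τ) * (A + B)) := by ring
    _ ≤ _ := mul_le_mul_of_nonneg_left hmom hj.le

/-- Otherwise `M = ⟨ab, c₀⟩`, and every type present has `a ∈ {0, 1}`, so that `ab ≤ b` and `M ≤ ⟨b,
c₀⟩ = 1`. -/
lemma second_moment_pos (h : Admissible c₀) (hM : 1 < bigM c₀) : 0 < momXX c₀ + momYY c₀ := by
  have hu := h.momXX_nonneg
  have hs := h.momYY_nonneg
  by_contra hc
  have hu0 : momXX c₀ = 0 := by linarith
  rw [bigM_eq, hu0, zero_mul, Real.sqrt_zero, add_zero] at hM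
  have hsum := h.summable_dXX.hasSum
  rw [show ∑' p, c₀ p * dXX 1 1 1 p = 0 from hu0] at hsum
  have hz := (hasSum_zero_iff_of_nonneg fun p => mul_nonneg (h.nonneg p)
    (dXX_nonneg one_pos.le one_pos.le one_pos.le p)).1 hsum
  have : momXY c₀ ≤ 1 := by
    rw [← h.female.tsum_eq]
    refine h.summable_dXY.tsum_le_tsum (fun p => ?_) h.female.summable
    rcases mul_eq_zero.1 (congrFun hz p) with h0 | h0
    · simp [h0]
    · refine mul_le_mul_of_nonneg_left ?_ (h.nonneg p)
      simp only [dXX, dXY, one_pow, mul_one, mul_eq_zero] at h0 ⊢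
      have hf := female_nonneg p
      rcases h0 with h0 | h0
      · rw [h0, zero_mul]; exact hf
      · rw [sub_eq_zero.1 h0, one_mul]
  linarith

lemma hasDerivAt_tau (ht : 0 ≤ t) : HasDerivAt tau ((1 - tau t) ^ 2) t := by
  have h1 : 1 + t ≠ 0 := by positivity
  refine ((hasDerivAt_id t).div ((hasDerivAt_id t).const_add 1) h1).congr_deriv ?_
  rw [one_sub_tau ht]
  simp only [id]
  field_simp
  ring

lemma tendsto_second_moment (h : Admissible c₀) {T : ℝ} (hT : critTime c₀ = (T : EReal)) :
    Tendsto (fun t => bracket (sol c₀ t)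
      fun p => SexedSmoluchowski.male p ^ 2 + SexedSmoluchowski.female p ^ 2) (𝓝[<] T) atTop := by
  have hM : 1 < bigM c₀ := by
    by_contra hM
    rw [critTime, if_pos (not_lt.1 hM)] at hT
    exact EReal.top_ne_coe T hT
  have hTM : T = 1 / (bigM c₀ - 1) := by
    rw [critTime, if_neg (not_le.2 hM), EReal.coe_eq_coe_iff] at hT
    exact hT.symm
  have hM1 : 0 < bigM c₀ - 1 := by linarith
  have hT0 : 0 < T := by rw [hTM]; positivity
  have hτT : tau T = 1 / bigM c₀ := by
    rw [tau, hTM]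
    field_simp
    ring
  have hmem : ∀ᶠ t in 𝓝[<] T, t ∈ timeInterval (critTime c₀) := by
    filter_upwards [Ioo_mem_nhdsLT hT0] with t ht
    exact ⟨ht.1.le, by rw [hT]; exact EReal.coe_lt_coe_iff.2 ht.2⟩
  have hτ : Tendsto tau (𝓝[<] T) (𝓝 (1 / bigM c₀)) := by
    rw [← hτT]
    exact (hasDerivAt_tau hT0.le).continuousAt.tendsto.mono_left nhdsWithin_le_nhds
  have hjc : Continuous (jacobian c₀) := by unfold jacobian; fun_prop
  -- With `q` the square root in `M`, the relation `M - momXY = q` makes the two squares in the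
  -- Jacobian equal at `1 / M`.
  have hj0 : jacobian c₀ (1 / bigM c₀) = 0 := by
    have hMne : bigM c₀ ≠ 0 := by linarith
    have e1 := Real.sq_sqrt (mul_nonneg h.momXX_nonneg h.momYY_nonneg)
    have e2 := bigM_eq c₀
    set q := √(momXX c₀ * momYY c₀)
    rw [jacobian, ← e1]
    have e3 : momXY c₀ = bigM c₀ - q := by linarith
    rw [e3]
    field_simp
    ring
  have hj : Tendsto (fun t => jacobian c₀ (tau t)) (𝓝[<] T) (𝓝[>] 0) := by
    refine tendsto_nhdsWithin_iff.2 ⟨?_, ?_⟩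
    · rw [← hj0]; exact (hjc.tendsto _).comp hτ
    · filter_upwards [hmem] with t ht using (h.subcritical_tau ht).jacobian_pos
  have hnum : Tendsto (fun t => (1 - tau t) ^ 2 * (momXX c₀ + momYY c₀) / 2) (𝓝[<] T)
      (𝓝 ((1 - 1 / bigM c₀) ^ 2 * (momXX c₀ + momYY c₀) / 2)) :=
    (((tendsto_const_nhds.sub hτ).pow 2).mul_const _).div_const 2
  have hpos : 0 < (1 - 1 / bigM c₀) ^ 2 * (momXX c₀ + momYY c₀) / 2 := by
    have h1 : 0 < 1 - 1 / bigM c₀ := by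
      rw [sub_pos, div_lt_one (by linarith)]; exact hM
    have h2 := h.second_moment_pos hM
    positivity
  refine tendsto_atTop_mono' _ ?_ (hnum.pos_mul_atTop hpos (tendsto_inv_nhdsGT_zero.comp hj))
  filter_upwards [hmem] with t ht
  have h1 := h.le_jacobian_mul_second_moment ht
  have h2 := (h.subcritical_tau ht).jacobian_pos
  simp only [Function.comp]
  rw [mul_inv_le_iff₀ h2]
  linarith

/-! ### Existence -/

lemma continuousOn_one_sub_tau (t : ℝ) : ContinuousOn (fun s => 1 - tau s) (Icc 0 t) := fun _ hs =>
  (continuousAt_const.sub (hasDerivAt_tau hs.1).continuousAt).continuousWithinAt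

/-- The derivative of `U_τ` produces the gain, by `gain_mul_monomial`. The derivative of `(1 - τ)^(a
+ b)` produces the loss, because the total rates `⟨a, c_t⟩` and `⟨b, c_t⟩` both equal `1 - τ` before
the critical time. -/
theorem isSolution_sol (h : Admissible c₀) : IsSolution c₀ (critTime c₀) (sol c₀) where
  initial := sol_zero c₀
  arms t ht := by
    refine ((h.hasSum_sol_male ht).summable.add (h.hasSum_sol_female ht).summable).congr fun p => ?_
    rw [abs_of_nonneg (h.sol_nonneg ht.1 p), mul_add]
  male_integrable t ht := by
    have hc : ContinuousOn (fun s => bracket (sol c₀ s) SexedSmoluchowski.male) (uIcc 0 t) := by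
      rw [uIcc_of_le ht.1]
      exact (continuousOn_one_sub_tau t).congr fun s hs =>
        (h.hasSum_sol_male (mem_timeInterval_of_le ht hs.1 hs.2)).tsum_eq
    exact hc.intervalIntegrable
  female_integrable t ht := by
    have hc : ContinuousOn (fun s => bracket (sol c₀ s) SexedSmoluchowski.female) (uIcc 0 t) := by
      rw [uIcc_of_le ht.1]
      exact (continuousOn_one_sub_tau t).congr fun s hs =>
        (h.hasSum_sol_female (mem_timeInterval_of_le ht hs.1 hs.2)).tsum_eq
    exact hc.intervalIntegrable
  second_moment := by
    refine ⟨1, one_pos, fun t ht _ => (h.summable_sol_second ht).congr fun p => ?_⟩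
    rw [abs_of_nonneg (h.sol_nonneg ht.1 p)]
  system t ht p := by
    have h1 := hasDerivAt_tau ht.1
    have h2 : HasDerivAt (fun s => 1 - tau s) (-(1 - tau t) ^ 2) t := h1.const_sub 1
    have h3 := (hasDerivAt_flow c₀ (tau t) p).comp t h1
    have h4 := hasDerivWithinAt_univ.1 (hasDerivWithinAt_monomial (s := univ)
      h2.hasDerivWithinAt h2.hasDerivWithinAt 1 p)
    refine ((h3.mul h4).congr_deriv ?_).hasDerivWithinAt
    have hloss : ∑' p', rate p p' * sol c₀ t p' =
        SexedSmoluchowski.female p * (1 - tau t) + SexedSmoluchowski.male p * (1 - tau t) := by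
      have := ((h.hasSum_sol_male ht).mul_left (SexedSmoluchowski.female p)).add
        ((h.hasSum_sol_female ht).mul_left (SexedSmoluchowski.male p))
      rw [← this.tsum_eq]
      exact tsum_congr fun q => by simp only [rate]; ring
    have hgain := gain_mul_monomial (flow c₀ (tau t)) (1 - tau t) (1 - tau t) p
    rw [← sol_eq, gain] at hgain
    rw [coagulation, hgain, hloss, sol]
    have e1 := mul_dX_self (1 - tau t) (1 - tau t) 1 p
    have e2 := mul_dY_self (1 - tau t) (1 - tau t) 1 p
    simp only [Function.comp]
    linear_combination -(flow c₀ (tau t) p * (1 - tau t)) * (e1 + e2)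

end Admissible

end SexedSmoluchowski

namespace SexedSmoluchowski

/-! ### Integrating factors with integrable exponents -/

/-- The exponential is Lipschitz on the bounded range of `f`. -/
lemma absolutelyContinuousOnInterval_exp {f : ℝ → ℝ} {a b : ℝ}
    (hf : AbsolutelyContinuousOnInterval f a b) :
    AbsolutelyContinuousOnInterval (fun s => Real.exp (f s)) a b := by
  obtain ⟨C, hC⟩ := hf.exists_bound
  obtain ⟨K, hK⟩ := (Real.contDiff_exp (n := 1)).contDiffOn.exists_lipschitzOnWith (by decide)
    (convex_Icc (-C) C) isCompact_Icc
  have hfC : ∀ x ∈ uIcc a b, f x ∈ Icc (-C) C := fun x hx => abs_le.1 (hC x hx)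
  rw [absolutelyContinuousOnInterval_iff] at hf ⊢
  intro ε hε
  -- The Lipschitz constant `K` may be zero, hence `K + 1`.
  obtain ⟨δ, hδ, h⟩ := hf (ε / (K + 1)) (by positivity)
  refine ⟨δ, hδ, fun E hE hEδ => ?_⟩
  calc _ ≤ ∑ i ∈ Finset.range E.1, K * dist (f (E.2 i).1) (f (E.2 i).2) :=
        Finset.sum_le_sum fun i hi =>
          hK.dist_le_mul _ (hfC _ (hE.1 i hi).1) _ (hfC _ (hE.1 i hi).2)
    _ = K * ∑ i ∈ Finset.range E.1, dist (f (E.2 i).1) (f (E.2 i).2) := (Finset.mul_sum _ _ _).symm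
    _ ≤ K * (ε / (K + 1)) := by gcongr; exact (h E hE hEδ).le
    _ < (K + 1) * (ε / (K + 1)) := by gcongr; linarith
    _ = ε := by field_simp

/-- The integrating factor identity `(u e^Λ)' = (u' + L u) e^Λ` with `Λ' = L`. The rates of a
solution are only integrable in time, so it holds almost everywhere and is integrated by absolute
continuity. -/
lemma mul_exp_primitive {L u u' : ℝ → ℝ} {t : ℝ} (ht : 0 ≤ t) (hL : Integrable L)
    (hu : ContinuousOn u (Icc 0 t)) (hd : ∀ s ∈ Ioo 0 t, HasDerivAt u (u' s) s)
    (hi : IntervalIntegrable u' volume 0 t) :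
    u t * Real.exp (∫ s in (0 : ℝ)..t, L s) =
      u 0 + ∫ s in (0 : ℝ)..t, (u' s + L s * u s) * Real.exp (∫ r in (0 : ℝ)..s, L r) := by
  have hLi : IntervalIntegrable L volume 0 t := hL.intervalIntegrable
  have hprim : ∀ s ∈ Icc 0 t, u 0 + ∫ r in (0 : ℝ)..s, u' r = u s := by
    intro s hs
    rw [intervalIntegral.integral_eq_sub_of_hasDerivAt_of_le hs.1 (hu.mono (Icc_subset_Icc_right hs.2))
      (fun r hr => hd r ⟨hr.1, hr.2.trans_le hs.2⟩)
      (hi.mono_set (by rw [uIcc_of_le hs.1, uIcc_of_le ht]; exact Icc_subset_Icc_right hs.2))]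
    ring
  have hU : AbsolutelyContinuousOnInterval (fun s => u 0 + ∫ r in (0 : ℝ)..s, u' r) 0 t :=
    ((LipschitzWith.const (u 0)).lipschitzOnWith (s := uIcc 0 t)).absolutelyContinuousOnInterval.add
      (hi.absolutelyContinuousOnInterval_intervalIntegral left_mem_uIcc)
  have hG := absolutelyContinuousOnInterval_exp
    (hLi.absolutelyContinuousOnInterval_intervalIntegral left_mem_uIcc)
  have key := hU.integral_deriv_mul_eq_sub hG
  simp only [intervalIntegral.integral_same, Real.exp_zero, mul_one, add_zero] at key
  rw [hprim t (right_mem_Icc.2 ht)] at key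
  rw [← sub_eq_iff_eq_add', ← key]
  refine intervalIntegral.integral_congr_ae ?_
  filter_upwards [hi.ae_hasDerivAt_integral, hLi.ae_hasDerivAt_integral] with s h1 h2 hs
  have hs' := uIoc_subset_uIcc hs
  rw [((h1 hs' 0 left_mem_uIcc).const_add (u 0)).deriv, ((h2 hs' 0 left_mem_uIcc).exp).deriv,
    hprim s (by rwa [uIcc_of_le ht] at hs')]
  ring

/-! ### Uniqueness -/

/-- The total number of arms of the kind counted by `w`, set to zero outside `[0, T₁]`. -/
def armRate (c : ℝ → S → ℝ) (w : S → ℝ) (T₁ : ℝ) : ℝ → ℝ :=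
  (Icc 0 T₁).indicator fun s => bracket (c s) w

/-- The integrating factor of the loss term. -/
def damping (c : ℝ → S → ℝ) (w : S → ℝ) (T₁ t : ℝ) : ℝ :=
  Real.exp (-∫ s in (0 : ℝ)..t, armRate c w T₁ s)

/-- The time change that turns a solution into the flow of the gain term. -/
def clock (c : ℝ → S → ℝ) (T₁ t : ℝ) : ℝ :=
  ∫ s in (0 : ℝ)..t, damping c female T₁ s * damping c male T₁ s

lemma damping_pos (c : ℝ → S → ℝ) (w : S → ℝ) (T₁ t : ℝ) : 0 < damping c w T₁ t := Real.exp_pos _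

lemma continuous_damping {c : ℝ → S → ℝ} {w : S → ℝ} {T₁ : ℝ} (h : Integrable (armRate c w T₁)) :
    Continuous (damping c w T₁) := (h.continuous_primitive 0).neg.rexp

lemma damping_eq {c : ℝ → S → ℝ} {w : S → ℝ} {T₁ t : ℝ} (ht : 0 ≤ t)
    (h : Integrable (armRate c w T₁)) :
    damping c w T₁ t = 1 - ∫ s in (0 : ℝ)..t, armRate c w T₁ s * damping c w T₁ s := by
  have := mul_exp_primitive (u := fun _ => 1) (u' := fun _ => 0) ht h.neg continuousOn_const
    (fun s _ => hasDerivAt_const s 1) intervalIntegrable_const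
  simp only [Pi.neg_apply, intervalIntegral.integral_neg, one_mul, zero_add, mul_one, neg_mul] at this
  rw [damping, this, ← sub_eq_add_neg]
  rfl

namespace IsSolution

variable {c₀ : S → ℝ} {c : ℝ → S → ℝ} {T : EReal} {T₁ s t : ℝ}

lemma summable_male (hc : IsSolution c₀ T c) (ht : t ∈ timeInterval T) :
    Summable fun p => c t p * male p :=
  (hc.arms t ht).of_norm_bounded fun p => by
    rw [norm_mul, Real.norm_eq_abs, Real.norm_of_nonneg (male_nonneg p)]
    exact mul_le_mul_of_nonneg_left (le_add_of_nonneg_right (female_nonneg p)) (abs_nonneg _)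

lemma summable_female (hc : IsSolution c₀ T c) (ht : t ∈ timeInterval T) :
    Summable fun p => c t p * female p :=
  (hc.arms t ht).of_norm_bounded fun p => by
    rw [norm_mul, Real.norm_eq_abs, Real.norm_of_nonneg (female_nonneg p)]
    exact mul_le_mul_of_nonneg_left (le_add_of_nonneg_left (male_nonneg p)) (abs_nonneg _)

lemma integrable_armRate_male (hc : IsSolution c₀ T c) (hT : T₁ ∈ timeInterval T) :
    Integrable (armRate c male T₁) :=
  (integrable_indicator_iff measurableSet_Icc).2 <| (integrableOn_Icc_iff_integrableOn_Ioc).2 <|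
    (intervalIntegrable_iff_integrableOn_Ioc_of_le hT.1).1 (hc.male_integrable T₁ hT)

lemma integrable_armRate_female (hc : IsSolution c₀ T c) (hT : T₁ ∈ timeInterval T) :
    Integrable (armRate c female T₁) :=
  (integrable_indicator_iff measurableSet_Icc).2 <| (integrableOn_Icc_iff_integrableOn_Ioc).2 <|
    (intervalIntegrable_iff_integrableOn_Ioc_of_le hT.1).1 (hc.female_integrable T₁ hT)

lemma hasDerivAt (hc : IsSolution c₀ T c) (hT : T₁ ∈ timeInterval T) (hs : s ∈ Ioo 0 T₁) (p : S) :
    HasDerivAt (fun r => c r p) (coagulation (c s) p) s :=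
  (hc.system s (mem_timeInterval_of_le hT hs.1.le hs.2.le) p).hasDerivAt <|
    mem_of_superset (Icc_mem_nhds hs.1 hs.2) fun _ hr => mem_timeInterval_of_le hT hr.1 hr.2

lemma continuousOn (hc : IsSolution c₀ T c) (hT : T₁ ∈ timeInterval T) (p : S) :
    ContinuousOn (fun r => c r p) (Icc 0 T₁) := fun s hs =>
  (hc.system s (mem_timeInterval_of_le hT hs.1 hs.2) p).continuousWithinAt.mono
    fun _ hr => mem_timeInterval_of_le hT hr.1 hr.2

lemma coagulation_eq (hc : IsSolution c₀ T c) (hT : T₁ ∈ timeInterval T) (hs : s ∈ Icc 0 T₁) (p : S) :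
    coagulation (c s) p = gain (c s) p - c s p *
      (female p * armRate c male T₁ s +
        male p * armRate c female T₁ s) := by
  have hs' := mem_timeInterval_of_le hT hs.1 hs.2
  rw [coagulation, gain, armRate, armRate, indicator_of_mem hs, indicator_of_mem hs]
  congr 2
  have := ((hc.summable_male hs').hasSum.mul_left (female p)).add
    ((hc.summable_female hs').hasSum.mul_left (male p))
  rw [bracket, bracket, ← this.tsum_eq]
  exact tsum_congr fun q => by simp only [rate]; ring

lemma intervalIntegrable_coagulation (hc : IsSolution c₀ T c) (hT : T₁ ∈ timeInterval T)
    (ht : t ∈ Icc 0 T₁) (p : S) :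
    IntervalIntegrable (fun s => coagulation (c s) p) volume 0 t := by
  have hsub : uIcc 0 t ⊆ Icc 0 T₁ := by rw [uIcc_of_le ht.1]; exact Icc_subset_Icc_right ht.2
  have h1 : IntervalIntegrable (fun s => gain (c s) p) volume 0 t :=
    (continuousOn_gain fun q _ => (hc.continuousOn hT q).mono hsub).intervalIntegrable
  have h2 := ((((hc.integrable_armRate_male hT).const_mul (female p)).add
    ((hc.integrable_armRate_female hT).const_mul
      (male p))).intervalIntegrable (a := 0) (b := t)).continuousOn_mul
    ((hc.continuousOn hT p).mono hsub)
  refine (h1.sub h2).congr fun s hs => ?_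
  exact (hc.coagulation_eq hT (hsub (uIoc_subset_uIcc hs)) p).symm

lemma continuous_dampings (hc : IsSolution c₀ T c) (hT : T₁ ∈ timeInterval T) :
    Continuous fun s => damping c female T₁ s *
      damping c male T₁ s :=
  (continuous_damping (hc.integrable_armRate_female hT)).mul
    (continuous_damping (hc.integrable_armRate_male hT))

lemma hasDerivAt_clock (hc : IsSolution c₀ T c) (hT : T₁ ∈ timeInterval T) (t : ℝ) :
    HasDerivAt (clock c T₁) (damping c female T₁ t *
      damping c male T₁ t) t :=
  (hc.continuous_dampings hT).integral_hasStrictDerivAt 0 t |>.hasDerivAt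

lemma monotone_clock (hc : IsSolution c₀ T c) (hT : T₁ ∈ timeInterval T) :
    Monotone (clock c T₁) :=
  monotone_of_hasDerivAt_nonneg (hc.hasDerivAt_clock hT) fun _ =>
    mul_nonneg (damping_pos _ _ _ _).le (damping_pos _ _ _ _).le

/-- A male arm is lost at rate `⟨b, c⟩` and a female arm at rate `⟨a, c⟩`, so the integrating
factors `X`, `Y` carry the exponents `a`, `b`. By `gain_mul_monomial` the gain of `U X^a Y^b` has an
extra factor `X Y`, which is the speed of the clock. The induction on the mass uses that the gain
involves only lighter types. -/
lemma eq_flow_clock (hc : IsSolution c₀ T c) (hT : T₁ ∈ timeInterval T) (ht : t ∈ Icc 0 T₁) (p : S) :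
    c t p = flow c₀ (clock c T₁ t) p * monomial (damping c female T₁ t)
      (damping c male T₁ t) 1 p := by
  obtain ⟨n, hn⟩ : ∃ n : ℕ, (p.2.2 : ℕ) = n := ⟨_, rfl⟩
  induction n using Nat.strong_induction_on generalizing p t with
  | _ n ih =>
    have hM := hc.integrable_armRate_male hT
    have hF := hc.integrable_armRate_female hT
    have hL : Integrable fun s => female p * armRate c male T₁ s +
        male p * armRate c female T₁ s :=
      (hM.const_mul _).add (hF.const_mul _)
    have hexp : ∀ s, monomial (damping c female T₁ s)
        (damping c male T₁ s) 1 p *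
        Real.exp (∫ r in (0 : ℝ)..s, (female p * armRate c male T₁ r +
          male p * armRate c female T₁ r)) = 1 := by
      intro s
      rw [intervalIntegral.integral_add (hM.const_mul _).intervalIntegrable
        (hF.const_mul _).intervalIntegrable, intervalIntegral.integral_const_mul,
        intervalIntegral.integral_const_mul, monomial, damping, damping, ← Real.exp_nat_mul,
        ← Real.exp_nat_mul, one_pow, mul_one, ← Real.exp_add, ← Real.exp_add, Real.exp_eq_one_iff,
        male, female]
      ring
    have key := mul_exp_primitive ht.1 hL ((hc.continuousOn hT p).mono (Icc_subset_Icc_right ht.2))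
      (fun s hs => hc.hasDerivAt hT ⟨hs.1, hs.2.trans_le ht.2⟩ p)
      (hc.intervalIntegrable_coagulation hT ht p)
    have hflow : ∫ s in (0 : ℝ)..t, gain (flow c₀ (clock c T₁ s)) p *
        (damping c female T₁ s * damping c male T₁ s) =
        flow c₀ (clock c T₁ t) p - c₀ p := by
      have hcc : Continuous (clock c T₁) :=
        continuous_iff_continuousAt.2 fun s => (hc.hasDerivAt_clock hT s).continuousAt
      rw [intervalIntegral.integral_eq_sub_of_hasDerivAt
        (f := fun s => flow c₀ (clock c T₁ s) p)
        (fun s _ => (hasDerivAt_flow c₀ (clock c T₁ s) p).comp s (hc.hasDerivAt_clock hT s))]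
      · simp [clock]
      · exact (((continuous_gain (continuous_flow c₀) p).comp hcc).mul
          (hc.continuous_dampings hT)).intervalIntegrable _ _
    have hint : ∫ s in (0 : ℝ)..t, (coagulation (c s) p +
        (female p * armRate c male T₁ s +
          male p * armRate c female T₁ s) * c s p) *
        Real.exp (∫ r in (0 : ℝ)..s, (female p * armRate c male T₁ r +
          male p * armRate c female T₁ r)) =
        flow c₀ (clock c T₁ t) p - c₀ p := by
      rw [← hflow]
      refine intervalIntegral.integral_congr fun s hs => ?_
      rw [uIcc_of_le ht.1] at hs
      have hs' : s ∈ Icc 0 T₁ := ⟨hs.1, hs.2.trans ht.2⟩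
      have hg : gain (c s) p = _ := (gain_congr fun q hq => ih _ (hn ▸ hq) hs' q rfl).trans
        (gain_mul_monomial (flow c₀ (clock c T₁ s)) _ _ p)
      simp only [hc.coagulation_eq hT hs' p, hg]
      linear_combination (damping c female T₁ s *
        damping c male T₁ s * gain (flow c₀ (clock c T₁ s)) p) * hexp s
    rw [hint, hc.initial, add_sub_cancel] at key
    rw [← key, mul_assoc, mul_comm (Real.exp _), hexp, mul_one]

end IsSolution

end SexedSmoluchowski

/-! ### Identification of the clock of an arbitrary solution -/

namespace SexedSmoluchowski

namespace IsSolution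

variable {c₀ : S → ℝ} {c : ℝ → S → ℝ} {T : EReal} {T₁ s t : ℝ}

lemma clock_nonneg (hc : IsSolution c₀ T c) (hT : T₁ ∈ timeInterval T) (ht : 0 ≤ t) :
    0 ≤ clock c T₁ t := by
  have := hc.monotone_clock hT ht
  rwa [clock, intervalIntegral.integral_same] at this

lemma nonneg (hc : IsSolution c₀ T c) (h : Admissible c₀) (hT : T₁ ∈ timeInterval T)
    (ht : t ∈ Icc 0 T₁) (p : S) : 0 ≤ c t p := by
  rw [hc.eq_flow_clock hT ht p]
  exact mul_nonneg (h.flow_nonneg (hc.clock_nonneg hT ht.1) p)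
    (monomial_nonneg (damping_pos _ _ _ _).le (damping_pos _ _ _ _).le zero_le_one p)

/-- A Lyapunov estimate for finite sums against a solution. -/
lemma sum_le_mul_damping (hc : IsSolution c₀ T c) (hT : T₁ ∈ timeInterval T) (ht : t ∈ Icc 0 T₁)
    {w v : S → ℝ} (hv : Integrable (armRate c v T₁)) (A : Finset S)
    (hA : ∀ s ∈ Icc 0 T₁, ∑ p ∈ A, w p * coagulation (c s) p ≤
      -(armRate c v T₁ s * ∑ p ∈ A, w p * c s p)) :
    ∑ p ∈ A, w p * c t p ≤ (∑ p ∈ A, w p * c₀ p) * damping c v T₁ t := by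
  have key := mul_exp_primitive (u := fun s => ∑ p ∈ A, w p * c s p)
    (u' := fun s => ∑ p ∈ A, w p * coagulation (c s) p) ht.1 hv
    (continuousOn_finsetSum _ fun p _ => continuousOn_const.mul
      ((hc.continuousOn hT p).mono (Icc_subset_Icc_right ht.2)))
    (fun s hs => HasDerivAt.fun_sum fun p _ =>
      (hc.hasDerivAt hT ⟨hs.1, hs.2.trans_le ht.2⟩ p).const_mul (w p))
    (by
      have := IntervalIntegrable.sum A (f := fun p s => w p * coagulation (c s) p)
        fun p _ => (hc.intervalIntegrable_coagulation hT ht p).const_mul (w p)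
      simpa only [Finset.sum_fn] using this)
  have hneg : ∫ s in (0 : ℝ)..t, (∑ p ∈ A, w p * coagulation (c s) p +
      armRate c v T₁ s * ∑ p ∈ A, w p * c s p) *
        Real.exp (∫ r in (0 : ℝ)..s, armRate c v T₁ r) ≤ 0 := by
    rw [← neg_nonneg, ← intervalIntegral.integral_neg]
    refine intervalIntegral.integral_nonneg ht.1 fun s hs => ?_
    have := hA s ⟨hs.1, hs.2.trans ht.2⟩
    rw [neg_nonneg]
    exact mul_nonpos_of_nonpos_of_nonneg (by linarith) (Real.exp_pos _).le
  rw [hc.initial] at key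
  rw [damping, Real.exp_neg, ← div_eq_mul_inv, le_div_iff₀ (Real.exp_pos _)]
  linarith

lemma bracket_le_damping (hc : IsSolution c₀ T c) (hT : T₁ ∈ timeInterval T) (ht : t ∈ Icc 0 T₁)
    {w v : S → ℝ} (hv : Integrable (armRate c v T₁)) (hw : ∀ p, 0 ≤ w p)
    (hc0 : ∀ s ∈ Icc 0 T₁, ∀ p, 0 ≤ c s p) (hw1 : HasSum (fun p => c₀ p * w p) 1)
    (hA : ∀ s ∈ Icc 0 T₁, ∀ N, ∑ p ∈ trunc N, w p * coagulation (c s) p ≤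
      -(armRate c v T₁ s * ∑ p ∈ trunc N, w p * c s p)) :
    armRate c w T₁ t ≤ damping c v T₁ t := by
  rw [armRate, indicator_of_mem ht, bracket]
  have hT0 : (0 : ℝ) ∈ Icc 0 T₁ := left_mem_Icc.2 hT.1
  refine Real.tsum_le_of_sum_le (fun p => mul_nonneg (hc0 t ht p) (hw p)) fun F => ?_
  obtain ⟨N, hN⟩ := exists_subset_trunc F
  have h1 : ∑ p ∈ trunc N, w p * c₀ p ≤ 1 := by
    rw [← hw1.tsum_eq]
    simp only [mul_comm (w _)]
    exact hw1.summable.sum_le_tsum _ fun p _ => mul_nonneg (hc.initial ▸ hc0 0 hT0 p) (hw p)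
  calc _ ≤ ∑ p ∈ trunc N, c t p * w p :=
        Finset.sum_le_sum_of_subset_of_nonneg hN fun p _ _ => mul_nonneg (hc0 t ht p) (hw p)
    _ = ∑ p ∈ trunc N, w p * c t p := Finset.sum_congr rfl fun p _ => mul_comm _ _
    _ ≤ _ := hc.sum_le_mul_damping hT ht hv _ fun s hs => hA s hs N
    _ ≤ _ := mul_le_of_le_one_left (damping_pos _ _ _ _).le h1

lemma sum_male_le_armRate (hc : IsSolution c₀ T c) (h : Admissible c₀) (hT : T₁ ∈ timeInterval T)
    (hs : s ∈ Icc 0 T₁) (A : Finset S) : ∑ p ∈ A, c s p * male p ≤ armRate c male T₁ s := by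
  rw [armRate, indicator_of_mem hs]
  exact (hc.summable_male (mem_timeInterval_of_le hT hs.1 hs.2)).sum_le_tsum _
    fun p _ => mul_nonneg (hc.nonneg h hT hs p) (male_nonneg p)

lemma sum_female_le_armRate (hc : IsSolution c₀ T c) (h : Admissible c₀) (hT : T₁ ∈ timeInterval T)
    (hs : s ∈ Icc 0 T₁) (A : Finset S) : ∑ p ∈ A, c s p * female p ≤ armRate c female T₁ s := by
  rw [armRate, indicator_of_mem hs]
  exact (hc.summable_female (mem_timeInterval_of_le hT hs.1 hs.2)).sum_le_tsum _
    fun p _ => mul_nonneg (hc.nonneg h hT hs p) (female_nonneg p)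

/-- On a truncation the gain of male arms involves the truncated rates, the loss the full ones. The
terms with second derivatives therefore have a favourable sign, and what remains is `A' ≤ -⟨b, c⟩ A`
for the truncated number `A` of male arms. -/
lemma armRate_male_le (hc : IsSolution c₀ T c) (h : Admissible c₀) (hT : T₁ ∈ timeInterval T)
    (ht : t ∈ Icc 0 T₁) : armRate c male T₁ t ≤ damping c female T₁ t := by
  refine hc.bracket_le_damping hT ht (hc.integrable_armRate_female hT) male_nonneg
    (fun s hs => hc.nonneg h hT hs) h.male fun s hs N => ?_
  have hU := hc.nonneg h hT hs
  have h1 := (leibniz_dX 1 1 1).sum_gain_le (hereditary_trunc N) hU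
    (dX_nonneg zero_le_one zero_le_one zero_le_one)
  have hA := hc.sum_male_le_armRate h hT hs (trunc N)
  have hB := hc.sum_female_le_armRate h hT hs (trunc N)
  have h2 : 0 ≤ ∑ p ∈ trunc N, c s p * dXX 1 1 1 p := Finset.sum_nonneg fun p _ =>
    mul_nonneg (hU p) (dXX_nonneg zero_le_one zero_le_one zero_le_one p)
  have h3 : 0 ≤ ∑ p ∈ trunc N, c s p * dXY 1 1 1 p := Finset.sum_nonneg fun p _ =>
    mul_nonneg (hU p) (dXY_nonneg zero_le_one zero_le_one zero_le_one p)
  have e : ∑ p ∈ trunc N, male p * coagulation (c s) p =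
      ∑ p ∈ trunc N, dX 1 1 1 p * gain (c s) p
        - (∑ p ∈ trunc N, c s p * dXY 1 1 1 p) * armRate c male T₁ s
        - (∑ p ∈ trunc N, c s p * dXX 1 1 1 p) * armRate c female T₁ s
        - armRate c female T₁ s * ∑ p ∈ trunc N, male p * c s p := by
    rw [Finset.sum_mul, Finset.sum_mul, Finset.mul_sum, ← Finset.sum_sub_distrib,
      ← Finset.sum_sub_distrib, ← Finset.sum_sub_distrib]
    refine Finset.sum_congr rfl fun p _ => ?_
    rw [hc.coagulation_eq hT hs]
    simp only [dX, dXX, dXY, one_pow]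
    ring
  have h4 := mul_le_mul_of_nonneg_left hB h2
  have h5 := mul_le_mul_of_nonneg_right hA h3
  simp only [dX, dY, one_pow, mul_one] at h1 e
  rw [e]
  linarith

lemma armRate_female_le (hc : IsSolution c₀ T c) (h : Admissible c₀) (hT : T₁ ∈ timeInterval T)
    (ht : t ∈ Icc 0 T₁) : armRate c female T₁ t ≤ damping c male T₁ t := by
  refine hc.bracket_le_damping hT ht (hc.integrable_armRate_male hT) female_nonneg
    (fun s hs => hc.nonneg h hT hs) h.female fun s hs N => ?_
  have hU := hc.nonneg h hT hs
  have h1 := (leibniz_dY 1 1 1).sum_gain_le (hereditary_trunc N) hU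
    (dY_nonneg zero_le_one zero_le_one zero_le_one)
  have hA := hc.sum_male_le_armRate h hT hs (trunc N)
  have hB := hc.sum_female_le_armRate h hT hs (trunc N)
  have h2 : 0 ≤ ∑ p ∈ trunc N, c s p * dYY 1 1 1 p := Finset.sum_nonneg fun p _ =>
    mul_nonneg (hU p) (dYY_nonneg zero_le_one zero_le_one zero_le_one p)
  have h3 : 0 ≤ ∑ p ∈ trunc N, c s p * dXY 1 1 1 p := Finset.sum_nonneg fun p _ =>
    mul_nonneg (hU p) (dXY_nonneg zero_le_one zero_le_one zero_le_one p)
  have e : ∑ p ∈ trunc N, female p * coagulation (c s) p =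
      ∑ p ∈ trunc N, dY 1 1 1 p * gain (c s) p
        - (∑ p ∈ trunc N, c s p * dXY 1 1 1 p) * armRate c female T₁ s
        - (∑ p ∈ trunc N, c s p * dYY 1 1 1 p) * armRate c male T₁ s
        - armRate c male T₁ s * ∑ p ∈ trunc N, female p * c s p := by
    rw [Finset.sum_mul, Finset.sum_mul, Finset.mul_sum, ← Finset.sum_sub_distrib,
      ← Finset.sum_sub_distrib, ← Finset.sum_sub_distrib]
    refine Finset.sum_congr rfl fun p _ => ?_
    rw [hc.coagulation_eq hT hs]
    simp only [dY, dYY, dXY, one_pow]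
    ring
  have h4 := mul_le_mul_of_nonneg_left hA h2
  have h5 := mul_le_mul_of_nonneg_right hB h3
  simp only [dX, dY, one_pow, mul_one] at h1 e
  rw [e]
  linarith

lemma armRate_mul_damping_intervalIntegrable {w : S → ℝ} (hv : Integrable (armRate c w T₁)) :
    IntervalIntegrable (fun s => armRate c w T₁ s * damping c w T₁ s) volume 0 t :=
  hv.intervalIntegrable.mul_continuousOn (continuous_damping hv).continuousOn

/-- `X = 1 - ∫ ⟨b, c⟩ X ≥ 1 - ∫ Y X = 1 - σ`, by the bound `⟨b, c⟩ ≤ Y`. -/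
lemma one_sub_clock_le_female (hc : IsSolution c₀ T c) (h : Admissible c₀)
    (hT : T₁ ∈ timeInterval T) (ht : t ∈ Icc 0 T₁) :
    1 - clock c T₁ t ≤ damping c female T₁ t := by
  have hF := hc.integrable_armRate_female hT
  rw [damping_eq ht.1 hF, clock]
  refine sub_le_sub_left (intervalIntegral.integral_mono_on ht.1
    (armRate_mul_damping_intervalIntegrable hF)
    ((hc.continuous_dampings hT).intervalIntegrable 0 t) fun s hs => ?_) 1
  rw [mul_comm]
  exact mul_le_mul_of_nonneg_left (hc.armRate_female_le h hT ⟨hs.1, hs.2.trans ht.2⟩)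
    (damping_pos _ _ _ _).le

lemma one_sub_clock_le_male (hc : IsSolution c₀ T c) (h : Admissible c₀)
    (hT : T₁ ∈ timeInterval T) (ht : t ∈ Icc 0 T₁) :
    1 - clock c T₁ t ≤ damping c male T₁ t := by
  have hM := hc.integrable_armRate_male hT
  rw [damping_eq ht.1 hM, clock]
  refine sub_le_sub_left (intervalIntegral.integral_mono_on ht.1
    (armRate_mul_damping_intervalIntegrable hM)
    ((hc.continuous_dampings hT).intervalIntegrable 0 t) fun s hs => ?_) 1
  exact mul_le_mul_of_nonneg_right (hc.armRate_male_le h hT ⟨hs.1, hs.2.trans ht.2⟩)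
    (damping_pos _ _ _ _).le

/-- The converse bound: `⟨a, c⟩ = X g_x(X, Y, 1) ≥ X g_x(1 - σ, 1 - σ, 1) = X`, because `X, Y ≥ 1 -
σ` and no arm is lost in the flow at the subcritical time `σ`. -/
lemma armRate_eq_damping (hc : IsSolution c₀ T c) (h : Admissible c₀) (hT : T₁ ∈ timeInterval T)
    (ht : t ∈ Icc 0 T₁) (hσ : Subcritical c₀ (clock c T₁ t)) :
    armRate c male T₁ t = damping c female T₁ t ∧
      armRate c female T₁ t = damping c male T₁ t := by
  have hx := hc.one_sub_clock_le_female h hT ht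
  have hy := hc.one_sub_clock_le_male h hT ht
  have hx0 := damping_pos c female T₁ t
  have hy0 := damping_pos c male T₁ t
  have ht' := mem_timeInterval_of_le hT ht.1 ht.2
  have hs0 : 0 ≤ 1 - clock c T₁ t := by linarith [hσ.mem.2]
  obtain ⟨hP, hQ⟩ := h.flowD_corner hσ
  refine ⟨(hc.armRate_male_le h hT ht).antisymm ?_, (hc.armRate_female_le h hT ht).antisymm ?_⟩
  · rw [armRate, indicator_of_mem ht, bracket, ← mul_one (damping _ _ _ _), ← hP, flowDx,
      ← tsum_mul_left]
    refine ((h.summable_flow_dX_corner hσ.mem).mul_left _).tsum_le_tsum (fun p => ?_)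
      (hc.summable_male ht')
    rw [hc.eq_flow_clock hT ht p, mul_assoc (flow _ _ _), mul_comm (monomial _ _ _ _), ← mul_dX_self,
      mul_left_comm]
    exact mul_le_mul_of_nonneg_left (mul_le_mul_of_nonneg_left
      (dX_mono hs0 hs0 zero_le_one hx hy le_rfl p) hx0.le) (h.flow_nonneg hσ.mem.1 p)
  · rw [armRate, indicator_of_mem ht, bracket, ← mul_one (damping _ _ _ _), ← hQ, flowDy,
      ← tsum_mul_left]
    refine ((h.summable_flow_dY_corner hσ.mem).mul_left _).tsum_le_tsum (fun p => ?_)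
      (hc.summable_female ht')
    rw [hc.eq_flow_clock hT ht p, mul_assoc (flow _ _ _), mul_comm (monomial _ _ _ _), ← mul_dY_self,
      mul_left_comm]
    exact mul_le_mul_of_nonneg_left (mul_le_mul_of_nonneg_left
      (dY_mono hs0 hs0 zero_le_one hx hy le_rfl p) hy0.le) (h.flow_nonneg hσ.mem.1 p)

lemma damping_eq_one_sub_clock (hc : IsSolution c₀ T c) (h : Admissible c₀)
    (hT : T₁ ∈ timeInterval T) (ht : t ∈ Icc 0 T₁)
    (hσ : ∀ s ∈ Icc 0 t, Subcritical c₀ (clock c T₁ s)) :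
    damping c female T₁ t = 1 - clock c T₁ t ∧ damping c male T₁ t = 1 - clock c T₁ t := by
  rw [damping_eq ht.1 (hc.integrable_armRate_female hT),
    damping_eq ht.1 (hc.integrable_armRate_male hT), clock]
  constructor <;> refine congrArg _ (intervalIntegral.integral_congr fun s hs => ?_) <;>
    rw [uIcc_of_le ht.1] at hs <;>
    obtain ⟨e1, e2⟩ := hc.armRate_eq_damping h hT ⟨hs.1, hs.2.trans ht.2⟩ (hσ s hs)
  · simp only [e2]; ring
  · simp only [e1]

/-- Once `X = Y = 1 - σ`, the clock solves `σ' = (1 - σ)²` with `σ(0) = 0`, so `1 / (1 - σ) - t` is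
constant. -/
lemma clock_eq_of_subcritical (hc : IsSolution c₀ T c) (h : Admissible c₀)
    (hT : T₁ ∈ timeInterval T) (ht : t ∈ Icc 0 T₁)
    (hσ : ∀ s ∈ Icc 0 t, Subcritical c₀ (clock c T₁ s)) : clock c T₁ t = tau t := by
  have h0 : clock c T₁ 0 = 0 := by simp [clock]
  have hne : ∀ s ∈ Icc 0 t, 1 - clock c T₁ s ≠ 0 := fun s hs => by linarith [(hσ s hs).mem.2]
  have hd : ∀ s ∈ Icc 0 t, HasDerivAt (fun r => (1 - clock c T₁ r)⁻¹ - r) 0 s := by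
    intro s hs
    obtain ⟨e1, e2⟩ := hc.damping_eq_one_sub_clock h hT ⟨hs.1, hs.2.trans ht.2⟩
      fun r hr => hσ r ⟨hr.1, hr.2.trans hs.2⟩
    have h1 := hc.hasDerivAt_clock hT s
    rw [e1, e2] at h1
    refine (((h1.const_sub 1).inv (hne s hs)).sub (hasDerivAt_id s)).congr_deriv ?_
    have := hne s hs
    field_simp
    ring
  have hconst := constant_of_derivWithin_zero
    (fun s hs => (hd s hs).differentiableAt.differentiableWithinAt)
    (fun s hs => (hd s (Ico_subset_Icc_self hs)).hasDerivWithinAt.derivWithin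
      (uniqueDiffOn_Icc (hs.1.trans_lt hs.2) s (Ico_subset_Icc_self hs)))
    t (right_mem_Icc.2 ht.1)
  simp only [h0, sub_zero, inv_one] at hconst
  have h2 : (1 - clock c T₁ t)⁻¹ = 1 + t := by linarith
  have h3 : 1 - clock c T₁ t = 1 / (1 + t) := by rw [← h2, one_div, inv_inv]
  have h4 := one_sub_tau ht.1
  linarith

/-- If the clock exceeded `τ(T₁)` at time `T₁`, it would take at some `r ≤ T₁` a value `κ > τ(T₁)`
that is still subcritical. Up to time `r` the clock is then equal to `τ`, so `κ = τ(r) ≤ τ(T₁)`, a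
contradiction. -/
lemma subcritical_clock (hc : IsSolution c₀ (critTime c₀) c) (h : Admissible c₀)
    (hT : T₁ ∈ timeInterval (critTime c₀)) (ht : t ∈ Icc 0 T₁) :
    Subcritical c₀ (clock c T₁ t) := by
  have hmono := hc.monotone_clock hT
  obtain ⟨hτ0, hτ1⟩ := tau_mem hT.1
  have hτM := (mem_timeInterval_iff.1 hT).2
  have hM0 : 0 ≤ bigM c₀ := by
    rw [bigM_eq]
    have : 0 ≤ momXY c₀ := tsum_nonneg fun p =>
      mul_nonneg (h.nonneg p) (dXY_nonneg zero_le_one zero_le_one zero_le_one p)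
    positivity
  suffices hle : clock c T₁ T₁ ≤ tau T₁ by
    have h1 := (hmono ht.2).trans hle
    exact h.subcritical ⟨hc.clock_nonneg hT ht.1, h1.trans_lt hτ1⟩
      ((mul_le_mul_of_nonneg_right h1 hM0).trans_lt hτM)
  by_contra! hlt
  obtain ⟨κ, ⟨hκ, hκσ⟩, hκ1, hκM⟩ : ∃ κ ∈ Ioc (tau T₁) (clock c T₁ T₁), κ < 1 ∧ κ * bigM c₀ < 1 := by
    have h1 : ∀ᶠ κ in 𝓝[>] tau T₁, κ < 1 := nhdsWithin_le_nhds (gt_mem_nhds hτ1)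
    have h2 : ∀ᶠ κ in 𝓝[>] tau T₁, κ * bigM c₀ < 1 := nhdsWithin_le_nhds
      ((continuous_id.mul continuous_const).continuousAt.eventually_lt continuousAt_const hτM)
    have h3 : ∀ᶠ κ in 𝓝[>] tau T₁, κ ∈ Ioc (tau T₁) (clock c T₁ T₁) := Ioc_mem_nhdsGT hlt
    obtain ⟨κ, h3, h4, h5⟩ := (h3.and (h1.and h2)).exists
    exact ⟨κ, h3, h4, h5⟩
  have hcont : ContinuousOn (clock c T₁) (Icc 0 T₁) := fun s _ =>
    (hc.hasDerivAt_clock hT s).continuousAt.continuousWithinAt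
  obtain ⟨r, hr, hrκ⟩ := intermediate_value_Icc hT.1 hcont
    (show κ ∈ Icc _ _ from ⟨by rw [clock, intervalIntegral.integral_same]; linarith, hκσ⟩)
  have hr' := hc.clock_eq_of_subcritical h hT hr fun s hs => by
    have h1 := hmono hs.2
    rw [hrκ] at h1
    exact h.subcritical ⟨hc.clock_nonneg hT hs.1, h1.trans_lt hκ1⟩
      ((mul_le_mul_of_nonneg_right h1 hM0).trans_lt hκM)
  have h1 := one_sub_tau hr.1
  have h2 := one_sub_tau hT.1
  have h3 : 1 / (1 + T₁) ≤ 1 / (1 + r) :=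
    one_div_le_one_div_of_le (by linarith [hr.1]) (by linarith [hr.2])
  linarith

theorem eq_sol (hc : IsSolution c₀ (critTime c₀) c) (h : Admissible c₀)
    (ht : t ∈ timeInterval (critTime c₀)) (p : S) : c t p = sol c₀ t p := by
  have hmem : t ∈ Icc 0 t := right_mem_Icc.2 ht.1
  have hσ : ∀ s ∈ Icc 0 t, Subcritical c₀ (clock c t s) := fun s hs => hc.subcritical_clock h ht hs
  obtain ⟨e1, e2⟩ := hc.damping_eq_one_sub_clock h ht hmem hσ
  rw [hc.eq_flow_clock ht hmem, e1, e2, hc.clock_eq_of_subcritical h ht hmem hσ, sol]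

end IsSolution

end SexedSmoluchowski

end

theorem theorem1 (c₀ : S → ℝ) (hnonneg : ∀ p, 0 ≤ c₀ p) (hone : Summable c₀)
    (hmale : HasSum (fun p => c₀ p * male p) 1)
    (hfemale : HasSum (fun p => c₀ p * female p) 1)
    (hsecond : Summable fun p => c₀ p * (male p ^ 2 + female p ^ 2)) :
    ∃ c : ℝ → S → ℝ,
      -- existence and uniqueness on the whole interval before the critical time
      IsSolution c₀ (critTime c₀) c ∧
      (∀ c' : ℝ → S → ℝ, IsSolution c₀ (critTime c₀) c' →
        ∀ t ∈ timeInterval (critTime c₀), ∀ p, c' t p = c t p) ∧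
      -- second moments: finite before the critical time, blowing up there if it is finite
      (∀ t ∈ timeInterval (critTime c₀),
        Summable fun p => c t p * (male p ^ 2 + female p ^ 2)) ∧
      (∀ T : ℝ, critTime c₀ = (T : EReal) →
        Tendsto (fun t => bracket (c t) fun p => male p ^ 2 + female p ^ 2) (𝓝[<] T) atTop) ∧
      -- the right inverse and the generating function
      (∃ h : ℝ → ℝ → ℝ × ℝ → ℝ × ℝ,
        (∀ t ∈ timeInterval (critTime c₀), ∀ z ∈ Icc (0 : ℝ) 1,
          IsRightInverse c₀ t z (h t z) ∧
          (∀ h' : ℝ × ℝ → ℝ × ℝ, IsRightInverse c₀ t z h' → EqOn h' (h t z) square) ∧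
          ContinuousOn (h t z) square ∧
          AnalyticOnNhd ℝ (h t z) (Ioo 0 1 ×ˢ Ioo 0 1)) ∧
        (∀ t ∈ timeInterval (critTime c₀), 0 < t →
          IntervalIntegrable (massIntegrand c₀ (h t)) volume 0 1 ∧
          ∀ x ∈ Icc (0 : ℝ) 1, ∀ y ∈ Icc (0 : ℝ) 1, ∀ z ∈ Icc (0 : ℝ) 1,
            HasSum (fun p => c t p * monomial x y z p)
              (1 / (1 + t) * (bigTilde2 t (h t z) x y + bigTilde1 t (h t z) 0 y)
                + bigG c₀ (h t) z))) ∧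
      -- conservation of the total mass, finite or not
      (∀ t ∈ timeInterval (critTime c₀),
        ((Summable fun p => c t p * mass p) ↔ Summable fun p => c₀ p * mass p) ∧
        bracket (c t) mass = bracket c₀ mass) := by
  have h : Admissible c₀ := ⟨hnonneg, hone, hmale, hfemale, hsecond⟩
  refine ⟨sol c₀, h.isSolution_sol, fun c' hc' t ht p => hc'.eq_sol h ht p,
    fun t ht => h.summable_sol_second ht, fun T hT => h.tendsto_second_moment hT,
    ⟨fun t z => foot c₀ (tau t) z, fun t ht z hz => ⟨h.isRightInverse_foot ht.1 hz,
      fun h' hh => h.eqOn_foot ht hz hh, h.continuousOn_foot_square (tau_mem ht.1) hz,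
      h.analyticOnNhd_foot (tau_mem ht.1) hz⟩, fun t ht ht0 =>
      ⟨(h.massIntegrand_spec (tau_mem ht.1)).1, fun x hx y hy z hz =>
        h.hasSum_sol_monomial ht0 hx hy hz⟩⟩,
    fun t ht => h.mass_conservation ht⟩
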